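/- **Setting.** Let $K,L,M\ge 1$ and $R$ be integers, $N=(K+M)L$. An *$(L,M,K,R)$-chandelier* is a rooted tree with $L$ branches, each consisting of a path with $M$ edges starting at the root, followed by a rooted tree with $K$ edges (a *bulb*) attached at the end of the path; the $L$ bulbs are pairwise non-isomorphic as rooted trees and each has at most $R$ automorphisms. Let $\mathcal T$ be the family of isomorphism classes of $(L,M,K,R)$-chandeliers (each has $N$ edges), and let $\mathsf{aut}(H)$ be the number of root-preserving automorphisms of $H$. Let $\mathcal J(K)$ be the set of unlabeled rooted trees with $K$ edges and let $\alpha\approx0.338$ be Otter's constant, $|\mathcal J(K)|=(\alpha+o(1))^{-K}$. Let $A,B$ be graphs on $[n]$, $n\ge1$, let $q\in[0,1]$, and let $\bar A=A-q$, $\bar B=B-q$ be the centered adjacency matrices. For a matrix $W\in\{\bar A,\bar B\}$, a coloring $\mu:[n]\to[N+1]$, a rooted tree $H$ with $N$ edges and $i\in[n]$ put $$X_{i,H}(W,\mu)=\sum_{S(i)\cong H}\mathbf 1\{\mu\text{ is injective on }V(S)\}\prod_{\{u,v\}\in E(S)}W_{uv},$$ where $S(i)$ runs over the subgraphs of the complete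 graph on $[n]$ that contain $i$, rooted at $i$. Let $r=(N+1)!/(N+1)^{N+1}$, $t=\lceil 1/r\rceil$, let $\mu_1,\dots,\mu_t,\nu_1,\dots,\nu_t$ be i.i.d. uniformly random colorings $[n]\to[N+1]$, and $$\tilde\Phi_{ij}=\frac1{r^2}\sum_{H\in\mathcal T}\mathsf{aut}(H)\Big(\frac1t\sum_{a=1}^tX_{i,H}(\bar A,\mu_a)\Big)\Big(\frac1t\sum_{a=1}^tX_{j,H}(\bar B,\nu_a)\Big).$$ **Algorithm.** On input $\bar A,\bar B,K,L,M,N,R$: (1) list all unlabeled rooted trees with $K$ edges by the Beyer–Hedetniemi successor rule on level sequences, compute the number of automorphisms of each, and keep those with at most $R$ automorphisms; (2) form all chandeliers from the $L$-element subsets of this list; (3) draw the $2t$ random colorings; (4) for every $a\le t$ and $H\in\mathcal T$ compute all $X_{i,H}(\bar A,\mu_a)$ and $X_{j,H}(\bar B,\nu_a)$ by color-coding dynamic programming: for a rooted tree $T$ obtained from $T_1$ by attaching $T_2$ to its root by a new edge, $$Y(x,T,C)=\sum_{y\in[n]}\ \sum_{(C_1,C_2)}W_{xy}\,Y(x,T_1,C_1)\,Y(y,T_2,C_2),$$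 where $(C_1,C_2)$ runs over the partitions of the color set $C$ into two parts with $|C_k|=|V(T_k)|$, with $Y(x,\bullet,C)=\mathbf 1\{C=\{\mu(x)\}\}$ for the one-vertex tree $\bullet$, and $X_{i,H}=Y(i,H,[N+1])/\mathsf{aut}(H)$; (5) output the numbers $\tilde\Phi_{ij}$, $i,j\in[n]$. Running time is the number of elementary steps with unit cost for arithmetic operations and comparisons, operations on subsets of $[N+1]$, elementary list and tree operations, array reads and writes, and random draws. **Proposition.** For every outcome of the random colorings the algorithm outputs $\{\tilde\Phi_{ij}\}_{i,j\in[n]}$, and its running time is $$O\big(n^2(3e/\alpha)^N\big)$$ with an absolute constant in $O(\cdot)$. Furthermore, let $C_1,\dots,C_4>0$ be absolute constants, $0<\epsilon\le1$, $nq\ge2$, and let $K,L,M,R$ be chosen as $$L=\frac{C_1}{\epsilon},\qquad K=C_2\log n,\qquad M=\frac{C_3K}{\log(nq)},\qquad R=\exp(C_4K),$$ each rounded to an integer (moved by at most $1$, with $K,L,M\ge1$). Then the running time is $O(n^{c/\epsilon})$, where $c$ and the constant in $O(\cdot)$ depend only on $C_1,\dots,C_4$ (so they are absolute). -/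

import Mathlib

open Filter Topology

namespace OtterMatching

/-! # Rooted graphs, unlabeled rooted trees, chandeliers -/

/-- A graph with a distinguished vertex. -/
@[ext] structure RootedGraph (V : Type*) where
  graph : SimpleGraph V
  root : V

namespace RootedGraph

/-- Isomorphisms of rooted graphs: graph isomorphisms that map root to root. -/
def Iso {V W : Type*} (G : RootedGraph V) (H : RootedGraph W) : Type _ :=
  {e : G.graph ≃g H.graph // e G.root = H.root}

/-- `G ≅ H` as rooted graphs. -/
def IsIso {V W : Type*} (G : RootedGraph V) (H : RootedGraph W) : Prop :=
  Nonempty (G.Iso H)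

/-- The number of automorphisms of a rooted graph. -/
noncomputable def aut {V : Type*} (G : RootedGraph V) : ℕ := Nat.card (G.Iso G)

theorem IsIso.refl {V : Type*} (G : RootedGraph V) : G.IsIso G :=
  ⟨⟨SimpleGraph.Iso.refl, rfl⟩⟩

theorem IsIso.symm {V W : Type*} {G : RootedGraph V} {H : RootedGraph W}
    (h : G.IsIso H) : H.IsIso G := by
  obtain ⟨e, he⟩ := h
  exact ⟨⟨e.symm, by rw [← he]; exact e.symm_apply_apply _⟩⟩

theorem IsIso.trans {U V W : Type*} {F : RootedGraph U} {G : RootedGraph V} {H : RootedGraph W}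
    (h₁ : F.IsIso G) (h₂ : G.IsIso H) : F.IsIso H := by
  obtain ⟨e, he⟩ := h₁
  obtain ⟨f, hf⟩ := h₂
  exact ⟨⟨f.comp e, by
    change f (e F.root) = H.root
    rw [he, hf]⟩⟩

instance instSetoid (V : Type*) : Setoid (RootedGraph V) where
  r G H := G.IsIso H
  iseqv := ⟨IsIso.refl, IsIso.symm, IsIso.trans⟩

instance instFinite (V : Type*) [Finite V] : Finite (RootedGraph V) :=
  Finite.of_injective (fun G : RootedGraph V => (G.graph, G.root)) (by
    rintro ⟨g, r⟩ ⟨g', r'⟩ h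
    simp only [Prod.mk.injEq] at h
    obtain ⟨rfl, rfl⟩ := h
    rfl)

end RootedGraph

/-- Unlabeled rooted graphs with `m` vertices: isomorphism classes of rooted graphs. -/
abbrev Unlabeled (m : ℕ) : Type := Quotient (RootedGraph.instSetoid (Fin m))

/-- The collection `J(K)` of all unlabeled rooted trees with `K` edges. -/
def rootedTrees (K : ℕ) : Set (Unlabeled (K + 1)) := {c | c.out.graph.IsTree}

/-- `α` is Otter's constant: the number of unlabeled rooted trees with `K` edges is
`(α + o(1)) ^ (-K)`. -/
def IsOtterConstant (α : ℝ) : Prop :=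
  0 < α ∧ Tendsto (fun K : ℕ => ((rootedTrees K).ncard : ℝ) ^ (1 / (K : ℝ))) atTop (𝓝 α⁻¹)

/-- The vertices of a chandelier (for `1 ≤ M`): the root, the `M - 1` interior vertices of each
of the `L` wires, and the `K + 1` vertices of each of the `L` bulbs. -/
inductive ChandelierVertex (L M K : ℕ) : Type
  | root : ChandelierVertex L M K
  | wire (l : Fin L) (m : Fin (M - 1)) : ChandelierVertex L M K
  | bulb (l : Fin L) (v : Fin (K + 1)) : ChandelierVertex L M K

/-- The `m`-th vertex, `0 ≤ m ≤ M`, of the `l`-th wire: the wire starts at the root of the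
chandelier and ends at the root of the `l`-th bulb. -/
def wireVertex {L M K : ℕ} (B : Fin L → RootedGraph (Fin (K + 1))) (l : Fin L) (m : ℕ) :
    ChandelierVertex L M K :=
  if m = 0 then .root
  else if h : m - 1 < M - 1 then .wire l ⟨m - 1, h⟩
  else .bulb l (B l).root

/-- The rooted graph with `L` branches, the `l`-th of which is a path with `M` edges followed by
the bulb `B l` (for `1 ≤ M`). -/
def chandelierGraph {L : ℕ} (M : ℕ) {K : ℕ} (B : Fin L → RootedGraph (Fin (K + 1))) :
    RootedGraph (ChandelierVertex L M K) where
  graph := SimpleGraph.fromRel fun x y =>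
    (∃ l, ∃ m < M, x = wireVertex B l m ∧ y = wireVertex B l (m + 1)) ∨
    (∃ l u v, x = .bulb l u ∧ y = .bulb l v ∧ (B l).graph.Adj u v)
  root := .root

/-- `H` is an `(L, M, K, R)`-chandelier (for `1 ≤ M`): the bulbs are pairwise non-isomorphic
rooted trees with `K` edges, each with at most `R` automorphisms. -/
def IsChandelier {V : Type*} (L M K R : ℕ) (H : RootedGraph V) : Prop :=
  ∃ B : Fin L → RootedGraph (Fin (K + 1)),
    (∀ l, (B l).graph.IsTree ∧ (B l).aut ≤ R) ∧
    (∀ l l', l ≠ l' → ¬ (B l).IsIso (B l')) ∧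
    H.IsIso (chandelierGraph M B)

/-- The family `T` of unlabeled `(L, M, K, R)`-chandeliers with `N = (K + M) L` edges. -/
def chandeliers (L M K R N : ℕ) : Set (Unlabeled (N + 1)) := {c | IsChandelier L M K R c.out}

/-! # Color-coded signed counts and the approximate similarity scores -/

open Classical in
/-- The centered adjacency matrix `A - q`. -/
noncomputable def centered {n : ℕ} (A : SimpleGraph (Fin n)) (q : ℝ) :
    Matrix (Fin n) (Fin n) ℝ :=
  fun u v => A.adjMatrix ℝ u v - q

open Classical in
/-- `X_{i,H}(M, μ)`: the sum, over the subgraphs `S` of the complete graph on `[n]` that contain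
`i` and are isomorphic to `H` when rooted at `i`, of the indicator that `μ` is injective on
`V(S)` times the product of the weights `M_e` of the edges of `S`. The edge `e = {u, v}`, `u < v`,
has `u = e.inf` and `v = e.sup`. -/
noncomputable def colorfulCount {n N : ℕ} (M : Matrix (Fin n) (Fin n) ℝ)
    (μ : Fin n → Fin (N + 1)) (H : RootedGraph (Fin (N + 1))) (i : Fin n) : ℝ :=
  ∑ S : (⊤ : SimpleGraph (Fin n)).Subgraph,
    if ∃ hi : i ∈ S.verts, RootedGraph.IsIso ⟨S.coe, ⟨i, hi⟩⟩ H then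
      (if Set.InjOn μ S.verts then 1 else 0) * ∏ e ∈ S.edgeSet.toFinset, M e.inf e.sup
    else 0

/-- The probability that a uniform coloring with `N + 1` colors is injective on a given set of
`N + 1` vertices. -/
noncomputable def colorfulProb (N : ℕ) : ℝ :=
  ((N + 1).factorial : ℝ) / ((N + 1 : ℕ) : ℝ) ^ (N + 1)

/-- The number `t = ⌈1 / r⌉` of random colorings of each graph. -/
noncomputable def numColorings (N : ℕ) : ℕ := ⌈1 / colorfulProb N⌉₊

/-- The approximate similarity score of `i` and `j`, for the weighted adjacency matrices `MA` and
`MB` and the outcomes `μ 0, …, μ (t - 1)` and `ν 0, …, ν (t - 1)` of the random colorings. -/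
noncomputable def approxScore (L M K R : ℕ) {n N : ℕ} (MA MB : Matrix (Fin n) (Fin n) ℝ)
    (μ ν : ℕ → Fin n → Fin (N + 1)) (i j : Fin n) : ℝ :=
  1 / colorfulProb N ^ 2 *
    ∑ H ∈ (Set.toFinite (chandeliers L M K R N)).toFinset,
      (H.out.aut : ℝ) *
        (1 / (numColorings N : ℝ) *
          ∑ a ∈ Finset.range (numColorings N), colorfulCount MA (μ a) H.out i) *
        (1 / (numColorings N : ℝ) *
          ∑ a ∈ Finset.range (numColorings N), colorfulCount MB (ν a) H.out j)

/-! # The cost model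

A computation returns a value together with the number of elementary steps it has taken.
One step is charged for: an arithmetic operation or a comparison (on natural numbers or on
scalars), a set operation on subsets of the set of colors (such a subset is one machine word),
building or taking apart one list cell, pair or tree node, a function call, one iteration of a
loop, reading or writing one array cell, drawing one random color. An array is modelled by the
function that maps an index to the content of the cell. -/

structure Timed (α : Type*) where
  val : α
  time : ℕ

namespace Timed

instance : Monad Timed where
  pure a := ⟨a, 0⟩
  bind x f := ⟨(f x.val).val, x.time + (f x.val).time⟩

/-- One elementary step with result `a`. -/
def step {α : Type*} (a : α) : Timed α := ⟨a, 1⟩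

/-- `k` elementary steps with overall result `a`. -/
def steps {α : Type*} (k : ℕ) (a : α) : Timed α := ⟨a, k⟩

/-- Run `body` on the elements of a list, one after the other, updating a state. -/
def loop {α σ : Type} (body : σ → α → Timed σ) : List α → σ → Timed σ
  | [], s => step s
  | a :: l, s => do
    let a ← step a
    let s ← body s a
    loop body l s

/-- Apply `f` to every element of a list. -/
def mapList {α β : Type} (f : α → Timed β) : List α → Timed (List β)
  | [] => step []
  | a :: l => do
    let a ← step a
    let b ← f a
    let l ← mapList f l
    step (b :: l)

/-- Concatenate two lists. -/
def append {α : Type} : List α → List α → Timed (List α)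
  | [], m => step m
  | a :: l, m => do
    let a ← step a
    let l ← append l m
    step (a :: l)

end Timed

open Timed

/-! # The algorithm -/

/-- Rooted trees as data: `leaf` has a single vertex, and `join t c` is obtained from `t` by
attaching `c` to the root of `t` through a new edge, as the last child. -/
inductive PlaneTree : Type
  | leaf : PlaneTree
  | join (t c : PlaneTree) : PlaneTree

/-! ## Listing the rooted trees with `K` edges

A rooted tree is encoded by the depths of its vertices in preorder. The list is kept in reverse
(last vertex first). Starting from the path, the successor of a level sequence is found as
follows: let `p` be the last vertex of depth at least `2`, let `q` be its parent; the entries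
before `p` are kept, and the entries from `p` on are overwritten by cyclic repetition of the
entries from `q` to `p - 1`. There is no successor if no vertex has depth at least `2`. -/

/-- Split off the initial entries that are less than `2`: their number, the first entry that is
at least `2`, and the entries behind it. -/
def dropShallow : List ℕ → Timed (Option (ℕ × ℕ × List ℕ))
  | [] => step none
  | a :: l => do
    let a ← step a
    let b ← step (decide (a < 2))
    if b then
      match ← dropShallow l with
      | none => step none
      | some (k, p, r) =>
        let k ← step (k + 1)
        step (some (k, p, r))
    else
      step (some (0, a, l))

/-- Collect, in reverse, the initial entries up to and including the first one equal to `d`. -/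
def takeBlock (d : ℕ) : List ℕ → List ℕ → Timed (List ℕ)
  | [], acc => step acc
  | a :: l, acc => do
    let a ← step a
    let acc ← step (a :: acc)
    let b ← step (decide (a = d))
    if b then step acc else takeBlock d l acc

/-- Push `k` entries onto `acc`: first those of `cur`, then those of `block`, cyclically. -/
def fillCyclic (block : List ℕ) : ℕ → List ℕ → List ℕ → Timed (List ℕ)
  | 0, _, acc => step acc
  | k + 1, b :: cur, acc => do
    let b ← step b
    let acc ← step (b :: acc)
    fillCyclic block k cur acc
  | k + 1, [], acc => do
    match ← step block with
    | [] => step acc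
    | b :: cur =>
      let acc ← step (b :: acc)
      fillCyclic block k cur acc

/-- The successor of a (reversed) level sequence. -/
def nextLevels (l : List ℕ) : Timed (Option (List ℕ)) := do
  match ← dropShallow l with
  | none => step none
  | some (k, p, r) =>
    let d ← step (p - 1)
    let block ← takeBlock d r []
    let k ← step (k + 1)
    let s ← fillCyclic block k block r
    step (some s)

/-- The level sequence `l` and its successors, until there is none. The first argument only
bounds the length of the list; it plays no role in the computation as long as it is at least
the number of sequences to be listed. -/
def levelsFrom : ℕ → List ℕ → Timed (List (List ℕ))
  | 0, _ => step []
  | fuel + 1, l => do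
    match ← nextLevels l with
    | none => step [l]
    | some l' =>
      let r ← levelsFrom fuel l'
      step (l :: r)

/-- The (reversed) level sequence of the path with `K` edges. -/
def pathLevels : ℕ → Timed (List ℕ)
  | 0 => step [0]
  | k + 1 => do
    let l ← pathLevels k
    step ((k + 1) :: l)

/-- Attach to `t`, whose root has depth `d`, the trees on top of the stack whose roots have
depth `d + 1`. -/
def absorb (d : ℕ) : PlaneTree → List (ℕ × PlaneTree) → Timed (PlaneTree × List (ℕ × PlaneTree))
  | t, [] => step (t, [])
  | t, (e, c) :: s => do
    let b ← step (decide (e = d + 1))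
    if b then
      let t ← step (PlaneTree.join t c)
      absorb d t s
    else
      step (t, (e, c) :: s)

/-- The tree with the given (reversed) level sequence. -/
def treeOfLevels (l : List ℕ) : Timed PlaneTree := do
  let s ← loop (fun (s : List (ℕ × PlaneTree)) d => do
    let (t, s) ← absorb d PlaneTree.leaf s
    step ((d, t) :: s)) l []
  match s with
  | [] => step PlaneTree.leaf
  | (_, t) :: _ => step t

/-! ## Automorphisms -/

/-- Are two plane trees equal? -/
def equalTrees : PlaneTree → PlaneTree → Timed Bool
  | .leaf, .leaf => step true
  | .leaf, .join _ _ => step false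
  | .join _ _, .leaf => step false
  | .join t c, .join t' c' => do
    let b ← equalTrees t t'
    let b' ← equalTrees c c'
    step (b && b')

/-- The number of children of the root of the second tree whose subtree equals `c`. -/
def countChildren (c : PlaneTree) : PlaneTree → Timed ℕ
  | .leaf => step 0
  | .join t c' => do
    let k ← countChildren c t
    let b ← equalTrees c c'
    if b then step (k + 1) else step k

/-- The number of automorphisms of a rooted tree in canonical form (in which isomorphic siblings
carry equal plane trees): a factor `m!` for each group of `m` isomorphic siblings. -/
def autTree : PlaneTree → Timed ℕ
  | .leaf => step 1
  | .join t c => do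
    let a ← autTree t
    let b ← autTree c
    let m ← countChildren c t
    let m ← step (m + 1)
    let ab ← step (a * b)
    step (ab * m)

/-- The trees of a list that have at most `R` automorphisms, with the number of these. -/
def selectBulbs (R : ℕ) : List (List ℕ) → Timed (List (PlaneTree × ℕ))
  | [] => step []
  | l :: ls => do
    let t ← treeOfLevels l
    let a ← autTree t
    let r ← selectBulbs R ls
    let b ← step (decide (a ≤ R))
    if b then step ((t, a) :: r) else step r

/-- The list of all rooted trees with `K` edges and at most `R` automorphisms. -/
def listBulbs (K R : ℕ) : Timed (List (PlaneTree × ℕ)) := do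
  let l ← pathLevels K
  let ls ← levelsFrom ((K + 1) ^ (K + 1)) l
  selectBulbs R ls

/-! ## Chandeliers -/

/-- All sublists of length `k`. -/
def combinations {α : Type} : ℕ → List α → Timed (List (List α))
  | 0, _ => step [[]]
  | _ + 1, [] => step []
  | k + 1, a :: l => do
    let s ← combinations k l
    let s ← mapList (fun c => step (a :: c)) s
    let s' ← combinations (k + 1) l
    append s s'

/-- Put a path with `m` edges on top of a tree. -/
def hang : ℕ → PlaneTree → Timed PlaneTree
  | 0, t => step t
  | m + 1, t => do
    let t ← hang m t
    step (PlaneTree.join PlaneTree.leaf t)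

/-- The chandelier with the given bulbs and wires with `M` edges, and its number of
automorphisms, which is the product of those of the bulbs. -/
def buildChandelier (M : ℕ) (bulbs : List (PlaneTree × ℕ)) : Timed (PlaneTree × ℕ) :=
  loop (fun (s : PlaneTree × ℕ) b => do
    let m ← step (M - 1)
    let branch ← hang m b.1
    let t ← step (PlaneTree.join s.1 branch)
    let a ← step (s.2 * b.2)
    step (t, a)) bulbs (PlaneTree.leaf, 1)

/-- The list of all chandeliers with `L` bulbs out of the given list. -/
def listChandeliers (L M : ℕ) (J : List (PlaneTree × ℕ)) : Timed (List (PlaneTree × ℕ)) := do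
  let c ← combinations L J
  mapList (buildChandelier M) c

/-! ## Counting colorful copies by dynamic programming -/

/-- A set of colors. -/
abbrev ColorSet (N : ℕ) : Type := Finset (Fin (N + 1))

/-- For every pair of sizes `(a, b)` the list of the pairs of disjoint sets of colors `(C₁, C₂)`
with `|C₁| = a` and `|C₂| = b`. -/
abbrev SplitTable (N : ℕ) : Type := ℕ → ℕ → List (ColorSet N × ColorSet N)

/-- All pairs of disjoint sets of colors. -/
def listSplits (N : ℕ) : Timed (List (ColorSet N × ColorSet N)) :=
  loop (fun (l : List (ColorSet N × ColorSet N)) c =>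
    loop (fun (r : List (ColorSet N × ColorSet N)) C => do
      let C₁ ← step (insert c C.1)
      let C₂ ← step (insert c C.2)
      let r ← step (C :: r)
      let r ← step ((C₁, C.2) :: r)
      step ((C.1, C₂) :: r)) l []) (List.finRange (N + 1)) [(∅, ∅)]

/-- Sort the pairs of disjoint sets of colors by their sizes; finding the size of a set takes
`N + 1` steps, and setting up the table one step for each of its `(N + 2) ^ 2` cells. -/
def buildSplits (N : ℕ) : Timed (SplitTable N) := do
  let l ← listSplits N
  let S ← steps ((N + 2) ^ 2) (fun _ _ => [])
  loop (fun (S : SplitTable N) C => do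
    let a ← steps (N + 1) C.1.card
    let b ← steps (N + 1) C.2.card
    let old ← step (S a b)
    let new ← step (C :: old)
    step (Function.update S a (Function.update (S a) b new))) l S

/-- An array indexed by the vertices and the sets of colors. -/
abbrev ColorTable (F : Type) (n N : ℕ) : Type := Fin n → ColorSet N → F

/-- Write one cell. -/
def ColorTable.write {F : Type} {n N : ℕ} (Y : ColorTable F n N) (x : Fin n) (C : ColorSet N)
    (v : F) : Timed (ColorTable F n N) :=
  step (Function.update Y x (Function.update (Y x) C v))

/-- A table filled with zeros. -/
def zeroTable (F : Type) [Field F] (n N : ℕ) : Timed (ColorTable F n N) :=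
  steps (n * 2 ^ (N + 1)) (fun _ _ => 0)

/-- The table of the single-vertex tree: `Y(x, C) = 1` if `C = {μ(x)}` and `0` otherwise. -/
def leafTable {F : Type} [Field F] {n N : ℕ} (μ : Fin n → Fin (N + 1)) :
    Timed (ColorTable F n N) := do
  let Y ← zeroTable F n N
  loop (fun (Y : ColorTable F n N) x => do
    let c ← step (μ x)
    let C ← step {c}
    Y.write x C 1) (List.finRange n) Y

/-- The table of `join t c` from those of `t` and `c`:
`Y(x, C) = ∑_y ∑_{(C₁, C₂)} M_{xy} Y_t(x, C₁) Y_c(y, C₂)`, where `(C₁, C₂)` runs over the given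
pairs with `C₁ ∪ C₂ = C`. -/
def joinTable {F : Type} [Field F] {n N : ℕ} (M : Matrix (Fin n) (Fin n) F)
    (splits : List (ColorSet N × ColorSet N)) (Yt Yc : ColorTable F n N) :
    Timed (ColorTable F n N) := do
  let Y ← zeroTable F n N
  loop (fun (Y : ColorTable F n N) (C : ColorSet N × ColorSet N) => do
    let U ← step (C.1 ∪ C.2)
    loop (fun (Y : ColorTable F n N) x =>
      loop (fun (Y : ColorTable F n N) y => do
        let m ← step (M x y)
        let u ← step (Yt x C.1)
        let v ← step (Yc y C.2)
        let old ← step (Y x U)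
        let mu ← step (m * u)
        let muv ← step (mu * v)
        let new ← step (old + muv)
        Y.write x U new) (List.finRange n) Y) (List.finRange n) Y) splits Y

/-- The number of vertices and the table of a tree. -/
def treeTable {F : Type} [Field F] {n N : ℕ} (M : Matrix (Fin n) (Fin n) F)
    (S : SplitTable N) (μ : Fin n → Fin (N + 1)) :
    PlaneTree → Timed (ℕ × ColorTable F n N)
  | .leaf => do
    let Y ← leafTable μ
    step (1, Y)
  | .join t c => do
    let (a, Yt) ← treeTable M S μ t
    let (b, Yc) ← treeTable M S μ c
    let splits ← step (S a b)
    let Y ← joinTable M splits Yt Yc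
    let ab ← step (a + b)
    step (ab, Y)

/-- Add to the array `acc` the colorful counts `X_{i,H}(M, μ) = Y(i, [N+1]) / aut(H)`. -/
def addCounts {F : Type} [Field F] {n N : ℕ} (M : Matrix (Fin n) (Fin n) F)
    (S : SplitTable N) (μ : Fin n → Fin (N + 1)) (H : PlaneTree) (aut : ℕ) (acc : Fin n → F) :
    Timed (Fin n → F) := do
  let (_, Y) ← treeTable M S μ H
  let C ← step Finset.univ
  let a ← step (aut : F)
  loop (fun (acc : Fin n → F) i => do
    let y ← step (Y i C)
    let x ← step (y / a)
    let old ← step (acc i)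
    let new ← step (old + x)
    step (Function.update acc i new)) (List.finRange n) acc

/-! ## Putting things together -/

/-- `(k!, b ^ k)`, by `k` rounds of multiplications. -/
def factorialAndPower (b : ℕ) : ℕ → Timed (ℕ × ℕ)
  | 0 => step (1, 1)
  | k + 1 => do
    let (f, p) ← factorialAndPower b k
    let k ← step (k + 1)
    let f ← step (f * k)
    let p ← step (p * b)
    step (f, p)

/-- Draw a random coloring with outcome `μ`, vertex by vertex. -/
def drawColoring {n N : ℕ} (μ : Fin n → Fin (N + 1)) : Timed (Fin n → Fin (N + 1)) :=
  loop (fun (c : Fin n → Fin (N + 1)) x => do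
    let color ← step (μ x)
    step (Function.update c x color)) (List.finRange n) (fun _ => 0)

/-- Approximate similarity scores via color coding. The inputs are the centered adjacency matrices
`MA` and `MB` and the integers `K`, `L`, `M`, `N`, `R`. The sequences `μ` and `ν` are the outcomes
of the random colorings, of which the algorithm draws the first `t`. -/
def approxScores {F : Type} [Field F] {n : ℕ} (K L M N R : ℕ) (MA MB : Matrix (Fin n) (Fin n) F)
    (μ ν : ℕ → Fin n → Fin (N + 1)) : Timed (Fin n → Fin n → F) := do
  -- list the bulbs and the chandeliers
  let J ← listBulbs K R
  let T ← listChandeliers L M J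
  -- compute `r` and `t`, and draw the random colorings
  let (f, p) ← factorialAndPower (N + 1) (N + 1)
  let r ← step ((f : F) / (p : F))
  let t ← steps 3 ((p + f - 1) / f)
  let colorings ← mapList (fun a => do
    let c ← drawColoring (μ a)
    let d ← drawColoring (ν a)
    step (c, d)) (List.range t)
  -- for each pair of colorings and each chandelier, compute and accumulate the colorful counts
  let S ← buildSplits N
  let records ← mapList (fun H : PlaneTree × ℕ =>
    steps (2 * n) (H, ((fun _ => 0 : Fin n → F), (fun _ => 0 : Fin n → F)))) T
  let records ← loop (fun (records : List ((PlaneTree × ℕ) × (Fin n → F) × (Fin n → F))) c =>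
    mapList (fun rec => do
      let XA ← addCounts MA S c.1 rec.1.1 rec.1.2 rec.2.1
      let XB ← addCounts MB S c.2 rec.1.1 rec.1.2 rec.2.2
      step (rec.1, XA, XB)) records) colorings records
  -- output the scores
  let t' ← step (t : F)
  let Φ ← steps (n ^ 2) (fun _ _ => 0)
  let Φ ← loop (fun (Φ : Fin n → Fin n → F)
      (rec : (PlaneTree × ℕ) × (Fin n → F) × (Fin n → F)) => do
    let a ← step (rec.1.2 : F)
    loop (fun (Φ : Fin n → Fin n → F) i => do
      let x ← step (rec.2.1 i)
      let x ← step (x / t')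
      let ax ← step (a * x)
      loop (fun (Φ : Fin n → Fin n → F) j => do
        let y ← step (rec.2.2 j)
        let y ← step (y / t')
        let axy ← step (ax * y)
        let old ← step (Φ i j)
        let new ← step (old + axy)
        step (Function.update Φ i (Function.update (Φ i) j new))) (List.finRange n) Φ)
      (List.finRange n) Φ) records Φ
  let rr ← step (r * r)
  loop (fun (Φ : Fin n → Fin n → F) i =>
    loop (fun (Φ : Fin n → Fin n → F) j => do
      let old ← step (Φ i j)
      let new ← step (old / rr)
      step (Function.update Φ i (Function.update (Φ i) j new))) (List.finRange n) Φ)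
    (List.finRange n) Φ

/-! # The choice of the parameters -/

/-- `k` is obtained from the real number `x` by rounding it to an integer, up or down, with a
shift by at most one. -/
def IsRounding (k : ℕ) (x : ℝ) : Prop := |(k : ℝ) - x| ≤ 1

/-- `L = C₁ / ε`, `K = C₂ log n`, `M = C₃ K / log (n q)`, `R = exp (C₄ K)`, each of them rounded to
an integer. -/
def IsSimpleChoice (C₁ C₂ C₃ C₄ ε q : ℝ) (n K L M R : ℕ) : Prop :=
  IsRounding L (C₁ / ε) ∧
  IsRounding K (C₂ * Real.log n) ∧
  IsRounding M (C₃ * K / Real.log (n * q)) ∧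
  IsRounding R (Real.exp (C₄ * K))

end OtterMatching

open OtterMatching

/-! Correctness. Rooted trees are handled as iterated joins (`PlaneTree`), and the structural facts
rest on one count, `card_iso_join`: an isomorphism from `join t c` to `s` amounts to a child of `s`
receiving the root of `c`, an isomorphism of `c` with the subtree there, and an isomorphism of `t`
with the rest of `s`. It yields uniqueness of canonical forms (`IsCanon.eq_of_isIso`), the
automorphism counts (`val_autTree`, `aut_chandelierTree`) and the recovery of the bulbs from a
chandelier.

A tree is canonical if at every vertex the level sequences of the children do not increase. On level
sequences this is a condition that passes to infixes (`SiblingsSorted`), and overwriting the tail by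
cyclic repetition gives the largest canonical sequence below the current one
(`IsCanonLevels.le_successor`). Starting from the path, the largest sequence, and stopping at the
star, the smallest, the listing therefore meets every rooted tree exactly once. Chandeliers then
correspond to `L`-element sublists of the list of bulbs (`nodup_allChandeliers`,
`mem_chandeliers_iff`).

The table of a tree holds weighted sums over all maps of the tree into `[n]` with prescribed root
and with distinct colors forming a prescribed set (`treeCount`); these sums multiply over joins
(`val_treeTable`). For the full color set such maps are copies of the tree, and each subgraph is the
image of exactly `aut(H)` of them (`aut_mul_colorfulCount`), so dividing by `aut(H)` leaves the
colorful count.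

Running time. The leading term is the product of the number of chandeliers, the number of colorings,
the number of joins per tree, the number of pairs of color sets of the relevant sizes, and `n ^ 2`.
A bound `(3e/α)^N` without a polynomial or subexponential loss needs three estimates. First, hanging
two trees from a new root gives `|J(i)| |J(j)| ≤ 2 |J(i + j + 2)|`; Fekete's lemma then proves that
Otter's constant exists and gives `|J(K)| ≤ (2 / α²) α^(-K)` for every `K`. The constant, raised to
the power `L`, is beaten by the `L!` in the binomial coefficient. Second, trinomial coefficients are
at most of order `3^N / √N`. Third, Stirling's formula bounds the number of colorings by order `e^N
/ √N`. The two square roots cancel the `N + 1` vertices of a tree. All remaining costs, including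
the listing, are absorbed because `3e > 8`.

For the simple choice of the parameters, `N` is at most a constant times `log n / ε`, so an
exponential in `N` is a power of `n` with exponent of order `1 / ε`. -/

namespace OtterMatching

/-! # Rooted graphs joined at their roots -/

namespace RootedGraph

variable {U V W X Y Z : Type*}

/-- The inverse of an isomorphism of rooted graphs. -/
def Iso.symm {G : RootedGraph V} {H : RootedGraph W} (e : G.Iso H) : H.Iso G :=
  ⟨e.1.symm, e.1.toEquiv.symm_apply_eq.2 e.2.symm⟩

/-- The composition of two isomorphisms of rooted graphs. -/
def Iso.trans {F : RootedGraph U} {G : RootedGraph V} {H : RootedGraph W} (e : F.Iso G)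
    (f : G.Iso H) : F.Iso H :=
  ⟨e.1.trans f.1, (congrArg f.1 e.2).trans f.2⟩

/-- The identity isomorphism of a rooted graph. -/
def Iso.refl (G : RootedGraph V) : G.Iso G := ⟨SimpleGraph.Iso.refl, rfl⟩

theorem Iso.ext {G : RootedGraph V} {H : RootedGraph W} {e f : G.Iso H}
    (h : ∀ x, e.1 x = f.1 x) : e = f :=
  Subtype.ext (RelIso.ext h)

theorem Iso.apply_eq_root_iff {G : RootedGraph V} {H : RootedGraph W} (e : G.Iso H) {v : V} :
    e.1 v = H.root ↔ v = G.root :=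
  ⟨fun h => e.1.injective (h.trans e.2.symm), fun h => (congrArg e.1 h).trans e.2⟩

/-- Composition with isomorphisms on both sides. -/
def Iso.congr {G : RootedGraph V} {G' : RootedGraph W} {H : RootedGraph X} {H' : RootedGraph Y}
    (e : G.Iso G') (f : H.Iso H') : G.Iso H ≃ G'.Iso H' where
  toFun g := (e.symm.trans g).trans f
  invFun g := (e.trans g).trans f.symm
  left_inv g := Iso.ext fun x => by
    change f.1.symm (f.1 (g.1 (e.1.symm (e.1 x)))) = g.1 x
    rw [e.1.symm_apply_apply, f.1.symm_apply_apply]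
  right_inv g := Iso.ext fun x => by
    change f.1 (f.1.symm (g.1 (e.1 (e.1.symm x)))) = g.1 x
    rw [e.1.apply_symm_apply, f.1.apply_symm_apply]

theorem IsIso.card_iso {G : RootedGraph V} {G' : RootedGraph W} {H : RootedGraph X}
    {H' : RootedGraph Y} (e : G.IsIso G') (f : H.IsIso H') :
    Nat.card (G.Iso H) = Nat.card (G'.Iso H') :=
  Nat.card_congr (Iso.congr e.some f.some)

theorem IsIso.aut_eq {G : RootedGraph V} {H : RootedGraph W} (e : G.IsIso H) : G.aut = H.aut :=
  e.card_iso e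

theorem IsIso.card_iso_eq_aut {G : RootedGraph V} {H : RootedGraph W} (e : G.IsIso H) :
    Nat.card (G.Iso H) = G.aut :=
  (IsIso.refl G).card_iso e.symm

theorem card_iso_eq_zero {G : RootedGraph V} {H : RootedGraph W} (e : ¬ G.IsIso H) :
    Nat.card (G.Iso H) = 0 := by
  have : IsEmpty (G.Iso H) := not_nonempty_iff.1 e
  exact Nat.card_of_isEmpty

instance [Finite V] [Finite W] (G : RootedGraph V) (H : RootedGraph W) : Finite (G.Iso H) :=
  Finite.of_injective (fun e : G.Iso H => (e.1 : V → W)) fun _ _ h => Iso.ext (congrFun h)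

theorem aut_pos [Finite V] (G : RootedGraph V) : 0 < G.aut := by
  have : Nonempty (G.Iso G) := ⟨Iso.refl G⟩
  exact Nat.card_pos

theorem IsIso.card_eq {G : RootedGraph V} {H : RootedGraph W} (e : G.IsIso H) :
    Nat.card V = Nat.card W :=
  Nat.card_congr e.some.1.toEquiv

theorem IsIso.isTree_iff {G : RootedGraph V} {H : RootedGraph W} (e : G.IsIso H) :
    G.graph.IsTree ↔ H.graph.IsTree :=
  e.some.1.isTree_iff

/-- The same rooted graph on another vertex set. -/
def transport (G : RootedGraph V) (e : V ≃ W) : RootedGraph W where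
  graph := G.graph.map e.toEmbedding
  root := e G.root

theorem isIso_transport (G : RootedGraph V) (e : V ≃ W) : G.IsIso (G.transport e) :=
  ⟨⟨SimpleGraph.Iso.map e G.graph, rfl⟩⟩

end RootedGraph

open RootedGraph

section Join

variable {V W V' W' X : Type*}

/-- The rooted graph obtained from `G` by attaching `H` to its root through a new edge. -/
def joinGraph (G : RootedGraph V) (H : RootedGraph W) : RootedGraph (V ⊕ W) where
  graph :=
    { Adj := fun x y => match x, y with
        | .inl u, .inl v => G.graph.Adj u v
        | .inr u, .inr v => H.graph.Adj u v
        | .inl u, .inr v => u = G.root ∧ v = H.root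
        | .inr u, .inl v => v = G.root ∧ u = H.root
      symm := ⟨by
        rintro (u | u) (v | v) h
        · exact SimpleGraph.Adj.symm h
        · exact h
        · exact h
        · exact SimpleGraph.Adj.symm h⟩
      loopless := ⟨by
        rintro (u | u) h
        · exact G.graph.loopless.irrefl _ h
        · exact H.graph.loopless.irrefl _ h⟩ }
  root := .inl G.root

variable {G : RootedGraph V} {H : RootedGraph W} {G' : RootedGraph V'} {H' : RootedGraph W'}

@[simp] theorem joinGraph_root : (joinGraph G H).root = .inl G.root := rfl
@[simp] theorem joinGraph_adj_inl_inl {u v : V} :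
    (joinGraph G H).graph.Adj (.inl u) (.inl v) ↔ G.graph.Adj u v := Iff.rfl
@[simp] theorem joinGraph_adj_inr_inr {u v : W} :
    (joinGraph G H).graph.Adj (.inr u) (.inr v) ↔ H.graph.Adj u v := Iff.rfl
@[simp] theorem joinGraph_adj_inl_inr {u : V} {v : W} :
    (joinGraph G H).graph.Adj (.inl u) (.inr v) ↔ u = G.root ∧ v = H.root := Iff.rfl
@[simp] theorem joinGraph_adj_inr_inl {u : W} {v : V} :
    (joinGraph G H).graph.Adj (.inr u) (.inl v) ↔ v = G.root ∧ u = H.root := Iff.rfl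

/-- Isomorphisms of the two parts of a join give an isomorphism of the joins. -/
def joinIso (e : G.Iso G') (f : H.Iso H') : (joinGraph G H).Iso (joinGraph G' H') :=
  ⟨{ toEquiv := Equiv.sumCongr e.1.toEquiv f.1.toEquiv
     map_rel_iff' := by
      rintro (u | u) (v | v)
      · exact e.1.map_rel_iff'
      · simp only [Equiv.sumCongr_apply, Sum.map_inl, Sum.map_inr, joinGraph_adj_inl_inr]
        exact and_congr e.apply_eq_root_iff f.apply_eq_root_iff
      · simp only [Equiv.sumCongr_apply, Sum.map_inl, Sum.map_inr, joinGraph_adj_inr_inl]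
        exact and_congr e.apply_eq_root_iff f.apply_eq_root_iff
      · exact f.1.map_rel_iff' }, by
    change Sum.inl (e.1 G.root) = _
    rw [e.2]
    rfl⟩

@[simp] theorem joinIso_inr (e : G.Iso G') (f : H.Iso H') (v : W) :
    (joinIso e f).1 (.inr v) = .inr (f.1 v) := rfl

theorem RootedGraph.IsIso.join (e : G.IsIso G') (f : H.IsIso H') :
    (joinGraph G H).IsIso (joinGraph G' H') :=
  ⟨joinIso e.some f.some⟩

/-- Two graphs attached one after the other may be swapped. -/
def joinComm (G : RootedGraph V) (H : RootedGraph W) (K : RootedGraph X) :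
    (joinGraph (joinGraph G H) K).Iso (joinGraph (joinGraph G K) H) :=
  ⟨{ toFun := fun x => match x with
        | .inl (.inl v) => .inl (.inl v)
        | .inl (.inr w) => .inr w
        | .inr z => .inl (.inr z)
     invFun := fun x => match x with
        | .inl (.inl v) => .inl (.inl v)
        | .inl (.inr w) => .inr w
        | .inr z => .inl (.inr z)
     left_inv := by rintro ((_ | _) | _) <;> rfl
     right_inv := by rintro ((_ | _) | _) <;> rfl
     map_rel_iff' := by
      rintro ((_ | _) | _) ((_ | _) | _) <;> simp }, rfl⟩

theorem joinGraph_connected (hG : G.graph.Connected) (hH : H.graph.Connected) :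
    (joinGraph G H).graph.Connected := by
  have h1 : ∀ v, (joinGraph G H).graph.Reachable (.inl G.root) (.inl v) := fun v =>
    (hG.preconnected G.root v).map (⟨Sum.inl, fun h => h⟩ : G.graph →g (joinGraph G H).graph)
  have h2 : ∀ v, (joinGraph G H).graph.Reachable (.inr H.root) (.inr v) := fun v =>
    (hH.preconnected H.root v).map (⟨Sum.inr, fun h => h⟩ : H.graph →g (joinGraph G H).graph)
  have h3 : (joinGraph G H).graph.Reachable (.inl G.root) (.inr H.root) :=
    SimpleGraph.Adj.reachable (by simp)
  have h4 : ∀ x, (joinGraph G H).graph.Reachable (.inl G.root) x := by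
    rintro (v | v)
    · exact h1 v
    · exact h3.trans (h2 v)
  have : Nonempty (V ⊕ W) := ⟨.inl G.root⟩
  exact ⟨fun x y => (h4 x).symm.trans (h4 y)⟩

/-- The only edge leaving the attached part of the target ends at `G'.root`, whose preimage is
`G.root`. So the image of a walk inside `H` that ends at its root cannot leave the attached part. -/
theorem exists_inr_of_iso (hH : H.graph.Connected)
    (e : (joinGraph G H).Iso (joinGraph G' H')) (he : e.1 (.inr H.root) = .inr H'.root) (w : W) :
    ∃ w', e.1 (.inr w) = .inr w' := by
  obtain ⟨p⟩ := hH.preconnected w H.root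
  generalize H.root = z at p he
  induction p with
  | nil => exact ⟨_, he⟩
  | cons h p ih =>
    rename_i u v z
    obtain ⟨v', hv'⟩ := ih he
    rcases hu : e.1 (.inr u) with u' | u'
    · have h1 : (joinGraph G' H').graph.Adj (e.1 (.inr u)) (e.1 (.inr v)) :=
        e.1.map_rel_iff.2 (by simpa using h)
      rw [hu, hv', joinGraph_adj_inl_inr] at h1
      have h2 : e.1 (.inr u) = e.1 (.inl G.root) := by
        rw [hu, h1.1]
        exact e.2.symm
      exact absurd (e.1.injective h2) (by simp)
    · exact ⟨u', rfl⟩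

/-- With `exists_inr_of_iso` for `e` and for its inverse, the attached parts correspond; hence so do
their complements, and `e` splits. -/
theorem joinIso_surjective (hH : H.graph.Connected) (hH' : H'.graph.Connected)
    (e : (joinGraph G H).Iso (joinGraph G' H')) (he : e.1 (.inr H.root) = .inr H'.root) :
    ∃ f : G.Iso G' × H.Iso H', joinIso f.1 f.2 = e := by
  have he' : e.symm.1 (.inr H'.root) = .inr H.root := by
    rw [← he]
    exact e.1.symm_apply_apply _
  have es : ∀ x, e.symm.1 (e.1 x) = x := e.1.symm_apply_apply
  have se : ∀ x, e.1 (e.symm.1 x) = x := e.1.apply_symm_apply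
  choose r hr using exists_inr_of_iso hH e he
  choose r' hr' using exists_inr_of_iso hH' e.symm he'
  have l : ∀ v, ∃ v', e.1 (.inl v) = .inl v' := fun v => by
    rcases hv : e.1 (.inl v) with v' | v'
    · exact ⟨v', rfl⟩
    · have := es (.inl v)
      rw [hv, hr'] at this
      simp at this
  have l' : ∀ v, ∃ v', e.symm.1 (.inl v) = .inl v' := fun v => by
    rcases hv : e.symm.1 (.inl v) with v' | v'
    · exact ⟨v', rfl⟩
    · have := se (.inl v)
      rw [hv, hr] at this
      simp at this
  choose l hl using l
  choose l' hl' using l'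
  refine ⟨⟨⟨⟨⟨l, l', fun v => ?_, fun v => ?_⟩, fun {u v} => ?_⟩, ?_⟩,
    ⟨⟨⟨r, r', fun v => ?_, fun v => ?_⟩, fun {u v} => ?_⟩, ?_⟩⟩, Iso.ext ?_⟩
  · have := es (.inl v)
    rw [hl, hl'] at this
    exact Sum.inl_injective this
  · have := se (.inl v)
    rw [hl', hl] at this
    exact Sum.inl_injective this
  · change G'.graph.Adj (l u) (l v) ↔ G.graph.Adj u v
    rw [← joinGraph_adj_inl_inl (H := H'), ← hl, ← hl, ← joinGraph_adj_inl_inl (H := H)]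
    exact e.1.map_rel_iff
  · apply Sum.inl_injective (β := W')
    change Sum.inl (l G.root) = _
    rw [← hl]
    exact e.2
  · have := es (.inr v)
    rw [hr, hr'] at this
    exact Sum.inr_injective this
  · have := se (.inr v)
    rw [hr', hr] at this
    exact Sum.inr_injective this
  · change H'.graph.Adj (r u) (r v) ↔ H.graph.Adj u v
    rw [← joinGraph_adj_inr_inr (G := G'), ← hr, ← hr, ← joinGraph_adj_inr_inr (G := G)]
    exact e.1.map_rel_iff
  · apply Sum.inr_injective (α := V')
    change Sum.inr (r H.root) = _
    rw [← hr]
    exact he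
  · rintro (v | v)
    · exact (hl v).symm
    · exact (hr v).symm

/-- The isomorphisms of two joins that match the attached parts. -/
noncomputable def joinIsoEquiv (hH : H.graph.Connected) (hH' : H'.graph.Connected) :
    G.Iso G' × H.Iso H' ≃
      {e : (joinGraph G H).Iso (joinGraph G' H') // e.1 (.inr H.root) = .inr H'.root} :=
  Equiv.ofBijective (fun f => ⟨joinIso f.1 f.2, by rw [joinIso_inr, f.2.2]⟩) (by
    constructor
    · intro f g h
      have h' : joinIso f.1 f.2 = joinIso g.1 g.2 := congrArg Subtype.val h
      refine Prod.ext (Iso.ext fun v => ?_) (Iso.ext fun v => ?_)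
      · have := congrArg (fun e => e.1 (Sum.inl v)) h'
        exact Sum.inl_injective this
      · have := congrArg (fun e => e.1 (Sum.inr v)) h'
        exact Sum.inr_injective this
    · rintro ⟨e, he⟩
      obtain ⟨f, hf⟩ := joinIso_surjective hH hH' e he
      exact ⟨f, Subtype.ext hf⟩)

end Join

/-! # Plane trees as rooted graphs -/

namespace PlaneTree

/-- The vertices of a plane tree. -/
def Vert : PlaneTree → Type
  | leaf => Unit
  | join t c => Vert t ⊕ Vert c

/-- The rooted graph with a single vertex. -/
def _root_.OtterMatching.pointGraph : RootedGraph Unit := ⟨⊥, ()⟩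

/-- The rooted graph given by a plane tree. -/
def toGraph : (t : PlaneTree) → RootedGraph (Vert t)
  | leaf => pointGraph
  | join t c => joinGraph (toGraph t) (toGraph c)

/-- The number of vertices of a plane tree. -/
def size : PlaneTree → ℕ
  | leaf => 1
  | join t c => size t + size c

noncomputable instance instFintypeVert : (t : PlaneTree) → Fintype (Vert t)
  | leaf => inferInstanceAs (Fintype Unit)
  | join t c =>
    letI := instFintypeVert t
    letI := instFintypeVert c
    inferInstanceAs (Fintype (Vert t ⊕ Vert c))

noncomputable instance (t : PlaneTree) : DecidableEq (Vert t) := Classical.decEq _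

theorem size_pos : ∀ t : PlaneTree, 0 < t.size
  | leaf => Nat.one_pos
  | join t _ => Nat.add_pos_left (size_pos t) _

theorem card_vert : ∀ t : PlaneTree, Fintype.card (Vert t) = t.size
  | leaf => rfl
  | join t c => by
    rw [size, ← card_vert t, ← card_vert c]
    exact Fintype.card_sum

theorem natCard_vert (t : PlaneTree) : Nat.card (Vert t) = t.size := by
  rw [Nat.card_eq_fintype_card, card_vert]

theorem toGraph_connected : ∀ t : PlaneTree, t.toGraph.graph.Connected
  | leaf => by
    have : Nonempty (Vert leaf) := ⟨()⟩
    have : Subsingleton (Vert leaf) := inferInstanceAs (Subsingleton Unit)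
    exact ⟨fun x y => by rw [Subsingleton.elim x y]⟩
  | join t c => joinGraph_connected (toGraph_connected t) (toGraph_connected c)

/-- The children of the root. -/
def Child : PlaneTree → Type
  | leaf => Empty
  | join t _ => Option (Child t)

noncomputable instance instFintypeChild : (t : PlaneTree) → Fintype (Child t)
  | leaf => inferInstanceAs (Fintype Empty)
  | join t _ =>
    letI := instFintypeChild t
    inferInstanceAs (Fintype (Option (Child t)))

/-- The subtree at a child of the root. -/
def sub : (t : PlaneTree) → Child t → PlaneTree
  | join _ c, none => c
  | join t _, some i => sub t i

/-- The tree without the subtree at a child of the root. -/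
def rest : (t : PlaneTree) → Child t → PlaneTree
  | join t _, none => t
  | join t c, some i => join (rest t i) c

/-- The vertex that is a given child of the root. -/
def childVert : (t : PlaneTree) → Child t → Vert t
  | join _ c, none => Sum.inr c.toGraph.root
  | join t _, some i => Sum.inl (childVert t i)

theorem childVert_injective : ∀ t : PlaneTree, Function.Injective (childVert t)
  | leaf => fun i => i.elim
  | join t _ => by
    rintro (_ | i) (_ | j) h
    · rfl
    · exact absurd h (by simp [childVert])
    · exact absurd h (by simp [childVert])
    · exact congrArg some (childVert_injective t (Sum.inl_injective h))

theorem adj_root_iff : ∀ (t : PlaneTree) (v : Vert t),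
    t.toGraph.graph.Adj t.toGraph.root v ↔ ∃ i, childVert t i = v
  | leaf, v => by
    constructor
    · intro h
      exact h.elim
    · rintro ⟨i, -⟩
      exact i.elim
  | join t c, v => by
    rcases v with v | v
    · have : (join t c).toGraph.graph.Adj (join t c).toGraph.root (Sum.inl v) ↔
        t.toGraph.graph.Adj t.toGraph.root v := Iff.rfl
      rw [this, adj_root_iff t v]
      constructor
      · rintro ⟨i, rfl⟩
        exact ⟨some i, rfl⟩
      · rintro ⟨_ | i, h⟩
        · exact absurd h (by simp [childVert])
        · exact ⟨i, Sum.inl_injective h⟩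
    · have : (join t c).toGraph.graph.Adj (join t c).toGraph.root (Sum.inr v) ↔
        t.toGraph.root = t.toGraph.root ∧ v = c.toGraph.root := Iff.rfl
      rw [this]
      constructor
      · rintro ⟨-, rfl⟩
        exact ⟨none, rfl⟩
      · rintro ⟨_ | i, h⟩
        · exact ⟨rfl, (Sum.inr_injective h).symm⟩
        · exact absurd h (by simp [childVert])

/-- `joinComm` moves a child past the later ones until it is attached last. The clause on
`childVert` records which edge becomes the outermost one; without it isomorphisms could not be
sorted by the image of a root. -/
theorem exists_split : ∀ (t : PlaneTree) (i : Child t),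
    ∃ e : t.toGraph.Iso (joinGraph (rest t i).toGraph (sub t i).toGraph),
      e.1 (childVert t i) = Sum.inr (sub t i).toGraph.root
  | join t c, none => ⟨Iso.refl _, rfl⟩
  | join t c, some i => by
    obtain ⟨e, he⟩ := exists_split t i
    refine ⟨Iso.trans (F := joinGraph t.toGraph c.toGraph)
      (joinIso e (Iso.refl c.toGraph)) (joinComm _ _ _), ?_⟩
    change (joinComm (rest t i).toGraph (sub t i).toGraph c.toGraph).1
      (Sum.inl (e.1 (childVert t i))) = _
    rw [he]
    rfl

theorem isIso_join_rest_sub (t : PlaneTree) (i : Child t) :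
    t.toGraph.IsIso (join (rest t i) (sub t i)).toGraph :=
  ⟨(exists_split t i).choose⟩

/-- An isomorphism from `join t c` to `s` maps `c` to the subtree of a child of `s` and `t` to the
rest of `s`. -/
theorem card_iso_join (t c s : PlaneTree) :
    Nat.card ((join t c).toGraph.Iso s.toGraph) =
      ∑ i : Child s, Nat.card (t.toGraph.Iso (rest s i).toGraph) *
        Nat.card (c.toGraph.Iso (sub s i).toGraph) := by
  have hc : ∀ e : (join t c).toGraph.Iso s.toGraph,
      ∃ i : Child s, childVert s i = e.1 (Sum.inr c.toGraph.root) := by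
    intro e
    have h : (join t c).toGraph.graph.Adj (join t c).toGraph.root (Sum.inr c.toGraph.root) :=
      (⟨rfl, rfl⟩ : t.toGraph.root = t.toGraph.root ∧ c.toGraph.root = c.toGraph.root)
    have h' := e.1.map_rel_iff.2 h
    have h2 := e.2
    rw [h2] at h'
    exact (adj_root_iff s _).1 h'
  -- `k e` is the child of `s` onto which `e` sends the root of `c`; the isomorphisms are counted
  -- fibre by fibre over `k`.
  choose k hk using hc
  have h1 := Nat.card_congr (Equiv.sigmaFiberEquiv k)
  rw [← h1, Nat.card_sigma]
  refine Finset.sum_congr rfl fun i _ => ?_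
  rw [← Nat.card_prod, Nat.card_congr (joinIsoEquiv (toGraph_connected c)
    (toGraph_connected (sub s i)))]
  obtain ⟨σ, hσ⟩ := exists_split s i
  refine Nat.card_congr (Equiv.subtypeEquiv (Iso.congr (Iso.refl _) σ) fun e => ?_)
  change k e = i ↔ σ.1 (e.1 (Sum.inr c.toGraph.root)) = Sum.inr (sub s i).toGraph.root
  rw [← hk, ← hσ, σ.1.injective.eq_iff, (childVert_injective s).eq_iff]

/-- Positivity of the count `card_iso_join`: a sum of products of naturals is nonzero only if some
term has two nonzero factors. -/
theorem isIso_join_iff (t c s : PlaneTree) :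
    (join t c).toGraph.IsIso s.toGraph ↔
      ∃ i : Child s, t.toGraph.IsIso (rest s i).toGraph ∧ c.toGraph.IsIso (sub s i).toGraph := by
  constructor
  · intro h
    have h1 : 0 < Nat.card ((join t c).toGraph.Iso s.toGraph) := by
      have : Nonempty ((join t c).toGraph.Iso s.toGraph) := h
      exact Nat.card_pos
    rw [card_iso_join] at h1
    obtain ⟨i, -, hi⟩ := Finset.exists_ne_zero_of_sum_ne_zero h1.ne'
    refine ⟨i, ?_, ?_⟩
    · by_contra h2
      rw [card_iso_eq_zero h2, zero_mul] at hi
      exact hi rfl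
    · by_contra h2
      rw [card_iso_eq_zero h2, mul_zero] at hi
      exact hi rfl
  · rintro ⟨i, h1, h2⟩
    exact (h1.join h2).trans (isIso_join_rest_sub s i).symm

theorem size_eq_of_isIso {s t : PlaneTree} (h : s.toGraph.IsIso t.toGraph) : s.size = t.size := by
  rw [← natCard_vert, ← natCard_vert, h.card_eq]

end PlaneTree

/-! ### Edges of a join, and attaching or removing a pendant vertex. -/

section Join

variable {V W : Type*} {G : RootedGraph V} {H : RootedGraph W}

theorem edgeSet_joinGraph (G : RootedGraph V) (H : RootedGraph W) :
    (joinGraph G H).graph.edgeSet =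
      insert s(Sum.inl G.root, Sum.inr H.root)
        (Sym2.map Sum.inl '' G.graph.edgeSet ∪ Sym2.map Sum.inr '' H.graph.edgeSet) := by
  ext e
  induction e with
  | h x y =>
    rw [SimpleGraph.mem_edgeSet, Set.mem_insert_iff, Set.mem_union]
    constructor
    · intro h
      rcases x with x | x <;> rcases y with y | y
      · exact Or.inr (Or.inl ⟨s(x, y), h, rfl⟩)
      · obtain ⟨rfl, rfl⟩ := h
        exact Or.inl rfl
      · obtain ⟨rfl, rfl⟩ := h
        exact Or.inl Sym2.eq_swap
      · exact Or.inr (Or.inr ⟨s(x, y), h, rfl⟩)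
    · rintro (h | ⟨e, he, h⟩ | ⟨e, he, h⟩)
      · rw [Sym2.eq_iff] at h
        rcases h with ⟨rfl, rfl⟩ | ⟨rfl, rfl⟩ <;> simp
      · induction e with
        | h u v =>
          rw [Sym2.map_mk, Sym2.eq_iff] at h
          rw [SimpleGraph.mem_edgeSet] at he
          rcases h with ⟨rfl, rfl⟩ | ⟨rfl, rfl⟩
          · exact he
          · exact he.symm
      · induction e with
        | h u v =>
          rw [Sym2.map_mk, Sym2.eq_iff] at h
          rw [SimpleGraph.mem_edgeSet] at he
          rcases h with ⟨rfl, rfl⟩ | ⟨rfl, rfl⟩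
          · exact he
          · exact he.symm

theorem disjoint_edges_joinGraph (s : Set (Sym2 V)) (s' : Set (Sym2 W)) :
    Disjoint (Sym2.map (Sum.inl : V → V ⊕ W) '' s) (Sym2.map Sum.inr '' s') := by
  rw [Set.disjoint_left]
  rintro _ ⟨e, -, rfl⟩ ⟨e', -, h⟩
  induction e with
  | h u v =>
    induction e' with
    | h u' v' =>
      rw [Sym2.map_mk, Sym2.map_mk, Sym2.eq_iff] at h
      simp at h

theorem new_edge_notMem_joinGraph (v : V) (w : W) (s : Set (Sym2 V)) (s' : Set (Sym2 W)) :
    s(Sum.inl v, Sum.inr w) ∉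
      Sym2.map (Sum.inl : V → V ⊕ W) '' s ∪ Sym2.map Sum.inr '' s' := by
  rintro (⟨e, -, h⟩ | ⟨e, -, h⟩)
  · induction e with
    | h u v =>
      rw [Sym2.map_mk, Sym2.eq_iff] at h
      simp at h
  · induction e with
    | h u v =>
      rw [Sym2.map_mk, Sym2.eq_iff] at h
      simp at h

/-- The edges of a join are the new edge and the two disjoint images of old edges; this matches the
recursion that defines `PlaneTree.weight`. -/
theorem finprod_edges_joinGraph [Finite V] [Finite W] {R : Type*} [CommMonoid R]
    (f : Sym2 (V ⊕ W) → R) :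
    ∏ᶠ e ∈ (joinGraph G H).graph.edgeSet, f e =
      f s(Sum.inl G.root, Sum.inr H.root) *
        ((∏ᶠ e ∈ G.graph.edgeSet, f (e.map Sum.inl)) *
          ∏ᶠ e ∈ H.graph.edgeSet, f (e.map Sum.inr)) := by
  rw [edgeSet_joinGraph, finprod_mem_insert _ (new_edge_notMem_joinGraph _ _ _ _)
      (Set.toFinite _), finprod_mem_union (disjoint_edges_joinGraph _ _) (Set.toFinite _)
      (Set.toFinite _), finprod_mem_image (Sym2.map.injective Sum.inl_injective).injOn,
    finprod_mem_image (Sym2.map.injective Sum.inr_injective).injOn]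

theorem ncard_edgeSet_joinGraph [Finite V] [Finite W] :
    (joinGraph G H).graph.edgeSet.ncard = G.graph.edgeSet.ncard + H.graph.edgeSet.ncard + 1 := by
  rw [edgeSet_joinGraph, Set.ncard_insert_of_notMem (new_edge_notMem_joinGraph _ _ _ _)
      (Set.toFinite _), Set.ncard_union_eq (disjoint_edges_joinGraph _ _) (Set.toFinite _)
      (Set.toFinite _), Set.ncard_image_of_injective _ (Sym2.map.injective Sum.inl_injective),
    Set.ncard_image_of_injective _ (Sym2.map.injective Sum.inr_injective)]

/-- The rooted graph obtained from `G` by attaching a new vertex to the vertex `u`. -/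
def pendantGraph (G : RootedGraph V) (u : V) : RootedGraph (Option V) where
  graph :=
    { Adj := fun x y => match x, y with
        | some v, some w => G.graph.Adj v w
        | some v, none => v = u
        | none, some v => v = u
        | none, none => False
      symm := ⟨by
        rintro (_ | v) (_ | w) h
        · exact h
        · exact h
        · exact h
        · exact SimpleGraph.Adj.symm h⟩
      loopless := ⟨by
        rintro (_ | v) h
        · exact h
        · exact G.graph.loopless.irrefl _ h⟩ }
  root := some G.root

@[simp] theorem pendantGraph_adj_some_some {u v w : V} :
    (pendantGraph G u).graph.Adj (some v) (some w) ↔ G.graph.Adj v w := Iff.rfl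
@[simp] theorem pendantGraph_adj_some_none {u v : V} :
    (pendantGraph G u).graph.Adj (some v) none ↔ v = u := Iff.rfl
@[simp] theorem pendantGraph_adj_none_some {u v : V} :
    (pendantGraph G u).graph.Adj none (some v) ↔ v = u := Iff.rfl

theorem RootedGraph.IsIso.pendant (e : G.Iso H) (u : V) :
    (pendantGraph G u).IsIso (pendantGraph H (e.1 u)) :=
  ⟨⟨{ toEquiv := Equiv.optionCongr e.1.toEquiv
      map_rel_iff' := by
        rintro (_ | v) (_ | w)
        · exact Iff.rfl
        · exact e.1.injective.eq_iff
        · exact e.1.injective.eq_iff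
        · exact e.1.map_rel_iff }, congrArg some e.2⟩⟩

theorem pendantGraph_joinGraph_inl (v : V) :
    (pendantGraph (joinGraph G H) (.inl v)).IsIso (joinGraph (pendantGraph G v) H) :=
  ⟨⟨{ toFun := fun x => match x with
        | none => .inl none
        | some (.inl v) => .inl (some v)
        | some (.inr w) => .inr w
      invFun := fun x => match x with
        | .inl none => none
        | .inl (some v) => some (.inl v)
        | .inr w => some (.inr w)
      left_inv := by rintro (_ | _ | _) <;> rfl
      right_inv := by rintro ((_ | _) | _) <;> rfl
      map_rel_iff' := by
        rintro (_ | _ | _) (_ | _ | _) <;> simp [pendantGraph] }, rfl⟩⟩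

theorem pendantGraph_joinGraph_inr (v : W) :
    (pendantGraph (joinGraph G H) (.inr v)).IsIso (joinGraph G (pendantGraph H v)) :=
  ⟨⟨{ toFun := fun x => match x with
        | none => .inr none
        | some (.inl v) => .inl v
        | some (.inr w) => .inr (some w)
      invFun := fun x => match x with
        | .inr none => none
        | .inl v => some (.inl v)
        | .inr (some w) => some (.inr w)
      left_inv := by rintro (_ | _ | _) <;> rfl
      right_inv := by rintro (_ | _ | _) <;> rfl
      map_rel_iff' := by
        rintro (_ | _ | _) (_ | _ | _) <;> simp [pendantGraph] }, rfl⟩⟩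

/-- Undoes the deletion of a leaf `v` with neighbour `u`: the induction step of
`exists_isIso_toGraph`. -/
theorem isIso_pendantGraph [DecidableEq V] {v u : V} (huv : ∀ w, G.graph.Adj v w ↔ w = u)
    (hv : G.root ∈ ({v}ᶜ : Set V)) (hu : u ∈ ({v}ᶜ : Set V)) :
    (pendantGraph ⟨G.graph.induce {v}ᶜ, ⟨G.root, hv⟩⟩ ⟨u, hu⟩).IsIso G :=
  ⟨⟨{ toFun := fun x => match x with
        | none => v
        | some w => w.1
      invFun := fun x => if h : x = v then none else some ⟨x, h⟩
      left_inv := by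
        rintro (_ | ⟨w, hw⟩)
        · simp
        · exact dif_neg hw
      right_inv := fun x => by
        by_cases h : x = v <;> simp [h]
      map_rel_iff' := by
        rintro (_ | ⟨x, hx⟩) (_ | ⟨y, hy⟩)
        · simp
        · simp [huv]
        · change G.graph.Adj x v ↔ _
          rw [G.graph.adj_comm, huv]
          simp
        · simp }, rfl⟩⟩

end Join

namespace PlaneTree

theorem toGraph_isTree (t : PlaneTree) : t.toGraph.graph.IsTree := by
  rw [SimpleGraph.isTree_iff_connected_and_card]
  refine ⟨toGraph_connected t, ?_⟩
  rw [Nat.card_coe_set_eq, natCard_vert]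
  induction t with
  | leaf =>
    have : (leaf.toGraph.graph).edgeSet = ∅ := SimpleGraph.edgeSet_bot
    rw [this, Set.ncard_empty]
    rfl
  | join t c h1 h2 =>
    change (joinGraph t.toGraph c.toGraph).graph.edgeSet.ncard + 1 = t.size + c.size
    rw [ncard_edgeSet_joinGraph, ← h1, ← h2]
    ring

/-- Attach a new vertex to the vertex `v` of a plane tree. -/
def attach : (t : PlaneTree) → Vert t → PlaneTree
  | leaf, _ => join leaf leaf
  | join t c, .inl v => join (attach t v) c
  | join t c, .inr v => join t (attach c v)

theorem isIso_attach : ∀ (t : PlaneTree) (v : Vert t),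
    (pendantGraph t.toGraph v).IsIso (attach t v).toGraph
  | leaf, v => ⟨⟨{
      toFun := fun x => match x with
        | none => .inr ()
        | some _ => .inl ()
      invFun := fun x => match x with
        | .inr _ => none
        | .inl _ => some ()
      left_inv := by rintro (_ | _) <;> rfl
      right_inv := by rintro (_ | _) <;> rfl
      map_rel_iff' := by
        rintro (_ | x) (_ | y)
        · exact Iff.rfl
        · exact ⟨fun _ => rfl, fun _ => ⟨rfl, rfl⟩⟩
        · exact ⟨fun _ => rfl, fun _ => ⟨rfl, rfl⟩⟩
        · exact Iff.rfl }, rfl⟩⟩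
  | join t c, .inl v =>
    (pendantGraph_joinGraph_inl (G := t.toGraph) (H := c.toGraph) v).trans
      ((isIso_attach t v).join (IsIso.refl _))
  | join t c, .inr v =>
    (pendantGraph_joinGraph_inr (G := t.toGraph) (H := c.toGraph) v).trans
      ((IsIso.refl _).join (isIso_attach c v))

/-- Every finite rooted tree is given by a plane tree. -/
theorem exists_isIso_toGraph {V : Type*} [Finite V] (G : RootedGraph V)
    (hG : G.graph.IsTree) : ∃ t : PlaneTree, G.IsIso t.toGraph := by
  classical
  induction hn : Nat.card V generalizing V with
  | zero =>
    have : Nonempty V := ⟨G.root⟩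
    exact absurd hn Nat.card_pos.ne'
  | succ n ih =>
    cases nonempty_fintype V
    rcases subsingleton_or_nontrivial V with hV | hV
    · refine ⟨leaf, ⟨⟨⟨⟨fun _ => (), fun _ => G.root, fun _ => Subsingleton.elim _ _,
        fun _ => rfl⟩, fun {x y} => ?_⟩, rfl⟩⟩⟩
      rw [Subsingleton.elim x y]
      exact iff_of_false (fun h => h) (G.graph.loopless.irrefl _)
    -- The root must survive the deletion. A nontrivial finite tree has two distinct leaves, so one
    -- of them is not the root.
    · obtain ⟨v, hv, hd⟩ : ∃ v, v ≠ G.root ∧ G.graph.degree v = 1 := by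
        obtain ⟨v, w, hvw, h1, h2⟩ := hG.exists_ne_and_degree_eq_one
        by_cases h : v = G.root
        · exact ⟨w, h ▸ hvw.symm, h2⟩
        · exact ⟨v, h, h1⟩
      obtain ⟨u, hu⟩ := SimpleGraph.degree_eq_one_iff_existsUnique_adj.1 hd
      have huv : ∀ w, G.graph.Adj v w ↔ w = u := fun w =>
        ⟨fun h => hu.2 w h, fun h => h ▸ hu.1⟩
      have h1 : u ∈ ({v}ᶜ : Set V) := hu.1.ne'
      have h2 : G.root ∈ ({v}ᶜ : Set V) := hv.symm
      obtain ⟨t, ⟨e⟩⟩ := ih ⟨G.graph.induce {v}ᶜ, ⟨G.root, h2⟩⟩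
        ⟨hG.1.induce_compl_singleton_of_degree_eq_one hd, hG.2.induce _⟩ (by
          rw [Nat.card_coe_set_eq, Set.ncard_compl, Set.ncard_singleton, hn]
          rfl)
      exact ⟨_, (isIso_pendantGraph huv h2 h1).symm.trans
        ((IsIso.pendant e _).trans (isIso_attach t _))⟩

end PlaneTree

/-! # Level sequences in canonical form and their successors -/

theorem append_le_append_left_iff {c a b : List ℕ} : c ++ a ≤ c ++ b ↔ a ≤ b := by
  constructor
  · intro h
    by_contra h'
    exact absurd (List.append_left_lt (not_le.1 h')) (not_lt.2 h)
  · intro h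
    by_contra h'
    rcases lt_or_eq_of_le h with h | rfl
    · exact absurd (List.append_left_lt h) (not_lt.2 (not_le.1 h').le)
    · exact h' le_rfl

theorem le_of_prefix {a b : List ℕ} (h : a <+: b) : a ≤ b := not_lt.1 h.le

theorem le_append_right (a b : List ℕ) : a ≤ a ++ b := le_of_prefix (List.prefix_append a b)

/-- Equal lengths exclude the proper prefix case of the lexicographic order. -/
theorem exists_mismatch_of_lt : ∀ {z s : List ℕ}, z < s → z.length = s.length →
    ∃ c a b z' s', z = c ++ a :: z' ∧ s = c ++ b :: s' ∧ a < b
  | [], [], h, _ => absurd h (lt_irrefl _)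
  | [], _ :: _, _, h => by simp at h
  | _ :: _, [], _, h => by simp at h
  | a :: z, b :: s, h, hl => by
    rcases List.cons_lt_cons_iff.1 h with hab | ⟨rfl, hzs⟩
    · exact ⟨[], a, b, z, s, rfl, rfl, hab⟩
    · obtain ⟨c, a', b', z', s', h1, h2, hab⟩ := exists_mismatch_of_lt hzs (by simpa using hl)
      exact ⟨a :: c, a', b', z', s', by rw [h1]; rfl, by rw [h2]; rfl, hab⟩

theorem mismatch_lt {c z s : List ℕ} {a b : ℕ} (h : a < b) : c ++ a :: z < c ++ b :: s :=
  List.append_left_lt (List.cons_lt_cons_iff.2 (Or.inl h))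

/-- Among siblings, the sequences of depths of the descendants do not increase. -/
def SiblingsSorted (s : List ℕ) : Prop :=
  ∀ x a u y z, s = x ++ (a :: (u ++ (a :: (y ++ z)))) → (∀ b ∈ u, a < b) → (∀ b ∈ y, a < b) →
    y ≤ u

/-- In `SiblingsSorted` the tail `z` is arbitrary, so `y` runs over all prefixes of the descendants
of the second sibling. As prefixes are smaller, this demands nothing more than the full comparison,
and it makes the property local. -/
theorem SiblingsSorted.infix {s s' : List ℕ} (h : SiblingsSorted s) (hs : s' <:+: s) :
    SiblingsSorted s' := by
  obtain ⟨p, q, rfl⟩ := hs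
  rintro x a u y z rfl hu hy
  exact h (p ++ x) a u y (z ++ q) (by simp) hu hy

/-- A level sequence starts at depth `0`, which does not occur again, and never goes down by more
than one level at a time. -/
structure IsLevels (s : List ℕ) : Prop where
  exists_cons : ∃ u, s = 0 :: u ∧ ∀ b ∈ u, 0 < b
  chain : s.IsChain (fun a b => b ≤ a + 1)

/-- Level sequences in canonical form. -/
structure IsCanonLevels (s : List ℕ) : Prop extends IsLevels s where
  sorted : SiblingsSorted s

/-- The list of `k` entries that consists of those of `cur` and then those of `Q`, cyclically. -/
def cyc (Q : List ℕ) : ℕ → List ℕ → List ℕ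
  | 0, _ => []
  | k + 1, b :: cur => b :: cyc Q k cur
  | k + 1, [] => match Q with
    | [] => []
    | b :: cur => b :: cyc Q k cur

/-! ### Cyclic repetition of a block `d :: β` with all entries of `β` above `d`. -/

section Cyc

variable {d : ℕ} {β : List ℕ}

@[simp] theorem cyc_zero {Q cur : List ℕ} : cyc Q 0 cur = [] := by cases cur <;> rfl
@[simp] theorem cyc_succ_cons {Q cur : List ℕ} {k b : ℕ} :
    cyc Q (k + 1) (b :: cur) = b :: cyc Q k cur := rfl
@[simp] theorem cyc_succ_nil {k : ℕ} : cyc (d :: β) (k + 1) [] = d :: cyc (d :: β) k β := rfl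

theorem length_cyc : ∀ (k : ℕ) (cur : List ℕ), (cyc (d :: β) k cur).length = k
  | 0, _ => by simp
  | k + 1, [] => by simp [length_cyc k]
  | k + 1, _ :: _ => by simp [length_cyc k]

theorem le_of_mem_cyc (hβ : ∀ b ∈ β, d < b) : ∀ (k : ℕ) (cur : List ℕ),
    (∀ b ∈ cur, d < b) → ∀ b ∈ cyc (d :: β) k cur, d ≤ b
  | 0, _, _ => by simp
  | k + 1, [], _ => by
    rw [cyc_succ_nil]
    intro b hb
    rcases List.mem_cons.1 hb with rfl | hb
    · exact le_rfl
    · exact le_of_mem_cyc hβ k β hβ b hb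
  | k + 1, c :: cur, h => by
    rw [cyc_succ_cons]
    intro b hb
    rcases List.mem_cons.1 hb with rfl | hb
    · exact (h b List.mem_cons_self).le
    · exact le_of_mem_cyc hβ k cur (fun b hb => h b (List.mem_cons_of_mem _ hb)) b hb

/-- Entries above `d` can only be read until the next separator `d`, that is, within `cur`. -/
theorem prefix_of_cyc_eq : ∀ (k : ℕ) (cur v z : List ℕ), cyc (d :: β) k cur = v ++ z →
    (∀ b ∈ v, d < b) → v <+: cur
  | _, _, [], _, _, _ => List.nil_prefix
  | 0, cur, a :: v, z, h, _ => by simp at h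
  | k + 1, [], a :: v, z, h, hv => by
    rw [cyc_succ_nil, List.cons_append, List.cons.injEq] at h
    exact absurd (hv a List.mem_cons_self) (by omega)
  | k + 1, c :: cur, a :: v, z, h, hv => by
    rw [cyc_succ_cons, List.cons_append, List.cons.injEq] at h
    rw [h.1, List.cons_prefix_cons]
    exact ⟨rfl, prefix_of_cyc_eq k cur v z h.2 fun b hb => hv b (List.mem_cons_of_mem _ hb)⟩

theorem eq_of_cyc_eq : ∀ (k : ℕ) (cur u z : List ℕ), cyc (d :: β) k cur = u ++ d :: z →
    (∀ b ∈ cur, d < b) → (∀ b ∈ u, d < b) → u = cur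
  | 0, cur, u, z, h, _, _ => by simp at h
  | k + 1, [], u, z, h, _, hu => by
    rw [cyc_succ_nil] at h
    rcases u with _ | ⟨a, u⟩
    · rfl
    · rw [List.cons_append, List.cons.injEq] at h
      exact absurd (hu a List.mem_cons_self) (by omega)
  | k + 1, c :: cur, [], z, h, hc, _ => by
    rw [cyc_succ_cons, List.nil_append, List.cons.injEq] at h
    exact absurd (hc c List.mem_cons_self) (by omega)
  | k + 1, c :: cur, a :: u, z, h, hc, hu => by
    rw [cyc_succ_cons, List.cons_append, List.cons.injEq] at h
    rw [h.1, eq_of_cyc_eq k cur u z h.2 (fun b hb => hc b (List.mem_cons_of_mem _ hb))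
      (fun b hb => hu b (List.mem_cons_of_mem _ hb))]

/-- What comes behind an entry `d` of a cyclic repetition. -/
theorem exists_cyc_eq_of_cyc_eq : ∀ (k : ℕ) (cur x z : List ℕ),
    cyc (d :: β) k cur = x ++ d :: z → (∀ b ∈ cur, d < b) → (∀ b ∈ β, d < b) →
      ∃ k', z = cyc (d :: β) k' β
  | 0, cur, x, z, h, _, _ => by simp at h
  | k + 1, [], x, z, h, _, hβ => by
    rw [cyc_succ_nil] at h
    rcases x with _ | ⟨a, x⟩
    · rw [List.nil_append, List.cons.injEq] at h
      exact ⟨k, h.2.symm⟩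
    · rw [List.cons_append, List.cons.injEq] at h
      exact exists_cyc_eq_of_cyc_eq k β x z h.2 hβ hβ
  | k + 1, c :: cur, [], z, h, hc, _ => by
    rw [cyc_succ_cons, List.nil_append, List.cons.injEq] at h
    exact absurd (hc c List.mem_cons_self) (by omega)
  | k + 1, c :: cur, a :: x, z, h, hc, hβ => by
    rw [cyc_succ_cons, List.cons_append, List.cons.injEq] at h
    exact exists_cyc_eq_of_cyc_eq k cur x z h.2 (fun b hb => hc b (List.mem_cons_of_mem _ hb)) hβ

/-- A stretch of entries above `d` contains no separator, so it lies inside a single copy of `β`. -/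
theorem infix_of_cyc_eq : ∀ (k : ℕ) (cur x v z : List ℕ),
    cyc (d :: β) k cur = x ++ (v ++ z) → cur <:+: β → (∀ b ∈ v, d < b) → v <:+: β
  | k, cur, [], v, z, h, hc, hv => (prefix_of_cyc_eq k cur v z h hv).isInfix.trans hc
  | 0, cur, a :: x, v, z, h, _, _ => by simp at h
  | k + 1, [], a :: x, v, z, h, _, hv => by
    rw [cyc_succ_nil, List.cons_append, List.cons.injEq] at h
    exact infix_of_cyc_eq k β x v z h.2 (List.infix_refl _) hv
  | k + 1, c :: cur, a :: x, v, z, h, hc, hv => by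
    rw [cyc_succ_cons, List.cons_append, List.cons.injEq] at h
    exact infix_of_cyc_eq k cur x v z h.2 ((List.suffix_cons c cur).isInfix.trans hc) hv

/-- The only new adjacencies lead from an entry that is at least `d` to the separator `d`, and these
do not go up. -/
theorem chain_cyc (h : (d :: β).IsChain (fun a b => b ≤ a + 1)) (hβ : ∀ b ∈ β, d < b) :
    ∀ (k : ℕ) (c : ℕ) (cur : List ℕ), d ≤ c → (c :: cur).IsChain (fun a b => b ≤ a + 1) →
      (c :: cur) <:+: d :: β → (c :: cyc (d :: β) k cur).IsChain (fun a b => b ≤ a + 1)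
  | 0, c, cur, _, _, _ => by simp
  | k + 1, c, [], hc, _, _ => by
    rw [cyc_succ_nil, List.isChain_cons_cons]
    exact ⟨by omega, chain_cyc h hβ k d β le_rfl h (List.infix_refl _)⟩
  | k + 1, c, b :: cur, hc, hch, hi => by
    rw [cyc_succ_cons, List.isChain_cons_cons]
    rw [List.isChain_cons_cons] at hch
    have hi' : (b :: cur) <:+: d :: β := (List.suffix_cons c (b :: cur)).isInfix.trans hi
    refine ⟨hch.1, chain_cyc h hβ k b cur ?_ hch.2 hi'⟩
    rcases List.mem_cons.1 (hi'.subset List.mem_cons_self) with h | h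
    · exact h.ge
    · exact (hβ b h).le

end Cyc

/-! ### The successor is canonical and is the next smaller canonical sequence. -/

section Successor

variable {d : ℕ} {w β o : List ℕ}

/-- Take two consecutive siblings. If both lie in the cyclic tail, either their depth is `d` and a
prefix of `β` is compared with `β`, or both lie inside one copy of `β`. If the second one opens the
tail, its block is a prefix of `β`, as in the given sequence. If both precede the tail and the
second block runs into it, that block only became smaller, because a `d` stands where `d + 1` was.
Otherwise nothing changed. -/
theorem siblingsSorted_successor (hs : SiblingsSorted (w ++ (d :: β ++ (d + 1) :: o)))
    (hβ : ∀ b ∈ β, d < b) (k : ℕ) :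
    SiblingsSorted (w ++ (d :: β ++ cyc (d :: β) (k + 1) [])) := by
  -- The kept block and the entries written behind it form a single cyclic repetition, so the `cyc`
  -- lemmas apply to the whole tail.
  have hC : d :: β ++ cyc (d :: β) (k + 1) [] = cyc (d :: β) (β.length + 1 + (k + 1)) [] := by
    have : ∀ cur : List ℕ, cur ++ cyc (d :: β) (k + 1) [] =
        cyc (d :: β) (cur.length + (k + 1)) cur := by
      intro cur
      induction cur with
      | nil => simp
      | cons c cur ih =>
        rw [List.cons_append, ih, List.length_cons, show cur.length + 1 + (k + 1) =
          cur.length + (k + 1) + 1 by ring, cyc_succ_cons]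
    rw [List.cons_append, this, show β.length + 1 + (k + 1) = β.length + (k + 1) + 1 by ring,
      cyc_succ_nil]
  have hge : ∀ b ∈ d :: β ++ cyc (d :: β) (k + 1) [], d ≤ b := by
    rw [hC]
    exact le_of_mem_cyc hβ _ _ (by simp)
  have hβs : SiblingsSorted β := hs.infix ⟨w ++ [d], (d + 1) :: o, by simp⟩
  have hws : SiblingsSorted w := hs.infix ⟨[], d :: β ++ (d + 1) :: o, by simp⟩
  intro x a u y z h hu hy
  rw [List.append_eq_append_iff] at h
  rcases h with ⟨x', rfl, h⟩ | ⟨w1, rfl, h⟩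
  · -- both entries `a` belong to the cyclic part
    rw [hC] at h
    have had : d ≤ a := by
      have := le_of_mem_cyc hβ (β.length + 1 + (k + 1)) [] (by simp) a (by rw [h]; simp)
      exact this
    rcases had.eq_or_lt with rfl | had
    · obtain ⟨k', hk'⟩ := exists_cyc_eq_of_cyc_eq _ _ _ _ h (by simp) hβ
      have h1 : u = β := eq_of_cyc_eq _ _ _ _ hk'.symm hβ hu
      obtain ⟨k'', hk''⟩ := exists_cyc_eq_of_cyc_eq _ _ _ _ hk'.symm hβ hβ
      have h2 : y <+: β := prefix_of_cyc_eq _ _ _ _ hk''.symm hy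
      exact h1 ▸ le_of_prefix h2
    · have h1 : a :: (u ++ (a :: y)) <:+: β := by
        refine infix_of_cyc_eq _ _ x' _ z (by rw [h]; simp) (List.nil_infix) ?_
        intro b hb
        simp only [List.mem_cons, List.mem_append] at hb
        rcases hb with rfl | hb | rfl | hb
        · exact had
        · exact had.trans (hu b hb)
        · exact had
        · exact had.trans (hy b hb)
      obtain ⟨p, q, hpq⟩ := h1
      exact hβs p a u y q (by rw [← hpq]; simp) hu hy
  · rcases w1 with _ | ⟨a', w1⟩
    · rw [List.nil_append] at h
      rw [hC] at h
      obtain rfl : d = a := by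
        rw [show β.length + 1 + (k + 1) = β.length + (k + 1) + 1 by ring, cyc_succ_nil,
          List.cons.injEq] at h
        exact h.1.symm
      obtain ⟨k', hk'⟩ := exists_cyc_eq_of_cyc_eq _ _ [] _ h.symm (by simp) hβ
      have h1 : u = β := eq_of_cyc_eq _ _ _ _ hk'.symm hβ hu
      obtain ⟨k'', hk''⟩ := exists_cyc_eq_of_cyc_eq _ _ _ _ hk'.symm hβ hβ
      have h2 : y <+: β := prefix_of_cyc_eq _ _ _ _ hk''.symm hy
      exact h1 ▸ le_of_prefix h2
    · rw [List.cons_append, List.cons.injEq] at h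
      obtain ⟨rfl, h⟩ := h
      rw [List.append_eq_append_iff] at h
      rcases h with ⟨w2, rfl, h⟩ | ⟨u', rfl, h⟩
      · rcases w2 with _ | ⟨a', w2⟩
        · -- the second entry `a` is the first one of the cyclic part
          rw [List.nil_append] at h
          rw [hC] at h
          obtain rfl : d = a := by
            rw [show β.length + 1 + (k + 1) = β.length + (k + 1) + 1 by ring, cyc_succ_nil,
              List.cons.injEq] at h
            exact h.1.symm
          obtain ⟨k', hk'⟩ := exists_cyc_eq_of_cyc_eq _ _ [] _ h.symm (by simp) hβ
          have h2 : y <+: β := prefix_of_cyc_eq _ _ _ _ hk'.symm hy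
          obtain ⟨y', rfl⟩ := h2
          exact hs x d u y (y' ++ (d + 1) :: o) (by simp) hu hy
        · rw [List.cons_append, List.cons.injEq] at h
          obtain ⟨rfl, h⟩ := h
          rw [List.append_eq_append_iff] at h
          rcases h with ⟨w3, rfl, h⟩ | ⟨y', rfl, h⟩
          · exact hws x a u y w3 (by simp) hu hy
          · rcases y' with _ | ⟨e, y'⟩
            · rw [List.append_nil] at hy ⊢
              exact hws x a u w2 [] (by simp) hu hy
            · have he : e = d := by
                rw [List.cons_append, List.cons_append, List.cons.injEq] at h
                exact h.1.symm
              subst he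
              have hae : a < e := hy e (by simp)
              -- In the given sequence the second sibling's descendants continue at least through
              -- the entry `d + 1`. Up to the end of `β` the new block agrees with this, and then it
              -- has `d` instead.
              have h1 : w2 ++ (e :: β ++ [e + 1]) ≤ u := by
                refine hs x a u _ o (by simp) hu fun b hb => ?_
                simp only [List.mem_append, List.mem_cons, List.not_mem_nil, or_false] at hb
                rcases hb with hb | (rfl | hb) | rfl
                · exact hy b (by simp [hb])
                · exact hae
                · exact hae.trans (hβ b hb)
                · omega
              refine le_trans ?_ h1
              rw [append_le_append_left_iff]
              rw [List.append_eq_append_iff] at h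
              rcases h with ⟨v, hv, h⟩ | ⟨v, hv, -⟩
              · rw [hv, append_le_append_left_iff]
                rcases v with _ | ⟨f, v⟩
                · exact le_of_prefix List.nil_prefix
                · rw [cyc_succ_nil, List.cons_append, List.cons.injEq] at h
                  rw [← h.1]
                  exact (mismatch_lt (c := []) (Nat.lt_succ_self e)).le
              · rw [hv, List.append_assoc]
                exact le_append_right _ _
      · rcases u' with _ | ⟨e, u'⟩
        · -- the second entry `a` is the first one of the cyclic part
          rw [List.nil_append] at h
          rw [hC] at h
          obtain rfl : d = a := by
            rw [show β.length + 1 + (k + 1) = β.length + (k + 1) + 1 by ring, cyc_succ_nil,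
              List.cons.injEq] at h
            exact h.1
          obtain ⟨k', hk'⟩ := exists_cyc_eq_of_cyc_eq _ _ [] _ h (by simp) hβ
          have h2 : y <+: β := prefix_of_cyc_eq _ _ _ _ hk'.symm hy
          obtain ⟨y', rfl⟩ := h2
          rw [List.append_nil] at hu ⊢
          exact hs x d w1 y (y' ++ (d + 1) :: o) (by simp) hu hy
        · have he : e = d := by
            rw [List.cons_append, List.cons_append, List.cons.injEq] at h
            exact h.1.symm
          have h1 : d ≤ a := hge a (by rw [h]; simp)
          exact absurd (hu e (by simp)) (by omega)

/-- The shape of a level sequence around its last entry that is at least `2`. -/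
theorem IsLevels.exists_block {r : List ℕ} {d : ℕ} {o : List ℕ}
    (h : IsLevels (r ++ (d + 1) :: o)) (hr : r ≠ []) :
    ∃ w β, r = w ++ d :: β ∧ ∀ b ∈ β, d < b := by
  obtain ⟨⟨u, hu, -⟩, hch⟩ := h
  -- Searching leftwards for the parent: levels rise by at most one, so the entry before an entry `e
  -- > d` is at least `d`. It is `d` itself or again above `d`, and the search ends because the
  -- first entry is `0`. Hence the generalization from `d + 1` to `e`.
  have key : ∀ (β r : List ℕ) (e : ℕ), r ≠ [] → r.head? = some 0 → d < e →
      (r ++ e :: β).IsChain (fun a b => b ≤ a + 1) →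
      ∃ w γ, r = w ++ d :: γ ∧ ∀ b ∈ γ, d < b := by
    intro β r
    induction r using List.reverseRecOn generalizing β with
    | nil => intro e h; exact absurd rfl h
    | append_singleton r a ih =>
      intro e _ h0 he hc
      rw [List.append_assoc, List.singleton_append] at hc
      have h1 : e ≤ a + 1 := by
        have := (List.isChain_append.1 hc).2.1
        rw [List.isChain_cons_cons] at this
        exact this.1
      rcases (show d ≤ a by omega).eq_or_lt with rfl | hda
      · exact ⟨r, [], rfl, by simp⟩
      · rcases eq_or_ne r [] with rfl | hr
        · simp at h0
          omega
        · have h0' : r.head? = some 0 := by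
            rw [List.head?_append_of_ne_nil _ hr] at h0
            exact h0
          obtain ⟨w, γ, rfl, hγ⟩ := ih (e :: β) a hr h0' hda hc
          refine ⟨w, γ ++ [a], by simp, fun b hb => ?_⟩
          rcases List.mem_append.1 hb with hb | hb
          · exact hγ b hb
          · rw [List.mem_singleton.1 hb]
            exact hda
  refine key o r (d + 1) hr ?_ (Nat.lt_succ_self d) hch
  have := congrArg List.head? hu
  rwa [List.head?_append_of_ne_nil _ hr] at this

/-- `0 < d` keeps the root unique: for `d = 0` the repetition would write a second `0`. This is why
the overwritten entry has to be at least `2`. -/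
theorem IsCanonLevels.successor (hs : IsCanonLevels (w ++ (d :: β ++ (d + 1) :: o)))
    (hd : 0 < d) (hβ : ∀ b ∈ β, d < b) (k : ℕ) :
    IsCanonLevels (w ++ (d :: β ++ cyc (d :: β) (k + 1) [])) := by
  obtain ⟨⟨⟨u, hu, hpos⟩, hch⟩, hsort⟩ := hs
  refine ⟨⟨?_, ?_⟩, siblingsSorted_successor hsort hβ k⟩
  · rcases w with _ | ⟨a, w⟩
    · rw [List.nil_append, List.cons_append, List.cons.injEq] at hu
      omega
    · rw [List.cons_append, List.cons.injEq] at hu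
      obtain ⟨rfl, rfl⟩ := hu
      refine ⟨w ++ (d :: β ++ cyc (d :: β) (k + 1) []), rfl, fun b hb => ?_⟩
      rw [List.mem_append, List.mem_append] at hb
      rcases hb with hb | hb | hb
      · exact hpos b (by simp [hb])
      · exact hpos b (List.mem_append_right _ (List.mem_append_left _ hb))
      · exact hd.trans_le (le_of_mem_cyc hβ _ _ (by simp) b hb)
  · have h1 : (w ++ d :: β).IsChain (fun a b => b ≤ a + 1) := by
      rw [← List.append_assoc] at hch
      exact (List.isChain_append.1 hch).1
    have h2 := List.isChain_append.1 h1
    rw [List.isChain_append]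
    have h3 : d :: β ++ cyc (d :: β) (k + 1) [] = d :: cyc (d :: β) (β.length + (k + 1)) β := by
      have : ∀ cur : List ℕ, cur ++ cyc (d :: β) (k + 1) [] =
          cyc (d :: β) (cur.length + (k + 1)) cur := by
        intro cur
        induction cur with
        | nil => simp
        | cons c cur ih =>
          rw [List.cons_append, ih, List.length_cons, show cur.length + 1 + (k + 1) =
            cur.length + (k + 1) + 1 by ring, cyc_succ_cons]
      rw [List.cons_append, this]
    refine ⟨h2.1, ?_, fun x hx y hy => h2.2.2 x hx y (by simpa using hy)⟩
    rw [h3]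
    exact chain_cyc h2.2.1 hβ _ d β le_rfl h2.2.1 (List.infix_refl _)

/-- After a sibling with block `β`, the next block can follow `β` (of which `β₁` is already copied)
or fall below it, but not exceed it. Once it has copied all of `β`, an entry above `d` would exceed
`β`; so at best a new sibling starts, and the completed copy becomes the reference for it. -/
theorem le_cyc_of_siblingsSorted (hβ : ∀ b ∈ β, d < b) : ∀ (k : ℕ) (w β₁ cur z : List ℕ),
    β = β₁ ++ cur → SiblingsSorted (w ++ d :: (β ++ d :: (β₁ ++ z))) → z.length = k →
      z ≤ cyc (d :: β) k cur
  | _, _, _, _, [], _, _, _ => le_of_prefix List.nil_prefix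
  | 0, _, _, _, _ :: _, _, _, h => by simp at h
  | k + 1, w, β₁, [], e :: z, hcur, hs, hl => by
    rw [List.append_nil] at hcur
    rw [cyc_succ_nil]
    rcases lt_trichotomy e d with he | he | he
    · exact (mismatch_lt (c := []) he).le
    · rw [he, ← List.singleton_append, ← List.singleton_append (l := cyc _ _ _),
        append_le_append_left_iff]
      refine le_cyc_of_siblingsSorted hβ k (w ++ d :: β) [] β z rfl ?_ (by simpa using hl)
      simpa [← hcur, he] using hs
    · have h1 : β ++ [e] ≤ β ++ [] := by
        rw [← hcur] at hs
        rw [List.append_nil]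
        refine hs w d β (β ++ [e]) z (by simp) hβ fun b hb => ?_
        rcases List.mem_append.1 hb with hb | hb
        · exact hβ b hb
        · rw [List.mem_singleton.1 hb]
          exact he
      rw [append_le_append_left_iff] at h1
      exact absurd h1 (not_le.2 (List.nil_lt_cons e []))
  | k + 1, w, β₁, c :: cur, e :: z, hcur, hs, hl => by
    rw [cyc_succ_cons]
    rcases lt_trichotomy e c with he | he | he
    · exact (mismatch_lt (c := []) he).le
    · rw [he, ← List.singleton_append, ← List.singleton_append (l := cyc _ _ _),
        append_le_append_left_iff]
      rw [he] at hs
      refine le_cyc_of_siblingsSorted hβ k w (β₁ ++ [c]) cur z (by simp [hcur]) ?_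
        (by simpa using hl)
      simpa using hs
    · have h1 : β₁ ++ [e] ≤ β₁ ++ c :: cur := by
        rw [← hcur]
        refine hs w d β (β₁ ++ [e]) z (by simp) hβ fun b hb => ?_
        rcases List.mem_append.1 hb with hb | hb
        · exact hβ b (by rw [hcur]; exact List.mem_append_left _ hb)
        · rw [List.mem_singleton.1 hb]
          exact (hβ c (by rw [hcur]; simp)).trans he
      rw [append_le_append_left_iff] at h1
      exact absurd h1 (not_le.2 (mismatch_lt (c := []) he))

/-- Among the canonical level sequences that are less than a given one, its successor is the
largest. -/
theorem IsCanonLevels.le_successor {z : List ℕ} (hz : IsCanonLevels z) (hβ : ∀ b ∈ β, d < b)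
    (ho : ∀ b ∈ o, b < 2) (hl : z.length = (w ++ (d :: β ++ (d + 1) :: o)).length)
    (h : z < w ++ (d :: β ++ (d + 1) :: o)) :
    z ≤ w ++ (d :: β ++ cyc (d :: β) (o.length + 1) []) := by
  obtain ⟨c, a, b, z', s', rfl, hs, hab⟩ := exists_mismatch_of_lt h hl
  rw [← List.append_assoc, List.append_eq_append_iff] at hs
  -- The first mismatch is at the overwritten entry, inside `o`, or before the overwritten entry. At
  -- that entry `z` has at most `d`, and `le_cyc_of_siblingsSorted` bounds the rest if it has
  -- exactly `d`. Inside `o` the entry of `z` would be `0`. Earlier, the successor still agrees with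
  -- the given sequence.
  rcases hs with ⟨v, rfl, hs⟩ | ⟨v, hv, hs⟩
  · rcases v with _ | ⟨e, v⟩
    · rw [List.nil_append, List.cons.injEq] at hs
      rw [← List.append_assoc, List.append_nil, append_le_append_left_iff, cyc_succ_nil]
      rcases (show a ≤ d by omega).eq_or_lt with rfl | had
      · rw [← List.singleton_append, ← List.singleton_append (l := cyc _ _ _),
          append_le_append_left_iff]
        refine le_cyc_of_siblingsSorted hβ _ w [] β z' rfl ?_ ?_
        · simpa using hz.sorted
        · simp at hl
          omega
      · exact (mismatch_lt (c := []) had).le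
    · rw [List.cons_append, List.cons.injEq] at hs
      have hb : b < 2 := ho b (by rw [hs.2]; simp)
      obtain ⟨⟨u, hu, hpos⟩, -⟩ := hz.toIsLevels
      have ha : 0 < a := by
        rcases w with _ | ⟨w0, w⟩
        · simp at hu
          exact hpos a (by rw [← hu.2]; simp)
        · simp at hu
          exact hpos a (by rw [← hu.2]; simp)
      omega
  · rcases v with _ | ⟨e, v⟩
    · rw [List.nil_append, List.cons.injEq] at hs
      rw [List.append_nil] at hv
      subst hv
      rw [← List.append_assoc, append_le_append_left_iff, cyc_succ_nil]
      rcases (show a ≤ d by omega).eq_or_lt with rfl | had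
      · rw [← List.singleton_append, ← List.singleton_append (l := cyc _ _ _),
          append_le_append_left_iff]
        refine le_cyc_of_siblingsSorted hβ _ w [] β z' rfl ?_ ?_
        · simpa using hz.sorted
        · simp at hl
          omega
      · exact (mismatch_lt (c := []) had).le
    · rw [List.cons_append, List.cons.injEq] at hs
      rw [← List.append_assoc, hv, ← hs.1, List.append_assoc, List.cons_append]
      exact (mismatch_lt hab).le

theorem successor_lt (k : ℕ) :
    w ++ (d :: β ++ cyc (d :: β) (k + 1) []) < w ++ (d :: β ++ (d + 1) :: o) := by
  rw [← List.append_assoc, ← List.append_assoc, cyc_succ_nil]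
  exact mismatch_lt (Nat.lt_succ_self d)

/-- The star has the smallest level sequence. -/
theorem IsLevels.le_of_forall_lt_two {s z : List ℕ} (hz : IsLevels z) (hl : z.length = s.length)
    (hs : ∀ b ∈ s, b < 2) (hs0 : s.head? = some 0) : s ≤ z := by
  by_contra h
  obtain ⟨c, a, b, z', s', rfl, rfl, hab⟩ := exists_mismatch_of_lt (not_le.1 h) hl
  have hb := hs b (by simp)
  obtain ⟨⟨u, hu, hpos⟩, -⟩ := hz
  rcases c with _ | ⟨c0, c⟩
  · simp at hs0
    omega
  · rw [List.cons_append, List.cons.injEq] at hu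
    have := hpos a (by rw [← hu.2]; simp)
    omega

/-- The path has the largest level sequence. -/
theorem IsLevels.le_range {z : List ℕ} (hz : IsLevels z) : z ≤ List.range z.length := by
  by_contra h
  obtain ⟨c, a, b, z', s', h1, h2, hab⟩ := exists_mismatch_of_lt (not_le.1 h) (by simp)
  have h3 : ∀ (i : ℕ) (hi : i < z.length), z[i] ≤ i := by
    intro i
    induction i with
    | zero =>
      intro hi
      obtain ⟨⟨u, rfl, -⟩, -⟩ := hz
      simp
    | succ i ih =>
      intro hi
      exact (List.isChain_iff_getElem.1 hz.chain i hi).trans (Nat.succ_le_succ (ih (by omega)))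
  have h4 : (List.range z.length)[c.length]? = some a := by rw [h1]; simp
  have h5 : z[c.length]? = some b := by
    conv_lhs => rw [h2]
    simp
  obtain ⟨h6, h7⟩ := List.getElem?_eq_some_iff.1 h4
  obtain ⟨h8, h9⟩ := List.getElem?_eq_some_iff.1 h5
  rw [List.getElem_range] at h7
  have := h3 _ h8
  omega

end Successor

theorem map_succ_le_map_succ_iff {a b : List ℕ} :
    a.map (· + 1) ≤ b.map (· + 1) ↔ a ≤ b := by
  have key : ∀ a b : List ℕ, a < b → a.map (· + 1) < b.map (· + 1) := by
    intro a
    induction a with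
    | nil =>
      rintro (_ | ⟨b0, b⟩) h
      · exact absurd h (lt_irrefl _)
      · exact List.nil_lt_cons _ _
    | cons a0 a ih =>
      rintro (_ | ⟨b0, b⟩) h
      · simp at h
      · rw [List.map_cons, List.map_cons]
        rcases List.cons_lt_cons_iff.1 h with h | ⟨h0, h⟩
        · exact List.cons_lt_cons_iff.2 (Or.inl (Nat.succ_lt_succ h))
        · exact List.cons_lt_cons_iff.2 (Or.inr ⟨by rw [h0], ih b h⟩)
  constructor
  · intro h
    by_contra h'
    exact absurd (key _ _ (not_le.1 h')) (not_lt.2 h)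
  · intro h
    by_contra h'
    rcases lt_or_eq_of_le h with h | rfl
    · exact absurd (key _ _ h) (not_lt.2 (not_le.1 h').le)
    · exact h' le_rfl

namespace PlaneTree

/-! # Level sequences of plane trees -/

/-- The depths of the vertices of a plane tree in preorder, where the root has depth `d`. -/
def lev : ℕ → PlaneTree → List ℕ
  | d, leaf => [d]
  | d, join t c => lev d t ++ lev (d + 1) c

theorem length_lev : ∀ (d : ℕ) (t : PlaneTree), (lev d t).length = t.size
  | _, leaf => rfl
  | d, join t c => by rw [lev, List.length_append, length_lev d t, length_lev (d + 1) c, size]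

theorem exists_lev_eq_cons : ∀ (d : ℕ) (t : PlaneTree),
    ∃ u, lev d t = d :: u ∧ ∀ b ∈ u, d < b
  | d, leaf => ⟨[], rfl, by simp⟩
  | d, join t c => by
    obtain ⟨u, hu, hu'⟩ := exists_lev_eq_cons d t
    obtain ⟨v, hv, hv'⟩ := exists_lev_eq_cons (d + 1) c
    refine ⟨u ++ lev (d + 1) c, by rw [lev, hu]; rfl, fun b hb => ?_⟩
    rw [hv] at hb
    rcases List.mem_append.1 hb with hb | hb
    · exact hu' b hb
    · rcases List.mem_cons.1 hb with rfl | hb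
      · exact Nat.lt_succ_self d
      · exact (Nat.lt_succ_self d).trans (hv' b hb)

theorem lev_succ : ∀ (d : ℕ) (t : PlaneTree), lev (d + 1) t = (lev d t).map (· + 1)
  | _, leaf => rfl
  | d, join t c => by rw [lev, lev_succ d t, lev_succ (d + 1) c, lev, List.map_append]

theorem lev_le_lev_iff {s t : PlaneTree} : ∀ {d : ℕ}, lev d s ≤ lev d t ↔ lev 0 s ≤ lev 0 t
  | 0 => Iff.rfl
  | d + 1 => by rw [lev_succ, lev_succ, map_succ_le_map_succ_iff, lev_le_lev_iff]

theorem le_of_mem_lev {d b : ℕ} {t : PlaneTree} (h : b ∈ lev d t) : d ≤ b := by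
  obtain ⟨u, hu, hu'⟩ := exists_lev_eq_cons d t
  rw [hu] at h
  rcases List.mem_cons.1 h with rfl | h
  · exact le_rfl
  · exact (hu' b h).le

theorem isChain_lev : ∀ (d : ℕ) (t : PlaneTree), (lev d t).IsChain (fun a b => b ≤ a + 1)
  | _, leaf => by simp [lev]
  | d, join t c => by
    rw [lev, List.isChain_append]
    refine ⟨isChain_lev d t, isChain_lev (d + 1) c, fun x hx y hy => ?_⟩
    obtain ⟨u, hu, -⟩ := exists_lev_eq_cons (d + 1) c
    rw [hu, List.head?_cons, Option.mem_some_iff] at hy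
    have := le_of_mem_lev (List.mem_of_getLast? hx)
    omega

theorem isLevels_lev (t : PlaneTree) : IsLevels (lev 0 t) :=
  ⟨exists_lev_eq_cons 0 t, isChain_lev 0 t⟩

/-- Split a list at the last occurrence of an element. -/
theorem exists_last_occurrence {α : Type*} [DecidableEq α] {a : α} : ∀ {l : List α}, a ∈ l →
    ∃ x y, l = x ++ a :: y ∧ a ∉ y
  | b :: l, h => by
    by_cases hl : a ∈ l
    · obtain ⟨x, y, rfl, hy⟩ := exists_last_occurrence hl
      exact ⟨b :: x, y, rfl, hy⟩
    · rcases List.mem_cons.1 h with rfl | h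
      · exact ⟨[], l, rfl, hl⟩
      · exact absurd h hl

/-- The last child of the root starts at the last entry `d + 1`; splitting there leaves two shorter
sequences of the same kind. -/
theorem exists_lev_eq : ∀ (n d : ℕ) (u : List ℕ), u.length = n → (∀ b ∈ u, d < b) →
    (d :: u).IsChain (fun a b => b ≤ a + 1) → ∃ t, lev d t = d :: u := by
  intro n
  induction n using Nat.strong_induction_on with
  | _ n ih =>
    rintro d (_ | ⟨b, v⟩) hn hu hc
    · exact ⟨leaf, rfl⟩
    · have hb : b = d + 1 := by
        have h1 := hu b (by simp)
        rw [List.isChain_cons_cons] at hc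
        omega
      have hmem : d + 1 ∈ b :: v := by simp [hb]
      obtain ⟨x, y, hxy, hy⟩ := exists_last_occurrence hmem
      have hl := congrArg List.length hxy
      simp at hl hn
      rw [hxy, ← List.cons_append, List.isChain_append] at hc
      obtain ⟨t, ht⟩ := ih x.length (by omega) d x rfl
        (fun b hb => hu b (by rw [hxy]; exact List.mem_append_left _ hb)) hc.1
      obtain ⟨c, hc⟩ := ih y.length (by omega) (d + 1) y rfl (fun b hb => by
        have h1 := hu b (by rw [hxy]; simp [hb])
        have h2 : b ≠ d + 1 := fun h => hy (h ▸ hb)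
        omega) hc.2.1
      exact ⟨join t c, by rw [lev, ht, hc, hxy]; rfl⟩

theorem exists_lev_eq_of_isLevels {s : List ℕ} (h : IsLevels s) : ∃ t, lev 0 t = s := by
  obtain ⟨⟨u, rfl, hu⟩, hc⟩ := h
  exact exists_lev_eq _ 0 u rfl hu hc

/-! # Plane trees in canonical form -/

/-- The last child of the root. -/
def lastChild : PlaneTree → Option PlaneTree
  | leaf => none
  | join _ c => some c

/-- The children of every vertex are sorted by their level sequences. -/
def IsCanon : PlaneTree → Prop
  | leaf => True
  | join t c => IsCanon t ∧ IsCanon c ∧ ∀ c' ∈ lastChild t, lev 0 c ≤ lev 0 c'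

/-- Behind its first entry the block of the last child is deeper than `d + 1`, so that block begins
at the last occurrence of `d + 1`. -/
theorem exists_lastChild_of_lev_eq {d : ℕ} {t : PlaneTree} {x u : List ℕ}
    (hp : lev d t = x ++ (d + 1) :: u) (hu : ∀ b ∈ u, d + 1 < b) :
    ∃ c ∈ lastChild t, lev (d + 1) c = (d + 1) :: u := by
  rcases t with _ | ⟨t, c⟩
  · have h := congrArg List.length hp
    simp only [lev, List.length_append, List.length_cons, List.length_nil] at h
    obtain rfl : x = [] := List.eq_nil_of_length_eq_zero (by omega)
    simp [lev] at hp
  · obtain ⟨v, hw, hw'⟩ := exists_lev_eq_cons (d + 1) c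
    refine ⟨c, rfl, ?_⟩
    rw [lev, hw, List.append_eq_append_iff] at hp
    rw [hw]
    rcases hp with ⟨q, -, hq⟩ | ⟨q, -, hq⟩
    · rcases q with _ | ⟨q0, q⟩
      · simpa using hq
      · rw [List.cons_append, List.cons.injEq] at hq
        have := hw' (d + 1) (by rw [hq.2]; simp)
        omega
    · rcases q with _ | ⟨q0, q⟩
      · simpa using hq.symm
      · rw [List.cons_append, List.cons.injEq] at hq
        have := hu (d + 1) (by rw [hq.2]; simp)
        omega

/-- Two consecutive siblings on different sides of the junction can only be the last child of `t`
and `c`, which is the comparison in `IsCanon`. All other pairs lie in one part, and the second block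
cannot cross the junction, since its root would be a second entry `d` in `lev d t`. -/
theorem siblingsSorted_lev_iff : ∀ (d : ℕ) (t : PlaneTree),
    SiblingsSorted (lev d t) ↔ IsCanon t
  | d, leaf => by
    refine iff_of_true ?_ trivial
    intro x a u y z h
    have := congrArg List.length h
    simp [lev] at this
    omega
  | d, join t c => by
    rw [lev, IsCanon, ← siblingsSorted_lev_iff d t, ← siblingsSorted_lev_iff (d + 1) c]
    obtain ⟨v, hv, hv'⟩ := exists_lev_eq_cons (d + 1) c
    constructor
    · intro h
      refine ⟨h.infix ⟨[], lev (d + 1) c, by simp⟩, h.infix ⟨lev d t, [], by simp⟩, ?_⟩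
      intro c' hc'
      rcases t with _ | ⟨t, c''⟩
      · simp [lastChild] at hc'
      · simp only [lastChild, Option.mem_some_iff] at hc'
        subst hc'
        obtain ⟨v', hw, hw'⟩ := exists_lev_eq_cons (d + 1) c''
        rw [← lev_le_lev_iff (d := d + 1), hv, hw]
        rw [lev, hv, hw] at h
        have h1 := h (lev d t) (d + 1) v' v [] (by simp) hw' hv'
        exact (append_le_append_left_iff (c := [d + 1])).2 h1
    · rintro ⟨h1, h2, h3⟩ x a u y z h hu hy
      rw [List.append_eq_append_iff] at h
      rcases h with ⟨p, rfl, h⟩ | ⟨p, hp, h⟩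
      · exact h2 p a u y z h hu hy
      rcases p with _ | ⟨a', p⟩
      · exact h2 [] a u y z (by rw [List.nil_append] at h ⊢; exact h.symm) hu hy
      rw [List.cons_append, List.cons.injEq] at h
      obtain ⟨rfl, h⟩ := h
      rw [List.append_eq_append_iff] at h
      rcases h with ⟨q, rfl, h⟩ | ⟨q, rfl, h⟩
      · rcases q with _ | ⟨a', q⟩
        · rw [List.nil_append, hv, List.cons.injEq] at h
          obtain ⟨rfl, h⟩ := h
          rw [List.append_nil] at hp
          obtain ⟨c', hc', hw⟩ := exists_lastChild_of_lev_eq hp hu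
          have h4 := h3 c' hc'
          rw [← lev_le_lev_iff (d := d + 1), hv, hw] at h4
          exact (le_of_prefix ⟨z, h⟩).trans ((append_le_append_left_iff (c := [d + 1])).1 h4)
        · rw [List.cons_append, List.cons.injEq] at h
          obtain ⟨rfl, h⟩ := h
          rw [List.append_eq_append_iff] at h
          rcases h with ⟨q', rfl, h⟩ | ⟨q', rfl, h⟩
          · exact h1 x a u y q' hp hu hy
          · rcases q' with _ | ⟨e, q'⟩
            · rw [List.append_nil] at hy ⊢
              exact h1 x a u q [] (by simpa using hp) hu hy
            · rw [hv, List.cons_append, List.cons.injEq] at h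
              obtain ⟨rfl, h⟩ := h
              have h4 : a < d + 1 := hy (d + 1) (by simp)
              obtain ⟨v', hw, hw'⟩ := exists_lev_eq_cons d t
              have h5 : d ≤ a := le_of_mem_lev (t := t) (by rw [hp]; simp)
              obtain rfl : d = a := by omega
              rw [hw] at hp
              have h6 : d ∈ v' := by
                rcases x with _ | ⟨x0, x⟩
                · rw [List.nil_append, List.cons.injEq] at hp
                  rw [hp.2]
                  simp
                · rw [List.cons_append, List.cons.injEq] at hp
                  rw [hp.2]
                  simp
              exact absurd (hw' d h6) (lt_irrefl d)
      · rcases q with _ | ⟨e, q⟩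
        · rw [List.nil_append, hv, List.cons.injEq] at h
          obtain ⟨rfl, h⟩ := h
          rw [List.append_nil] at hu ⊢
          obtain ⟨c', hc', hw⟩ := exists_lastChild_of_lev_eq hp hu
          have h4 := h3 c' hc'
          rw [← lev_le_lev_iff (d := d + 1), hv, hw] at h4
          exact (le_of_prefix ⟨z, h.symm⟩).trans ((append_le_append_left_iff (c := [d + 1])).1 h4)
        · have h4 : d + 1 ≤ a := le_of_mem_lev (t := c) (by rw [h]; simp)
          rw [hv, List.cons_append, List.cons.injEq] at h
          have h5 := hu e (by simp)
          omega

theorem isCanonLevels_lev_iff {t : PlaneTree} : IsCanonLevels (lev 0 t) ↔ IsCanon t := by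
  rw [← siblingsSorted_lev_iff 0]
  exact ⟨fun h => h.sorted, fun h => ⟨isLevels_lev t, h⟩⟩

theorem IsCanon.sub : ∀ {t : PlaneTree}, IsCanon t → ∀ i : Child t, IsCanon (sub t i)
  | join _ _, h, none => h.2.1
  | join _ _, h, some i => h.1.sub i

theorem IsCanon.le_sub : ∀ {t c : PlaneTree}, IsCanon (join t c) → ∀ i : Child (join t c),
    lev 0 c ≤ lev 0 (PlaneTree.sub (join t c) i)
  | _, _, _, none => le_rfl
  | join _ c', _, h, some i => (h.2.2 c' rfl).trans (h.1.le_sub i)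

end PlaneTree

open Timed

namespace Timed

variable {α β : Type}

@[simp] theorem val_bind (x : Timed α) (f : α → Timed β) : (x >>= f).val = (f x.val).val := rfl
@[simp] theorem time_bind (x : Timed α) (f : α → Timed β) :
    (x >>= f).time = x.time + (f x.val).time := rfl
@[simp] theorem val_step (a : α) : (step a).val = a := rfl
@[simp] theorem time_step (a : α) : (step a).time = 1 := rfl
@[simp] theorem val_steps (k : ℕ) (a : α) : (steps k a).val = a := rfl
@[simp] theorem time_steps (k : ℕ) (a : α) : (steps k a).time = k := rfl

end Timed

namespace PlaneTree

/-- `exists_lastChild_of_lev_eq` recovers the sequence of the last child, hence that child;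
cancelling it leaves the rest of the tree. -/
theorem levels_injective : Function.Injective (lev 0) := by
  have key : ∀ (s t : PlaneTree) (d : ℕ), lev d s = lev d t → s = t := by
    intro s
    induction s with
    | leaf =>
      intro t d h
      rcases t with _ | ⟨t, c⟩
      · rfl
      · have h1 := congrArg List.length h
        rw [length_lev, length_lev, size, size] at h1
        have := size_pos t
        have := size_pos c
        omega
    | join s c ih1 ih2 =>
      intro t d h
      rcases t with _ | ⟨t, c'⟩
      · have h1 := congrArg List.length h
        rw [length_lev, length_lev, size, size] at h1
        have := size_pos s
        have := size_pos c
        omega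
      · obtain ⟨u, hu, hu'⟩ := exists_lev_eq_cons (d + 1) c
        have h1 : lev d (join t c') = lev d s ++ (d + 1) :: u := by rw [← h, lev, hu]
        obtain ⟨c'', hc, hc'⟩ := exists_lastChild_of_lev_eq h1 hu'
        simp only [lastChild, Option.mem_some_iff] at hc
        subst hc
        have h2 : c = c' := ih2 c' (d + 1) (by rw [hu, hc'])
        subst h2
        rw [lev, lev, List.append_left_inj] at h
        rw [ih1 t d h]
  exact fun s t h => key s t 0 h

/-- The children do not increase, so a child equal to the last one is followed only by copies of it.
Removing any of these copies leaves the same tree. -/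
theorem rest_eq_of_sub_eq : ∀ {t c : PlaneTree}, IsCanon (join t c) →
    ∀ i : Child (join t c), sub (join t c) i = c → rest (join t c) i = t
  | _, _, _, none, _ => rfl
  | join t' c', c, h, some j, hj => by
    have h1 : lev 0 c ≤ lev 0 c' := h.2.2 c' rfl
    have h2 : lev 0 c' ≤ lev 0 c := by
      rw [← hj]
      exact h.1.le_sub j
    obtain rfl : c = c' := levels_injective (le_antisymm h1 h2)
    have h3 := rest_eq_of_sub_eq h.1 j hj
    exact congrArg (fun s => join s c) h3

/-- Isomorphic plane trees in canonical form are equal. -/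
theorem IsCanon.eq_of_isIso : ∀ {s t : PlaneTree}, IsCanon s → IsCanon t →
    s.toGraph.IsIso t.toGraph → s = t
  | leaf, leaf, _, _, _ => rfl
  | leaf, join t c, _, _, h => by
    have h1 := size_eq_of_isIso h
    have := size_pos t
    have := size_pos c
    rw [size, size] at h1
    omega
  | join t c, leaf, _, _, h => by
    have h1 := size_eq_of_isIso h
    have := size_pos t
    have := size_pos c
    rw [size, size] at h1
    omega
  | join t c, join t' c', h1, h2, h => by
    obtain ⟨i, hi, hi'⟩ := (isIso_join_iff t c _).1 h
    obtain ⟨j, hj, hj'⟩ := (isIso_join_iff t' c' _).1 h.symm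
    -- Each last child is isomorphic, hence by induction equal, to some child of the other tree.
    -- Both are smallest among the children of their trees, so they coincide.
    have e1 : c = PlaneTree.sub (join t' c') i := eq_of_isIso h1.2.1 (h2.sub i) hi'
    have e2 : c' = PlaneTree.sub (join t c) j := eq_of_isIso h2.2.1 (h1.sub j) hj'
    have h3 : lev 0 c' ≤ lev 0 c := by
      rw [e1]
      exact h2.le_sub i
    have h4 : lev 0 c ≤ lev 0 c' := by
      rw [e2]
      exact h1.le_sub j
    have h5 : c = c' := levels_injective (le_antisymm h4 h3)
    rw [rest_eq_of_sub_eq h2 i (e1.symm.trans h5)] at hi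
    have h6 : t = t' := eq_of_isIso h1.1 h2.1 hi
    rw [h5, h6]
termination_by s => s.size
decreasing_by
  all_goals
    have := size_pos t
    have := size_pos c
    have := size_pos t'
    have := size_pos c'
    have := size_eq_of_isIso h
    simp only [size] at *
    omega

open Classical in
/-- Insert a child so that the children remain sorted. -/
noncomputable def insertChild (c : PlaneTree) : PlaneTree → PlaneTree
  | leaf => join leaf c
  | join t c' => if lev 0 c ≤ lev 0 c' then join (join t c') c else join (insertChild c t) c'

theorem isIso_insertChild (c : PlaneTree) : ∀ t : PlaneTree,
    (join t c).toGraph.IsIso (insertChild c t).toGraph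
  | leaf => IsIso.refl _
  | join t c' => by
    by_cases h : lev 0 c ≤ lev 0 c'
    · rw [insertChild, if_pos h]
      exact IsIso.refl _
    · rw [insertChild, if_neg h]
      have h1 : (join (join t c') c).toGraph.IsIso (join (join t c) c').toGraph :=
        ⟨joinComm t.toGraph c'.toGraph c.toGraph⟩
      exact h1.trans ((isIso_insertChild c t).join (IsIso.refl c'.toGraph))

theorem lastChild_insertChild (c : PlaneTree) (t : PlaneTree) :
    ∀ c' ∈ lastChild (insertChild c t), c' = c ∨ c' ∈ lastChild t := by
  rcases t with _ | ⟨t, c''⟩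
  · simp [insertChild, lastChild]
  · rw [insertChild]
    split_ifs <;> simp [lastChild]

theorem IsCanon.insertChild {c : PlaneTree} (hc : IsCanon c) : ∀ {t : PlaneTree}, IsCanon t →
    IsCanon (insertChild c t)
  | leaf, _ => ⟨trivial, hc, by simp [lastChild]⟩
  | join t c', h => by
    rw [PlaneTree.insertChild]
    split_ifs with hcc
    · exact ⟨h, hc, by simpa [lastChild] using hcc⟩
    · refine ⟨hc.insertChild h.1, h.2.1, fun c'' hc'' => ?_⟩
      rcases lastChild_insertChild c t c'' hc'' with rfl | h'
      · exact (not_le.1 hcc).le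
      · exact h.2.2 c'' h'

/-- Insertion sort of the children at every vertex; each exchange is a `joinComm`. -/
theorem exists_isCanon_isIso : ∀ t : PlaneTree, ∃ s, IsCanon s ∧ t.toGraph.IsIso s.toGraph
  | leaf => ⟨leaf, trivial, IsIso.refl _⟩
  | join t c => by
    obtain ⟨t', ht, ht'⟩ := exists_isCanon_isIso t
    obtain ⟨c', hc, hc'⟩ := exists_isCanon_isIso c
    exact ⟨insertChild c' t', hc.insertChild ht, (ht'.join hc').trans (isIso_insertChild c' t')⟩

/-! # Automorphisms -/

theorem val_equalTrees : ∀ s t : PlaneTree, (equalTrees s t).val = true ↔ s = t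
  | leaf, leaf => by simp [equalTrees]
  | leaf, join _ _ => by simp [equalTrees]
  | join _ _, leaf => by simp [equalTrees]
  | join t c, join t' c' => by
    simp [equalTrees, val_equalTrees t t', val_equalTrees c c']

open Classical in
theorem val_countChildren (c : PlaneTree) : ∀ t : PlaneTree,
    (countChildren c t).val = ∑ i : Child t, if sub t i = c then 1 else 0
  | leaf => by
    have : IsEmpty (Child leaf) := inferInstanceAs (IsEmpty Empty)
    simp [countChildren]
  | join t c' => by
    have h1 : ∑ i : Child (join t c'), (if sub (join t c') i = c then 1 else 0) =
        (if c' = c then 1 else 0) + ∑ i : Child t, if sub t i = c then 1 else 0 :=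
      Fintype.sum_option _
    rw [h1, ← val_countChildren c t]
    by_cases h : c' = c
    · have h2 : (equalTrees c c').val = true := (val_equalTrees _ _).2 h.symm
      rw [if_pos h]
      simp [countChildren, h2, Nat.add_comm]
    · have h2 : (equalTrees c c').val = false := by
        rw [← Bool.not_eq_true, val_equalTrees]
        exact fun h' => h h'.symm
      simp [countChildren, h2, h]

/-- In `card_iso_join` with `s = join t c`, only children equal to `c` contribute, since canonical
isomorphic trees are equal. By `rest_eq_of_sub_eq` each of them contributes `aut t * aut c`. Besides
`c` itself there are `countChildren c t` of them. -/
theorem val_autTree : ∀ {t : PlaneTree}, IsCanon t → (autTree t).val = t.toGraph.aut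
  | leaf, _ => by
    have : Nat.card (leaf.toGraph.Iso leaf.toGraph) = 1 := by
      rw [Nat.card_eq_one_iff_unique]
      exact ⟨⟨fun e f => Iso.ext fun x => rfl⟩, ⟨Iso.refl _⟩⟩
    exact this.symm
  | join t c, h => by
    classical
    have h1 : ∑ i : Child (join t c), (Nat.card (t.toGraph.Iso (rest (join t c) i).toGraph) *
        Nat.card (c.toGraph.Iso (sub (join t c) i).toGraph)) =
        ∑ i : Child (join t c), (if sub (join t c) i = c then 1 else 0) *
          (t.toGraph.aut * c.toGraph.aut) := by
      refine Finset.sum_congr rfl fun i _ => ?_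
      split_ifs with hi
      · rw [rest_eq_of_sub_eq h i hi, hi, one_mul]
        rfl
      · rw [card_iso_eq_zero (G := c.toGraph) fun h' => hi (h.2.1.eq_of_isIso (h.sub i) h').symm,
          mul_zero, zero_mul]
    have h2 : ∑ i : Child (join t c), (if sub (join t c) i = c then 1 else 0) =
        (if c = c then 1 else 0) + ∑ i : Child t, if sub t i = c then 1 else 0 :=
      Fintype.sum_option _
    rw [aut, card_iso_join, h1, ← Finset.sum_mul, h2, if_pos rfl, ← val_countChildren,
      ← val_autTree h.1, ← val_autTree h.2.1]
    simp [autTree]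
    ring

/-! # Decoding level sequences -/

theorem val_absorb (d : ℕ) : ∀ (cs : List PlaneTree) (t : PlaneTree) (s : List (ℕ × PlaneTree)),
    (∀ p ∈ s, p.1 ≤ d) →
      (absorb d t (cs.map (fun c => (d + 1, c)) ++ s)).val = (cs.foldl join t, s)
  | [], t, [], _ => by simp [absorb]
  | [], t, (e, c) :: s, h => by
    have : e ≠ d + 1 := by
      have := h (e, c) (by simp)
      simp only at this
      omega
    simp [absorb, this]
  | c :: cs, t, s, h => by
    rw [List.map_cons, List.cons_append, absorb]
    simpa using val_absorb d cs (join t c) s h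

theorem val_loop_append {α σ : Type} (body : σ → α → Timed σ) (l l' : List α) (s : σ) :
    (loop body (l ++ l') s).val = (loop body l' (loop body l s).val).val := by
  induction l generalizing s with
  | nil => rfl
  | cons a l ih =>
    rw [List.cons_append, loop, loop]
    simp [ih]

/-- The sequence is read backwards, so children are finished before their parent and right ones
before left ones. In the induction `cs` holds the children that stand to the right of those of `t`
and are still to be attached to its root; `s` is the untouched rest of the stack. -/
theorem val_loop_treeOfLevels : ∀ (d : ℕ) (t : PlaneTree) (cs : List PlaneTree)
    (s : List (ℕ × PlaneTree)), (∀ p ∈ s, p.1 ≤ d) →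
      (loop (fun (s : List (ℕ × PlaneTree)) d => do
        let (t, s) ← absorb d PlaneTree.leaf s
        step ((d, t) :: s)) (lev d t).reverse (cs.map (fun c => (d + 1, c)) ++ s)).val =
        (d, cs.foldl join t) :: s
  | d, leaf, cs, s, h => by
    simp [lev, loop, val_absorb d cs leaf s h]
  | d, join t c, cs, s, h => by
    have h1 := val_loop_treeOfLevels (d + 1) c [] (cs.map (fun c => (d + 1, c)) ++ s) (by
      intro p hp
      rcases List.mem_append.1 hp with hp | hp
      · obtain ⟨c, -, rfl⟩ := List.mem_map.1 hp
        exact le_rfl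
      · exact (h p hp).trans (Nat.le_succ d))
    rw [List.map_nil, List.nil_append] at h1
    have h2 := val_loop_treeOfLevels d t (c :: cs) s h
    rw [lev, List.reverse_append, val_loop_append, h1]
    exact h2

theorem val_treeOfLevels (t : PlaneTree) : (treeOfLevels (lev 0 t).reverse).val = t := by
  have h := val_loop_treeOfLevels 0 t [] [] (by simp)
  rw [List.map_nil, List.nil_append] at h
  rw [treeOfLevels, val_bind, h]
  rfl

end PlaneTree

open PlaneTree

/-! ### Costs of loops and lists. -/

namespace Timed

/-- Amortized analysis: a single pass may be expensive if it lowers the potential `Φ`. It is needed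
for `treeOfLevels`; elsewhere `Φ = 0` suffices. -/
theorem time_loop_le_of_potential {α σ : Type} {body : σ → α → Timed σ} (Φ : σ → ℕ) (c : ℕ) :
    ∀ (l : List α) (s : σ), (∀ s, ∀ a ∈ l, (body s a).time + Φ (body s a).val ≤ Φ s + c) →
      (loop body l s).time + Φ (loop body l s).val ≤ Φ s + l.length * (c + 1) + 1
  | [], s, _ => by simp [loop, Nat.add_comm]
  | a :: l, s, h => by
    have h1 := time_loop_le_of_potential Φ c l (body s a).val
      fun s b hb => h s b (List.mem_cons_of_mem _ hb)
    have h2 := h s a List.mem_cons_self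
    simp only [loop, time_bind, time_step, val_bind, val_step, List.length_cons]
    linarith

theorem time_loop_le {α σ : Type} {body : σ → α → Timed σ} (c : ℕ) (l : List α) (s : σ)
    (h : ∀ s, ∀ a ∈ l, (body s a).time ≤ c) :
    (loop body l s).time ≤ l.length * (c + 1) + 1 := by
  have := time_loop_le_of_potential (body := body) (fun _ => 0) c l s (by simpa using h)
  simpa using this

@[simp] theorem val_mapList {α β : Type} (f : α → Timed β) : ∀ l : List α,
    (mapList f l).val = l.map fun a => (f a).val
  | [] => rfl
  | a :: l => by simp [mapList, val_mapList f l]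

theorem time_mapList_le {α β : Type} {f : α → Timed β} (c : ℕ) : ∀ l : List α,
    (∀ a ∈ l, (f a).time ≤ c) → (mapList f l).time ≤ l.length * (c + 2) + 1
  | [], _ => by simp [mapList]
  | a :: l, h => by
    have h1 := time_mapList_le c l fun b hb => h b (List.mem_cons_of_mem _ hb)
    have h2 := h a List.mem_cons_self
    simp only [mapList, time_bind, time_step, val_step, List.length_cons]
    linarith

@[simp] theorem val_append {α : Type} : ∀ l m : List α, (Timed.append l m).val = l ++ m
  | [], m => rfl
  | a :: l, m => by simp [Timed.append, val_append l m]

theorem time_append {α : Type} : ∀ l m : List α, (Timed.append l m).time = 2 * l.length + 1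
  | [], m => rfl
  | a :: l, m => by
    simp [Timed.append, time_append l m]
    ring

end Timed

/-! # The successor of a level sequence -/

theorem shallow_or_exists (l : List ℕ) : (∀ b ∈ l, b < 2) ∨
    ∃ o p r, l = o ++ p :: r ∧ (∀ b ∈ o, b < 2) ∧ 2 ≤ p := by
  induction l with
  | nil => exact Or.inl (by simp)
  | cons a l ih =>
    by_cases ha : a < 2
    · rcases ih with h | ⟨o, p, r, rfl, ho, hp⟩
      · exact Or.inl fun b hb => (List.mem_cons.1 hb).elim (fun h' => h' ▸ ha) (h b)
      · exact Or.inr ⟨a :: o, p, r, rfl, fun b hb => (List.mem_cons.1 hb).elim (fun h' => h' ▸ ha) (ho b), hp⟩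
    · exact Or.inr ⟨[], a, l, rfl, by simp, not_lt.1 ha⟩

theorem val_dropShallow_none {l : List ℕ} (h : ∀ b ∈ l, b < 2) : (dropShallow l).val = none := by
  induction l with
  | nil => rfl
  | cons a l ih =>
    have h1 : a ≤ 1 := Nat.le_of_lt_succ (h a List.mem_cons_self)
    have h2 := ih fun b hb => h b (List.mem_cons_of_mem _ hb)
    simp [dropShallow, h1, h2]

theorem val_dropShallow_some {o r : List ℕ} {p : ℕ} (h : ∀ b ∈ o, b < 2) (hp : 2 ≤ p) :
    (dropShallow (o ++ p :: r)).val = some (o.length, p, r) := by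
  induction o with
  | nil =>
    have : ¬ p ≤ 1 := by omega
    simp [dropShallow, this]
  | cons a l ih =>
    have h1 : a ≤ 1 := Nat.le_of_lt_succ (h a List.mem_cons_self)
    have h2 := ih fun b hb => h b (List.mem_cons_of_mem _ hb)
    simp [dropShallow, h1, h2]

theorem time_dropShallow_le (l : List ℕ) : (dropShallow l).time ≤ 4 * l.length + 2 := by
  induction l with
  | nil => simp [dropShallow]
  | cons a l ih =>
    by_cases h1 : a ≤ 1
    · rcases h2 : (dropShallow l).val with _ | ⟨k, p, r⟩
      · simp [dropShallow, h1, h2]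
        omega
      · simp [dropShallow, h1, h2]
        omega
    · simp [dropShallow, h1]
      omega

theorem val_takeBlock {d : ℕ} {γ r acc : List ℕ} (h : d ∉ γ) :
    (takeBlock d (γ ++ d :: r) acc).val = d :: (γ.reverse ++ acc) := by
  induction γ generalizing acc with
  | nil => simp [takeBlock]
  | cons a l ih =>
    simp only [List.mem_cons, not_or] at h
    have h1 : a ≠ d := fun h' => h.1 h'.symm
    simp [takeBlock, h1, ih h.2]

theorem time_takeBlock_le (d : ℕ) (l acc : List ℕ) :
    (takeBlock d l acc).time ≤ 4 * l.length + 1 := by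
  induction l generalizing acc with
  | nil => simp [takeBlock]
  | cons a l ih =>
    have := ih (a :: acc)
    by_cases h : a = d
    · simp [takeBlock, h]
      omega
    · simp [takeBlock, h]
      omega

theorem val_fillCyclic (d : ℕ) (β : List ℕ) : ∀ (k : ℕ) (cur acc : List ℕ),
    (fillCyclic (d :: β) k cur acc).val = (cyc (d :: β) k cur).reverse ++ acc
  | 0, _, _ => by simp [fillCyclic]
  | k + 1, [], acc => by
    simp [fillCyclic, val_fillCyclic d β k]
  | k + 1, b :: cur, acc => by
    simp [fillCyclic, val_fillCyclic d β k]

theorem time_fillCyclic_le (Q : List ℕ) : ∀ (k : ℕ) (cur acc : List ℕ),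
    (fillCyclic Q k cur acc).time ≤ 2 * k + 2
  | 0, _, _ => by simp [fillCyclic]
  | k + 1, [], acc => by
    rcases Q with _ | ⟨b, Q⟩
    · simp [fillCyclic]
    · have := time_fillCyclic_le (b :: Q) k Q (b :: acc)
      simp [fillCyclic]
      omega
  | k + 1, b :: cur, acc => by
    have := time_fillCyclic_le Q k cur (b :: acc)
    simp [fillCyclic]
    omega

theorem time_nextLevels_le (l : List ℕ) : (nextLevels l).time ≤ 10 * l.length + 8 := by
  have h0 := time_dropShallow_le l
  rcases shallow_or_exists l with h | ⟨o, p, r, rfl, ho, hp⟩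
  · simp [nextLevels, val_dropShallow_none h]
    omega
  · have h1 := time_takeBlock_le (p - 1) r []
    have h2 := time_fillCyclic_le (takeBlock (p - 1) r []).val (o.length + 1)
      (takeBlock (p - 1) r []).val r
    simp [nextLevels, val_dropShallow_some ho hp] at h0 ⊢
    omega

/-- The successor of a canonical level sequence, if there is one. -/
theorem IsCanonLevels.val_nextLevels {s : List ℕ} (hs : IsCanonLevels s) :
    ((nextLevels s.reverse).val = none ∧ ∀ b ∈ s, b < 2) ∨
    ∃ s', (nextLevels s.reverse).val = some s'.reverse ∧ IsCanonLevels s' ∧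
      s'.length = s.length ∧ s' < s ∧
      ∀ z, IsCanonLevels z → z.length = s.length → z < s → z ≤ s' := by
  rcases shallow_or_exists s.reverse with h | ⟨o, p, r, h, ho, hp⟩
  · exact Or.inl ⟨by simp [nextLevels, val_dropShallow_none h], by simpa using h⟩
  · have hs' : s = r.reverse ++ p :: o.reverse := by
      rw [← List.reverse_reverse s, h]
      simp
    obtain ⟨d, rfl⟩ : ∃ d, p = d + 1 := ⟨p - 1, by omega⟩
    have hr : r.reverse ≠ [] := by
      intro hr
      obtain ⟨u, hu, -⟩ := hs.exists_cons
      rw [hs', hr, List.nil_append, List.cons.injEq] at hu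
      omega
    rw [hs'] at hs
    obtain ⟨w, β, hw, hβ⟩ := hs.toIsLevels.exists_block hr
    have hs'' : s = w ++ (d :: β ++ (d + 1) :: o.reverse) := by
      rw [hs', hw]
      simp
    rw [← hs', hs''] at hs
    refine Or.inr ⟨w ++ (d :: β ++ cyc (d :: β) (o.length + 1) []), ?_,
      hs.successor (by omega) hβ _, ?_, ?_, ?_⟩
    · have hr' : r = β.reverse ++ d :: w.reverse := by
        rw [← List.reverse_reverse r, hw]
        simp
      have hd : d ∉ β.reverse := by
        rw [List.mem_reverse]
        exact fun h => lt_irrefl _ (hβ d h)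
      have h1 := val_takeBlock (r := w.reverse) (acc := []) hd
      rw [h, nextLevels, val_bind, val_dropShallow_some ho hp]
      simp [hr', h1, val_fillCyclic]
    · rw [hs'']
      simp [length_cyc]
    · rw [hs'']
      exact successor_lt _
    · intro z hz hl hzs
      rw [hs''] at hl hzs
      have := hz.le_successor hβ (by simpa using ho) hl hzs
      rwa [List.length_reverse] at this

/-! # The number of plane trees -/

/-- A plane tree as a binary tree. -/
def PlaneTree.toBinaryTree : PlaneTree → BinaryTree Unit
  | .leaf => .nil
  | .join t c => .node () t.toBinaryTree c.toBinaryTree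

theorem PlaneTree.toBinaryTree_injective : Function.Injective toBinaryTree := by
  intro s
  induction s with
  | leaf =>
    rintro (_ | ⟨t, c⟩) h
    · rfl
    · simp [toBinaryTree] at h
  | join s c ih1 ih2 =>
    rintro (_ | ⟨t, c'⟩) h
    · simp [toBinaryTree] at h
    · simp only [toBinaryTree, BinaryTree.node.injEq, true_and] at h
      rw [ih1 h.1, ih2 h.2]

theorem PlaneTree.numNodes_toBinaryTree : ∀ t : PlaneTree, t.toBinaryTree.numNodes + 1 = t.size
  | .leaf => rfl
  | .join t c => by
    rw [toBinaryTree, BinaryTree.numNodes, size, ← numNodes_toBinaryTree t,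
      ← numNodes_toBinaryTree c]
    ring

/-- A join is a binary node, so plane trees with `K` edges inject into binary trees with `K` nodes,
which are counted by a Catalan number. -/
theorem finite_and_ncard_size_le (K : ℕ) :
    {t : PlaneTree | t.size = K + 1}.Finite ∧ {t : PlaneTree | t.size = K + 1}.ncard ≤ 4 ^ K := by
  have h1 : Set.MapsTo toBinaryTree {t : PlaneTree | t.size = K + 1}
      (BinaryTree.treesOfNumNodesEq K : Set (BinaryTree Unit)) := by
    intro t ht
    rw [Finset.mem_coe, BinaryTree.mem_treesOfNumNodesEq]
    have := numNodes_toBinaryTree t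
    rw [Set.mem_ofPred_eq] at ht
    omega
  have h2 := Set.Finite.of_injOn h1 toBinaryTree_injective.injOn (Finset.finite_toSet _)
  refine ⟨h2, ?_⟩
  have h3 := Set.ncard_le_ncard_of_injOn _ h1 toBinaryTree_injective.injOn (Finset.finite_toSet _)
  rw [Set.ncard_coe_finset, BinaryTree.treesOfNumNodesEq_card_eq_catalan,
    catalan_eq_centralBinom_div] at h3
  calc _ ≤ _ := h3
    _ ≤ Nat.centralBinom K := Nat.div_le_self _ _
    _ ≤ 2 ^ (2 * K) := Nat.choose_le_two_pow _ _
    _ = 4 ^ K := by rw [pow_mul]; norm_num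

/-- The plane trees with `K` edges in canonical form. -/
def canonTrees (K : ℕ) : Set PlaneTree := {t | IsCanon t ∧ t.size = K + 1}

theorem canonTrees_subset (K : ℕ) : canonTrees K ⊆ {t : PlaneTree | t.size = K + 1} :=
  fun _ h => h.2

theorem finite_canonTrees (K : ℕ) : (canonTrees K).Finite :=
  (finite_and_ncard_size_le K).1.subset (canonTrees_subset K)

theorem ncard_canonTrees_le (K : ℕ) : (canonTrees K).ncard ≤ 4 ^ K :=
  (Set.ncard_le_ncard (canonTrees_subset K) (finite_and_ncard_size_le K).1).trans
    (finite_and_ncard_size_le K).2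

/-- With the Catalan bound this shows that the fuel of `listBulbs` never runs out. -/
theorem four_pow_le_succ_pow_succ (K : ℕ) : 4 ^ K ≤ (K + 1) ^ (K + 1) := by
  rcases Nat.lt_or_ge K 3 with h | h
  · interval_cases K <;> norm_num
  · calc 4 ^ K ≤ (K + 1) ^ K := Nat.pow_le_pow_left (by omega) K
      _ ≤ (K + 1) ^ (K + 1) := Nat.pow_le_pow_right (by omega) (by omega)

theorem setOf_isCanonLevels_eq (K : ℕ) :
    {z | IsCanonLevels z ∧ z.length = K + 1} = lev 0 '' canonTrees K := by
  ext z
  constructor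
  · rintro ⟨h1, h2⟩
    obtain ⟨t, rfl⟩ := exists_lev_eq_of_isLevels h1.toIsLevels
    rw [length_lev] at h2
    exact ⟨t, ⟨isCanonLevels_lev_iff.1 h1, h2⟩, rfl⟩
  · rintro ⟨t, ⟨h1, h2⟩, rfl⟩
    exact ⟨isCanonLevels_lev_iff.2 h1, by rw [length_lev, h2]⟩

/-! # Listing the rooted trees -/

/-- Nothing canonical lies strictly between `s` and its successor `s'`. So the sequences up to `s`
are `s` and those up to `s'`: each call uses up exactly one of the sequences that the fuel has to
cover. -/
theorem levelsFrom_spec (K : ℕ) : ∀ (fuel : ℕ) (s : List ℕ), IsCanonLevels s →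
    s.length = K + 1 → {z | (IsCanonLevels z ∧ z.length = K + 1) ∧ z ≤ s}.ncard ≤ fuel →
      (∀ z : List ℕ, z.reverse ∈ (levelsFrom fuel s.reverse).val ↔
        (IsCanonLevels z ∧ z.length = K + 1) ∧ z ≤ s) ∧
      (levelsFrom fuel s.reverse).val.Nodup ∧
      (levelsFrom fuel s.reverse).time ≤
        (levelsFrom fuel s.reverse).val.length * (10 * (K + 1) + 9) := by
  have hfin : ∀ s, {z | (IsCanonLevels z ∧ z.length = K + 1) ∧ z ≤ s}.Finite := fun s => by
    refine Set.Finite.subset (s := {z | IsCanonLevels z ∧ z.length = K + 1}) ?_ fun z hz => hz.1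
    rw [setOf_isCanonLevels_eq]
    exact (finite_canonTrees K).image _
  intro fuel
  induction fuel with
  | zero =>
    intro s hs hl h
    rw [Nat.le_zero, Set.ncard_eq_zero (hfin s)] at h
    have : s ∈ {z | (IsCanonLevels z ∧ z.length = K + 1) ∧ z ≤ s} := ⟨⟨hs, hl⟩, le_rfl⟩
    rw [h] at this
    exact this.elim
  | succ fuel ih =>
    intro s hs hl h
    have ht := time_nextLevels_le s.reverse
    rw [List.length_reverse, hl] at ht
    rcases hs.val_nextLevels with ⟨h1, h2⟩ | ⟨s', h1, hs', hl', hlt, hle⟩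
    · have h3 : levelsFrom (fuel + 1) s.reverse =
          ⟨[s.reverse], (nextLevels s.reverse).time + 1⟩ := by
        rw [levelsFrom]
        simp only [Bind.bind, h1]
        rfl
      rw [h3]
      refine ⟨fun z => ?_, List.nodup_singleton _, by simpa using by omega⟩
      rw [List.mem_singleton, List.reverse_inj]
      constructor
      · rintro rfl
        exact ⟨⟨hs, hl⟩, le_rfl⟩
      · rintro ⟨⟨hz, hzl⟩, hzs⟩
        -- No successor means that all entries are below `2`: `s` is the star, which is the
        -- smallest.
        refine le_antisymm hzs (hz.toIsLevels.le_of_forall_lt_two (by omega) h2 ?_)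
        obtain ⟨u, rfl, -⟩ := hs.exists_cons
        rfl
    · have h3 : levelsFrom (fuel + 1) s.reverse =
          ⟨s.reverse :: (levelsFrom fuel s'.reverse).val,
            (nextLevels s.reverse).time + ((levelsFrom fuel s'.reverse).time + 1)⟩ := by
        rw [levelsFrom]
        simp only [Bind.bind, h1]
        rfl
      have h4 : {z | (IsCanonLevels z ∧ z.length = K + 1) ∧ z ≤ s} =
          insert s {z | (IsCanonLevels z ∧ z.length = K + 1) ∧ z ≤ s'} := by
        ext z
        constructor
        · rintro ⟨⟨hz, hzl⟩, hzs⟩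
          rcases hzs.eq_or_lt with rfl | hzs
          · exact Or.inl rfl
          · exact Or.inr ⟨⟨hz, hzl⟩, hle z hz (by omega) hzs⟩
        · rintro (rfl | ⟨hz, hzs⟩)
          · exact ⟨⟨hs, hl⟩, le_rfl⟩
          · exact ⟨hz, hzs.trans hlt.le⟩
      have h5 : s ∉ {z | (IsCanonLevels z ∧ z.length = K + 1) ∧ z ≤ s'} :=
        fun h => absurd h.2 (not_le.2 hlt)
      rw [h4, Set.ncard_insert_of_notMem h5 (hfin s')] at h
      obtain ⟨i1, i2, i3⟩ := ih s' hs' (by omega) (by omega)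
      rw [h3]
      refine ⟨fun z => ?_, List.nodup_cons.2 ⟨fun h => h5 ((i1 s).1 h), i2⟩, ?_⟩
      · have h6 : _ ↔ z = s ∨ _ := Set.ext_iff.1 h4 z
        rw [List.mem_cons, List.reverse_inj, i1]
        exact h6.symm
      · rw [List.length_cons, Nat.add_mul]
        simp only
        omega

theorem val_pathLevels (K : ℕ) : (pathLevels K).val = (List.range (K + 1)).reverse := by
  induction K with
  | zero => rfl
  | succ K ih => simp [pathLevels, ih, List.range_succ]

theorem time_pathLevels (K : ℕ) : (pathLevels K).time = K + 1 := by
  induction K with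
  | zero => rfl
  | succ K ih => simp [pathLevels, ih]

theorem isCanonLevels_range (K : ℕ) : IsCanonLevels (List.range (K + 1)) := by
  refine ⟨⟨⟨(List.range K).map Nat.succ, List.range_succ_eq_map, by simp⟩, ?_⟩, ?_⟩
  · rw [List.isChain_iff_getElem]
    intro i hi
    simp
  · intro x a u y z h
    have h1 := List.nodup_range (n := K + 1)
    rw [h] at h1
    have h2 := (List.nodup_append.1 h1).2.1
    rw [List.nodup_cons] at h2
    exact absurd (by simp) h2.1

/-- The level sequences found by the algorithm. -/
def allLevels (K : ℕ) : Timed (List (List ℕ)) :=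
  levelsFrom ((K + 1) ^ (K + 1)) (pathLevels K).val

theorem allLevels_spec (K : ℕ) :
    (∀ l, l ∈ (allLevels K).val ↔ ∃ t ∈ canonTrees K, (lev 0 t).reverse = l) ∧
    (allLevels K).val.Nodup ∧
    (allLevels K).time ≤ (allLevels K).val.length * (10 * (K + 1) + 9) := by
  have h1 : {z | (IsCanonLevels z ∧ z.length = K + 1) ∧ z ≤ List.range (K + 1)} =
      lev 0 '' canonTrees K := by
    rw [← setOf_isCanonLevels_eq]
    ext z
    refine ⟨fun h => h.1, fun h => ⟨h, ?_⟩⟩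
    have := h.1.toIsLevels.le_range
    rwa [h.2] at this
  rw [allLevels, val_pathLevels]
  obtain ⟨i1, i2, i3⟩ := levelsFrom_spec K ((K + 1) ^ (K + 1)) (List.range (K + 1))
    (isCanonLevels_range K) (by simp) (by
      rw [h1, Set.ncard_image_of_injective _ levels_injective]
      exact (ncard_canonTrees_le K).trans (four_pow_le_succ_pow_succ K))
  refine ⟨fun l => ?_, i2, i3⟩
  rw [← List.reverse_reverse l, i1, ← Set.mem_ofPred_eq (p := fun z =>
    (IsCanonLevels z ∧ z.length = K + 1) ∧ z ≤ List.range (K + 1)), h1, Set.mem_image]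
  simp only [List.reverse_eq_iff, List.reverse_reverse]

theorem length_allLevels (K : ℕ) : (allLevels K).val.length = (canonTrees K).ncard := by
  obtain ⟨h1, h2, -⟩ := allLevels_spec K
  rw [← List.toFinset_card_of_nodup h2, ← Set.ncard_coe_finset]
  have : ((allLevels K).val.toFinset : Set (List ℕ)) =
      (fun t => (lev 0 t).reverse) '' canonTrees K := by
    ext l
    rw [Finset.mem_coe, List.mem_toFinset, h1]
    rfl
  rw [this, Set.ncard_image_of_injective]
  exact List.reverse_injective.comp levels_injective

/-! ### Costs of automorphism counts and decoding, and the list of bulbs. -/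

theorem time_equalTrees_lt : ∀ s t : PlaneTree, (equalTrees s t).time < 2 * s.size
  | .leaf, .leaf => by simp [equalTrees, size]
  | .leaf, .join _ _ => by simp [equalTrees, size]
  | .join s c, .leaf => by
    have := size_pos s
    simp [equalTrees, size]
    omega
  | .join s c, .join t c' => by
    have h1 := time_equalTrees_lt s t
    have h2 := time_equalTrees_lt c c'
    simp [equalTrees, size]
    omega

theorem time_countChildren_le (c : PlaneTree) : ∀ t : PlaneTree,
    (countChildren c t).time ≤ t.size * (2 * c.size + 1)
  | .leaf => by simp [countChildren, size]
  | .join t c' => by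
    have h1 := time_countChildren_le c t
    have h2 := time_equalTrees_lt c c'
    have h3 : 2 * c.size + 1 ≤ c'.size * (2 * c.size + 1) :=
      Nat.le_mul_of_pos_left _ (size_pos c')
    rw [size, Nat.add_mul]
    by_cases h : (equalTrees c c').val = true
    · simp [countChildren, h]
      omega
    · simp [countChildren, h]
      omega

/-- Comparing `c` with the children of `t` costs at most `|t| (2 |c| + 1)`, which the cross term `8
|t| |c|` of `4 (|t| + |c|) ^ 2` pays for. -/
theorem time_autTree_le : ∀ t : PlaneTree, (autTree t).time ≤ 4 * t.size ^ 2
  | .leaf => by simp [autTree, size]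
  | .join t c => by
    have h1 := time_autTree_le t
    have h2 := time_autTree_le c
    have h3 := time_countChildren_le c t
    have h4 := size_pos t
    have h5 := size_pos c
    have h6 : 1 ≤ t.size * c.size := Nat.mul_pos h4 h5
    have h7 : t.size ≤ t.size * c.size := Nat.le_mul_of_pos_right _ h5
    simp only [autTree, time_bind, time_step, size]
    nlinarith

theorem time_absorb_le (d : ℕ) : ∀ (t : PlaneTree) (s : List (ℕ × PlaneTree)),
    (absorb d t s).time + 2 * (absorb d t s).val.2.length ≤ 2 * s.length + 2
  | t, [] => by simp [absorb]
  | t, (e, c) :: s => by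
    by_cases h : e = d + 1
    · have := time_absorb_le d (t.join c) s
      simp [absorb, h]
      omega
    · simp [absorb, h]
      omega

/-- Every tree pushed on the stack is absorbed at most once. With twice the height of the stack as
potential, one entry costs at most `5`: the bounded part `2` of `absorb`, one step, and a rise of
the potential by `2`. -/
theorem time_treeOfLevels_le (l : List ℕ) : (treeOfLevels l).time ≤ 6 * l.length + 2 := by
  have h := time_loop_le_of_potential (body := fun (s : List (ℕ × PlaneTree)) d => do
    let (t, s) ← absorb d PlaneTree.leaf s
    step ((d, t) :: s)) (fun s => 2 * s.length) 5 l [] (by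
      intro s d _
      have := time_absorb_le d .leaf s
      simp
      omega)
  rw [treeOfLevels, time_bind]
  split <;> simp_all <;> omega

theorem selectBulbs_spec (R K : ℕ) : ∀ ls : List (List ℕ),
    (∀ l ∈ ls, ∃ t ∈ canonTrees K, (lev 0 t).reverse = l) → ls.Nodup →
      (∀ p, p ∈ (selectBulbs R ls).val ↔
        p.1.IsCanon ∧ (lev 0 p.1).reverse ∈ ls ∧ p.2 = p.1.toGraph.aut ∧ p.2 ≤ R) ∧
      ((selectBulbs R ls).val.map Prod.fst).Nodup ∧
      (selectBulbs R ls).val.length ≤ ls.length ∧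
      (selectBulbs R ls).time ≤ ls.length * (6 * (K + 1) + 4 * (K + 1) ^ 2 + 4) + 1
  | [], _, _ => by simp [selectBulbs]
  | l :: ls, h, hn => by
    obtain ⟨i1, i2, i3, i4⟩ := selectBulbs_spec R K ls
      (fun l hl => h l (List.mem_cons_of_mem _ hl)) (List.nodup_cons.1 hn).2
    obtain ⟨t, ⟨ht, hs⟩, rfl⟩ := h l List.mem_cons_self
    have h1 := val_treeOfLevels t
    have h2 := val_autTree ht
    have h3 := time_treeOfLevels_le (lev 0 t).reverse
    have h4 := time_autTree_le t
    rw [List.length_reverse, length_lev, hs] at h3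
    rw [hs] at h4
    have hval : (selectBulbs R ((lev 0 t).reverse :: ls)).val =
        if t.toGraph.aut ≤ R then (t, t.toGraph.aut) :: (selectBulbs R ls).val
        else (selectBulbs R ls).val := by
      by_cases h5 : t.toGraph.aut ≤ R <;> simp [selectBulbs, h1, h2, h5]
    have htime : (selectBulbs R ((lev 0 t).reverse :: ls)).time =
        (treeOfLevels (lev 0 t).reverse).time + (autTree t).time +
          (selectBulbs R ls).time + 2 := by
      by_cases h5 : t.toGraph.aut ≤ R <;> simp [selectBulbs, h1, h2, h5] <;> ring
    have hmem : ∀ p : PlaneTree × ℕ, p.1.IsCanon → ((lev 0 p.1).reverse = (lev 0 t).reverse ↔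
        p.1 = t) := fun p _ =>
      ⟨fun h => levels_injective (List.reverse_injective h), fun h => by rw [h]⟩
    refine ⟨fun p => ?_, ?_, ?_, ?_⟩
    · have h6 : p ∈ (selectBulbs R ((lev 0 t).reverse :: ls)).val ↔
          (t.toGraph.aut ≤ R ∧ p = (t, t.toGraph.aut)) ∨ p ∈ (selectBulbs R ls).val := by
        rw [hval]
        split_ifs with h5 <;> simp [h5]
      rw [h6, i1, List.mem_cons]
      constructor
      · rintro (⟨h5, rfl⟩ | ⟨j1, j2, j3⟩)
        · exact ⟨ht, Or.inl rfl, rfl, h5⟩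
        · exact ⟨j1, Or.inr j2, j3⟩
      · rintro ⟨j1, j2 | j2, j3, j4⟩
        · rw [hmem p j1] at j2
          obtain ⟨p1, p2⟩ := p
          simp only at j2 j3 j4
          subst j2 j3
          exact Or.inl ⟨j4, rfl⟩
        · exact Or.inr ⟨j1, j2, j3, j4⟩
    · rw [hval]
      split_ifs with h5
      · rw [List.map_cons, List.nodup_cons]
        refine ⟨fun h6 => ?_, i2⟩
        obtain ⟨p, hp, hpt⟩ := List.mem_map.1 h6
        have h7 := ((i1 p).1 hp).2.1
        rw [hpt] at h7
        exact (List.nodup_cons.1 hn).1 h7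
      · exact i2
    · rw [hval]
      split_ifs <;> simp <;> omega
    · rw [htime, List.length_cons, Nat.add_mul]
      omega

theorem listBulbs_spec (K R : ℕ) :
    (∀ p, p ∈ (listBulbs K R).val ↔
      p.1 ∈ canonTrees K ∧ p.2 = p.1.toGraph.aut ∧ p.2 ≤ R) ∧
    ((listBulbs K R).val.map Prod.fst).Nodup ∧
    (listBulbs K R).val.length ≤ (canonTrees K).ncard ∧
    (listBulbs K R).time ≤ (canonTrees K).ncard * (4 * (K + 1) ^ 2 + 16 * (K + 1) + 13) +
      (K + 1) + 1 := by
  obtain ⟨h1, h2, h3⟩ := allLevels_spec K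
  obtain ⟨i1, i2, i3, i4⟩ := selectBulbs_spec R K (allLevels K).val (fun l hl => (h1 l).1 hl) h2
  have hv : (listBulbs K R).val = (selectBulbs R (allLevels K).val).val := rfl
  have ht : (listBulbs K R).time = (pathLevels K).time + ((allLevels K).time +
    (selectBulbs R (allLevels K).val).time) := rfl
  rw [hv, ht, time_pathLevels]
  rw [length_allLevels] at h3 i3 i4
  refine ⟨fun p => ?_, i2, i3, by linarith⟩
  rw [i1, h1]
  constructor
  · rintro ⟨j1, ⟨t, j2, j3⟩, j4⟩
    rw [levels_injective (List.reverse_injective j3)] at j2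
    exact ⟨j2, j4⟩
  · rintro ⟨j1, j2⟩
    exact ⟨j1.1, ⟨p.1, j1, rfl⟩, j2⟩

/-! # Combinations -/

theorem mem_combinations {α : Type} : ∀ {k : ℕ} {l c : List α},
    c ∈ (combinations k l).val ↔ c.Sublist l ∧ c.length = k
  | 0, l, c => by
    simp only [combinations, val_step, List.mem_singleton, List.length_eq_zero_iff]
    exact ⟨fun h => ⟨h ▸ List.nil_sublist l, h⟩, fun h => h.2⟩
  | k + 1, [], c => by
    simp only [combinations, val_step, List.not_mem_nil, List.sublist_nil, false_iff, not_and]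
    rintro rfl
    simp
  | k + 1, a :: l, c => by
    simp only [combinations, val_bind, val_mapList, val_step, Timed.val_append, List.mem_append,
      List.mem_map, mem_combinations, List.sublist_cons_iff]
    constructor
    · rintro (⟨c, ⟨h1, rfl⟩, rfl⟩ | ⟨h1, h2⟩)
      · exact ⟨Or.inr ⟨c, rfl, h1⟩, rfl⟩
      · exact ⟨Or.inl h1, h2⟩
    · rintro ⟨h1 | ⟨r, rfl, h1⟩, h2⟩
      · exact Or.inr ⟨h1, h2⟩
      · exact Or.inl ⟨r, ⟨h1, by simpa using h2⟩, rfl⟩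

theorem nodup_combinations {α : Type} : ∀ (k : ℕ) {l : List α}, l.Nodup →
    (combinations k l).val.Nodup
  | 0, _, _ => by simp [combinations]
  | k + 1, [], _ => by simp [combinations]
  | k + 1, a :: l, h => by
    rw [List.nodup_cons] at h
    simp only [combinations, val_bind, val_mapList, val_step, Timed.val_append]
    rw [List.nodup_append]
    refine ⟨(nodup_combinations k h.2).map fun c c' h => (List.cons.inj h).2,
      nodup_combinations (k + 1) h.2, ?_⟩
    rintro c hc c' hc' rfl
    obtain ⟨r, -, rfl⟩ := List.mem_map.1 hc
    exact h.1 ((mem_combinations.1 hc').1.subset List.mem_cons_self)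

theorem length_combinations {α : Type} : ∀ (k : ℕ) (l : List α),
    (combinations k l).val.length = l.length.choose k
  | 0, l => by simp [combinations]
  | k + 1, [] => by simp [combinations]
  | k + 1, a :: l => by
    simp [combinations, length_combinations, Nat.choose_succ_succ]

/-- One more element in the combinations costs three steps per list in `mapList` and two in
`append`, hence the `5`. The `2` on the left absorbs the additive constants of these two calls. -/
theorem time_combinations_le {α : Type} : ∀ (k : ℕ) (l : List α),
    (combinations k l).time + 2 ≤ (5 * k + 3) * (l.length + 1) ^ k
  | 0, l => by simp [combinations]
  | k + 1, [] => by simp [combinations]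
  | k + 1, a :: l => by
    have h1 := time_combinations_le k l
    have h2 := time_combinations_le (k + 1) l
    have h3 := time_mapList_le (f := fun c : List α => step (a :: c)) 1
      (combinations k l).val (by simp)
    have h4 := time_append ((mapList (fun c => step (a :: c)) (combinations k l).val).val)
      (combinations (k + 1) l).val
    rw [val_mapList, List.length_map] at h4
    have h5 : (combinations k l).val.length ≤ (l.length + 1) ^ k := by
      rw [length_combinations]
      exact (Nat.choose_le_pow l.length k).trans (Nat.pow_le_pow_left (Nat.le_succ _) k)
    have h6 : (l.length + 1) ^ k * (l.length + 1 + 1) ≤ (l.length + 1 + 1) ^ (k + 1) := by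
      rw [pow_succ]
      exact Nat.mul_le_mul_right _ (Nat.pow_le_pow_left (Nat.le_succ _) k)
    simp only [combinations, time_bind, List.length_cons, val_mapList] at *
    rw [h4]
    rw [pow_succ] at h2
    calc _ ≤ (5 * k + 8) * ((l.length + 1) ^ k * (l.length + 1 + 1)) := by nlinarith
      _ ≤ _ := Nat.mul_le_mul_left _ h6

/-! # Chandeliers as plane trees -/

/-- A path with `m` edges on top of a tree. -/
def hangTree : ℕ → PlaneTree → PlaneTree
  | 0, t => t
  | m + 1, t => .join .leaf (hangTree m t)

theorem val_hang (m : ℕ) (t : PlaneTree) : (hang m t).val = hangTree m t := by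
  induction m with
  | zero => rfl
  | succ m ih => simp [hang, hangTree, ih]

theorem time_hang (m : ℕ) (t : PlaneTree) : (hang m t).time = m + 1 := by
  induction m with
  | zero => rfl
  | succ m ih => simp [hang, ih]

/-- The chandelier with the given bulbs. -/
def chandelierTree (M : ℕ) (ts : List PlaneTree) : PlaneTree :=
  ts.foldl (fun t b => .join t (hangTree (M - 1) b)) .leaf

theorem chandelierTree_concat (M : ℕ) (ts : List PlaneTree) (b : PlaneTree) :
    chandelierTree M (ts ++ [b]) = .join (chandelierTree M ts) (hangTree (M - 1) b) := by
  simp [chandelierTree]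

theorem val_buildChandelier (M : ℕ) (bulbs : List (PlaneTree × ℕ)) :
    (buildChandelier M bulbs).val =
      (chandelierTree M (bulbs.map Prod.fst), (bulbs.map Prod.snd).prod) := by
  have key : ∀ (s : PlaneTree × ℕ), (loop (fun (s : PlaneTree × ℕ) b => do
      let m ← step (M - 1)
      let branch ← hang m b.1
      let t ← step (PlaneTree.join s.1 branch)
      let a ← step (s.2 * b.2)
      step (t, a)) bulbs s).val =
      ((bulbs.map Prod.fst).foldl (fun t b => .join t (hangTree (M - 1) b)) s.1,
        s.2 * (bulbs.map Prod.snd).prod) := by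
    induction bulbs with
    | nil => simp [loop]
    | cons b bulbs ih =>
      intro s
      simp only [loop, val_bind, val_step, ih, val_hang, List.map_cons, List.foldl_cons,
        List.prod_cons, mul_assoc]
  rw [buildChandelier, key, one_mul]
  rfl

theorem time_buildChandelier_le (M : ℕ) (hM : 0 < M) (bulbs : List (PlaneTree × ℕ)) :
    (buildChandelier M bulbs).time ≤ bulbs.length * (M + 5) + 1 := by
  refine time_loop_le (M + 4) bulbs _ fun s b _ => ?_
  simp [time_hang]
  omega

theorem size_hangTree (m : ℕ) (t : PlaneTree) : (hangTree m t).size = m + t.size := by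
  induction m with
  | zero => simp [hangTree]
  | succ m ih =>
    rw [hangTree, size, size, ih]
    ring

theorem size_chandelierTree {M K : ℕ} (hM : 0 < M) (ts : List PlaneTree)
    (h : ∀ t ∈ ts, t.size = K + 1) :
    (chandelierTree M ts).size = (K + M) * ts.length + 1 := by
  induction ts using List.reverseRecOn with
  | nil => rfl
  | append_singleton ts b ih =>
    rw [chandelierTree_concat, size, ih fun t ht => h t (List.mem_append_left _ ht),
      size_hangTree, h b (by simp), List.length_append, List.length_singleton]
    have : M - 1 + (K + 1) = K + M := by omega
    rw [this]
    ring

/-- A vertex of the added path has a single child, so `card_iso_join` has a single term and the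
isomorphisms descend to the ends of the paths. -/
theorem card_iso_hangTree (m : ℕ) (s t : PlaneTree) :
    Nat.card ((hangTree m s).toGraph.Iso (hangTree m t).toGraph) =
      Nat.card (s.toGraph.Iso t.toGraph) := by
  induction m with
  | zero => rfl
  | succ m ih =>
    have h1 : ∀ f : Child (.join .leaf (hangTree m t)) → ℕ, ∑ i, f i = f none := fun f => by
      have : IsEmpty (Child .leaf) := inferInstanceAs (IsEmpty Empty)
      refine (Fintype.sum_option (α := Child .leaf) f).trans ?_
      simp
    have h2 : Nat.card (PlaneTree.leaf.toGraph.Iso PlaneTree.leaf.toGraph) = 1 := by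
      rw [Nat.card_eq_one_iff_unique]
      exact ⟨⟨fun e f => Iso.ext fun x => rfl⟩, ⟨Iso.refl _⟩⟩
    rw [hangTree, hangTree, card_iso_join, h1]
    change Nat.card (PlaneTree.leaf.toGraph.Iso PlaneTree.leaf.toGraph) *
      Nat.card ((hangTree m s).toGraph.Iso (hangTree m t).toGraph) = _
    rw [h2, one_mul, ih]

theorem isIso_iff_card_pos (s t : PlaneTree) :
    s.toGraph.IsIso t.toGraph ↔ 0 < Nat.card (s.toGraph.Iso t.toGraph) := by
  rw [Nat.card_pos_iff]
  exact ⟨fun h => ⟨h, inferInstance⟩, fun h => h.1⟩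

theorem isIso_hangTree_iff {m : ℕ} {s t : PlaneTree} :
    (hangTree m s).toGraph.IsIso (hangTree m t).toGraph ↔ s.toGraph.IsIso t.toGraph := by
  rw [isIso_iff_card_pos, isIso_iff_card_pos, card_iso_hangTree]

theorem sub_chandelierTree (M : ℕ) (ts : List PlaneTree) (i : Child (chandelierTree M ts)) :
    ∃ b ∈ ts, sub (chandelierTree M ts) i = hangTree (M - 1) b := by
  induction ts using List.reverseRecOn with
  | nil => exact i.elim
  | append_singleton ts b ih =>
    revert i
    rw [chandelierTree_concat]
    rintro (_ | i)
    · exact ⟨b, by simp, rfl⟩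
    · obtain ⟨b', hb, hi⟩ := ih i
      exact ⟨b', List.mem_append_left _ hb, hi⟩

theorem exists_sub_chandelierTree (M : ℕ) (ts : List PlaneTree) {b : PlaneTree} (h : b ∈ ts) :
    ∃ i, sub (chandelierTree M ts) i = hangTree (M - 1) b := by
  induction ts using List.reverseRecOn with
  | nil => simp at h
  | append_singleton ts b' ih =>
    rw [chandelierTree_concat]
    rcases List.mem_append.1 h with h | h
    · obtain ⟨i, hi⟩ := ih h
      exact ⟨some i, hi⟩
    · rw [List.mem_singleton.1 h]
      exact ⟨none, rfl⟩

theorem exists_isIso_sub {s t : PlaneTree} (h : s.toGraph.IsIso t.toGraph) (i : Child s) :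
    ∃ j, (sub s i).toGraph.IsIso (sub t j).toGraph := by
  obtain ⟨j, -, hj⟩ := (isIso_join_iff _ _ _).1 ((isIso_join_rest_sub s i).symm.trans h)
  exact ⟨j, hj⟩

/-- An isomorphism carries branches to branches, and all wires have the same length, so the bulbs at
their ends correspond. -/
theorem exists_isIso_of_isIso_chandelierTree {M : ℕ} {ts ts' : List PlaneTree}
    (h : (chandelierTree M ts).toGraph.IsIso (chandelierTree M ts').toGraph) {b : PlaneTree}
    (hb : b ∈ ts) : ∃ b' ∈ ts', b.toGraph.IsIso b'.toGraph := by
  obtain ⟨i, hi⟩ := exists_sub_chandelierTree M ts hb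
  obtain ⟨j, hj⟩ := exists_isIso_sub h i
  obtain ⟨b', hb', hj'⟩ := sub_chandelierTree M ts' j
  rw [hi, hj', isIso_hangTree_iff] at hj
  exact ⟨b', hb', hj⟩

/-- No other child can receive `c`, so only one term of `card_iso_join` survives. -/
theorem aut_join_of_forall_not_isIso {t c : PlaneTree}
    (h : ∀ i : Child t, ¬ c.toGraph.IsIso (sub t i).toGraph) :
    (PlaneTree.join t c).toGraph.aut = t.toGraph.aut * c.toGraph.aut := by
  have h1 : ∀ f : Child (.join t c) → ℕ, ∑ i, f i = f none + ∑ i : Child t, f (some i) :=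
    fun f => Fintype.sum_option (α := Child t) f
  rw [aut, card_iso_join, h1, Finset.sum_eq_zero, Nat.add_zero]
  · rfl
  · intro i _
    have h2 : Nat.card (c.toGraph.Iso (sub (.join t c) (some i)).toGraph) = 0 :=
      card_iso_eq_zero (h i)
    rw [h2, mul_zero]

theorem aut_chandelierTree (M : ℕ) (ts : List PlaneTree)
    (h : ts.Pairwise fun s t => ¬ s.toGraph.IsIso t.toGraph) :
    (chandelierTree M ts).toGraph.aut = (ts.map fun t => t.toGraph.aut).prod := by
  induction ts using List.reverseRecOn with
  | nil => exact (val_autTree (t := .leaf) trivial).symm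
  | append_singleton ts b ih =>
    rw [List.pairwise_append] at h
    rw [chandelierTree_concat, aut_join_of_forall_not_isIso, ih h.1, List.map_append,
      List.prod_append]
    · have : (hangTree (M - 1) b).toGraph.aut = b.toGraph.aut := card_iso_hangTree _ _ _
      rw [this]
      simp
    · intro i hi
      obtain ⟨b', hb', hj⟩ := sub_chandelierTree M ts i
      rw [hj, isIso_hangTree_iff] at hi
      exact h.2.2 b' hb' b (by simp) hi.symm

/-- The transpositions are instances of `joinComm`. In `key` the starting trees vary, so that the
induction on the permutation passes along the fold. -/
theorem isIso_chandelierTree_of_perm {M : ℕ} {ts ts' : List PlaneTree} (h : ts.Perm ts') :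
    (chandelierTree M ts).toGraph.IsIso (chandelierTree M ts').toGraph := by
  have key : ∀ s s' : PlaneTree, s.toGraph.IsIso s'.toGraph →
      (ts.foldl (fun t b => PlaneTree.join t (hangTree (M - 1) b)) s).toGraph.IsIso
        (ts'.foldl (fun t b => PlaneTree.join t (hangTree (M - 1) b)) s').toGraph := by
    induction h with
    | nil => exact fun _ _ h => h
    | cons b _ ih => exact fun s s' h => ih _ _ (h.join (IsIso.refl _))
    | swap b b' l =>
      intro s s' h
      have h1 : ∀ (l : List PlaneTree) (s s' : PlaneTree), s.toGraph.IsIso s'.toGraph →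
          (l.foldl (fun t b => PlaneTree.join t (hangTree (M - 1) b)) s).toGraph.IsIso
            (l.foldl (fun t b => PlaneTree.join t (hangTree (M - 1) b)) s').toGraph := by
        intro l
        induction l with
        | nil => exact fun _ _ h => h
        | cons b _ ih => exact fun s s' h => ih _ _ (h.join (IsIso.refl _))
      refine h1 l _ _ ?_
      have h2 : (PlaneTree.join (.join s (hangTree (M - 1) b')) (hangTree (M - 1) b)).toGraph.IsIso
          (PlaneTree.join (.join s (hangTree (M - 1) b)) (hangTree (M - 1) b')).toGraph :=
        ⟨joinComm _ _ _⟩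
      exact h2.trans ((h.join (IsIso.refl _)).join (IsIso.refl _))
    | trans _ _ ih1 ih2 => exact fun s s' h => (ih1 s s' h).trans (ih2 s' s' (IsIso.refl _))
  exact key _ _ (IsIso.refl _)

/-! # Chandeliers as graphs -/

section Wire

variable {L M K : ℕ} {B : Fin L → RootedGraph (Fin (K + 1))}

theorem wireVertex_eq_root_iff {l : Fin L} {m : ℕ} :
    (.root : ChandelierVertex L M K) = wireVertex B l m ↔ m = 0 := by
  unfold wireVertex
  split_ifs <;> simp_all

theorem wireVertex_eq_wire_iff {l l' : Fin L} {m : ℕ} {i : Fin (M - 1)} :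
    (.wire l' i : ChandelierVertex L M K) = wireVertex B l m ↔ l' = l ∧ m = i + 1 := by
  unfold wireVertex
  split_ifs with h1 h2
  · simp
    omega
  · simp only [ChandelierVertex.wire.injEq, Fin.ext_iff]
    omega
  · simp
    omega

theorem wireVertex_eq_bulb_iff {l l' : Fin L} {m : ℕ} {v : Fin (K + 1)} :
    (.bulb l' v : ChandelierVertex L M K) = wireVertex B l m ↔
      l' = l ∧ m ≠ 0 ∧ M ≤ m ∧ v = (B l).root := by
  unfold wireVertex
  split_ifs with h1 h2
  · simp [h1]
  · simp
    omega
  · simp only [ChandelierVertex.bulb.injEq]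
    constructor
    · rintro ⟨rfl, rfl⟩
      exact ⟨rfl, h1, by omega, rfl⟩
    · rintro ⟨rfl, -, -, rfl⟩
      exact ⟨rfl, rfl⟩

theorem not_chandelierGraph_adj_root_root :
    ¬ (chandelierGraph M B).graph.Adj .root .root := SimpleGraph.irrefl _

theorem chandelierGraph_adj_root_wire (hM : 0 < M) {l : Fin L} {i : Fin (M - 1)} :
    (chandelierGraph M B).graph.Adj .root (.wire l i) ↔ (i : ℕ) = 0 := by
  simp only [chandelierGraph, SimpleGraph.fromRel_adj, wireVertex_eq_root_iff,
    wireVertex_eq_wire_iff]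
  constructor
  · rintro ⟨-, (⟨l, m, h1, rfl, rfl, h2⟩ | ⟨_, _, _, h, _⟩) | (⟨l, m, h1, ⟨rfl, h2⟩, h3⟩ |
      ⟨_, _, _, h, _⟩)⟩
    · omega
    · simp at h
    · omega
    · simp at h
  · intro h
    exact ⟨by simp, Or.inl (Or.inl ⟨l, 0, hM, rfl, rfl, by omega⟩)⟩

theorem chandelierGraph_adj_root_bulb (hM : 0 < M) {l : Fin L} {v : Fin (K + 1)} :
    (chandelierGraph M B).graph.Adj .root (.bulb l v) ↔ M = 1 ∧ v = (B l).root := by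
  simp only [chandelierGraph, SimpleGraph.fromRel_adj, wireVertex_eq_root_iff,
    wireVertex_eq_bulb_iff]
  constructor
  · rintro ⟨-, (⟨l, m, h1, rfl, rfl, h2, h3, h4⟩ | ⟨_, _, _, h, _⟩) |
      (⟨l, m, h1, ⟨rfl, h2⟩, h3⟩ | ⟨_, _, _, _, h, _⟩)⟩
    · exact ⟨by omega, h4⟩
    · simp at h
    · omega
    · simp at h
  · rintro ⟨h, h'⟩
    exact ⟨by simp, Or.inl (Or.inl ⟨l, 0, hM, rfl, rfl, by omega, by omega, h'⟩)⟩

theorem chandelierGraph_adj_wire_wire {l l' : Fin L} {i j : Fin (M - 1)} :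
    (chandelierGraph M B).graph.Adj (.wire l i) (.wire l' j) ↔
      l = l' ∧ ((i : ℕ) + 1 = j ∨ (j : ℕ) + 1 = i) := by
  simp only [chandelierGraph, SimpleGraph.fromRel_adj, wireVertex_eq_wire_iff]
  constructor
  · rintro ⟨-, (⟨l, m, h1, ⟨rfl, rfl⟩, rfl, h2⟩ | ⟨_, _, _, h, _⟩) |
      (⟨l, m, h1, ⟨rfl, rfl⟩, rfl, h2⟩ | ⟨_, _, _, h, _⟩)⟩
    · exact ⟨rfl, by omega⟩
    · simp at h
    · exact ⟨rfl, by omega⟩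
    · simp at h
  · have hi := i.2
    have hj := j.2
    rintro ⟨rfl, h | h⟩
    · refine ⟨by simp [Fin.ext_iff]; omega, Or.inl (Or.inl ⟨l, i + 1, by omega, ⟨rfl, rfl⟩, rfl,
        by omega⟩)⟩
    · refine ⟨by simp [Fin.ext_iff]; omega, Or.inr (Or.inl ⟨l, j + 1, by omega, ⟨rfl, rfl⟩, rfl,
        by omega⟩)⟩

theorem chandelierGraph_adj_wire_bulb {l l' : Fin L} {i : Fin (M - 1)} {v : Fin (K + 1)} :
    (chandelierGraph M B).graph.Adj (.wire l i) (.bulb l' v) ↔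
      l = l' ∧ (i : ℕ) + 1 = M - 1 ∧ v = (B l').root := by
  have hi := i.2
  simp only [chandelierGraph, SimpleGraph.fromRel_adj, wireVertex_eq_wire_iff,
    wireVertex_eq_bulb_iff]
  constructor
  · rintro ⟨-, (⟨l, m, h1, ⟨rfl, rfl⟩, rfl, h2, h3, h4⟩ | ⟨_, _, _, h, _⟩) |
      (⟨l, m, h1, ⟨rfl, h2, h3, h4⟩, h5, h6⟩ | ⟨_, _, _, _, h, _⟩)⟩
    · exact ⟨rfl, by omega, h4⟩
    · simp at h
    · omega
    · simp at h
  · rintro ⟨rfl, h, h'⟩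
    exact ⟨by simp, Or.inl (Or.inl ⟨l, i + 1, by omega, ⟨rfl, rfl⟩, rfl, by omega, by omega, h'⟩)⟩

theorem chandelierGraph_adj_bulb_bulb {l l' : Fin L} {u v : Fin (K + 1)} :
    (chandelierGraph M B).graph.Adj (.bulb l u) (.bulb l' v) ↔
      l = l' ∧ (B l).graph.Adj u v := by
  simp only [chandelierGraph, SimpleGraph.fromRel_adj, wireVertex_eq_bulb_iff]
  constructor
  · rintro ⟨-, (⟨l, m, h1, ⟨rfl, h2, h3, rfl⟩, -⟩ | ⟨_, _, _, h, h', h''⟩) |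
      (⟨l, m, h1, ⟨rfl, h2, h3, rfl⟩, -⟩ | ⟨_, _, _, h, h', h''⟩)⟩
    · omega
    · simp only [ChandelierVertex.bulb.injEq] at h h'
      obtain ⟨rfl, rfl⟩ := h
      obtain ⟨rfl, rfl⟩ := h'
      exact ⟨rfl, h''⟩
    · omega
    · simp only [ChandelierVertex.bulb.injEq] at h h'
      obtain ⟨rfl, rfl⟩ := h
      obtain ⟨rfl, rfl⟩ := h'
      exact ⟨rfl, h''.symm⟩
  · rintro ⟨rfl, h⟩
    exact ⟨by simp [h.ne], Or.inl (Or.inr ⟨l, u, v, rfl, rfl, h⟩)⟩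

end Wire

section Branch

variable {V : Type*}

/-- A path with `m` edges on top of a rooted graph. -/
def branchGraph (m : ℕ) (G : RootedGraph V) : RootedGraph (Fin m ⊕ V) where
  graph :=
    { Adj := fun x y => match x, y with
        | .inl i, .inl j => (i : ℕ) + 1 = j ∨ (j : ℕ) + 1 = i
        | .inl i, .inr v => (i : ℕ) + 1 = m ∧ v = G.root
        | .inr v, .inl i => (i : ℕ) + 1 = m ∧ v = G.root
        | .inr u, .inr v => G.graph.Adj u v
      symm := ⟨by
        rintro (i | u) (j | v) h
        · exact h.symm
        · exact h
        · exact h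
        · exact SimpleGraph.Adj.symm h⟩
      loopless := ⟨by
        rintro (i | u) h
        · simp at h
        · exact G.graph.loopless.irrefl _ h⟩ }
  root := if h : 0 < m then .inl ⟨0, h⟩ else .inr G.root

variable {m : ℕ} {G : RootedGraph V}

@[simp] theorem branchGraph_adj_inl_inl {i j : Fin m} :
    (branchGraph m G).graph.Adj (.inl i) (.inl j) ↔ (i : ℕ) + 1 = j ∨ (j : ℕ) + 1 = i := Iff.rfl
@[simp] theorem branchGraph_adj_inl_inr {i : Fin m} {v : V} :
    (branchGraph m G).graph.Adj (.inl i) (.inr v) ↔ (i : ℕ) + 1 = m ∧ v = G.root := Iff.rfl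
@[simp] theorem branchGraph_adj_inr_inl {i : Fin m} {v : V} :
    (branchGraph m G).graph.Adj (.inr v) (.inl i) ↔ (i : ℕ) + 1 = m ∧ v = G.root := Iff.rfl
@[simp] theorem branchGraph_adj_inr_inr {u v : V} :
    (branchGraph m G).graph.Adj (.inr u) (.inr v) ↔ G.graph.Adj u v := Iff.rfl

theorem inl_eq_root_branchGraph_iff {i : Fin m} :
    (.inl i : Fin m ⊕ V) = (branchGraph m G).root ↔ (i : ℕ) = 0 := by
  have := i.2
  rw [branchGraph]
  simp only [show 0 < m by omega, dite_true, Sum.inl.injEq, Fin.ext_iff]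

theorem inr_eq_root_branchGraph_iff {v : V} :
    (.inr v : Fin m ⊕ V) = (branchGraph m G).root ↔ m = 0 ∧ v = G.root := by
  rw [branchGraph]
  by_cases h : 0 < m
  · simp [h]
    omega
  · simp [h]
    omega

theorem branchGraph_zero_isIso (G : RootedGraph V) : (branchGraph 0 G).IsIso G :=
  ⟨⟨{ toFun := fun x => match x with
        | .inr v => v
      invFun := .inr
      left_inv := by rintro (i | v); · exact i.elim0
                     · rfl
      right_inv := fun _ => rfl
      map_rel_iff' := by
        rintro (i | u) (j | v)
        · exact i.elim0
        · exact i.elim0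
        · exact j.elim0
        · exact Iff.rfl }, rfl⟩⟩

theorem branchGraph_succ_isIso (m : ℕ) (G : RootedGraph V) :
    (joinGraph pointGraph (branchGraph m G)).IsIso (branchGraph (m + 1) G) :=
  ⟨⟨{ toFun := fun x => match x with
        | .inl _ => .inl 0
        | .inr (.inl i) => .inl i.succ
        | .inr (.inr v) => .inr v
      invFun := fun x => match x with
        | .inl i => Fin.cases (.inl ()) (fun i => .inr (.inl i)) i
        | .inr v => .inr (.inr v)
      left_inv := by rintro (_ | _ | _) <;> rfl
      right_inv := by
        rintro (i | v)
        · refine Fin.cases ?_ (fun i => ?_) i <;> rfl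
        · rfl
      map_rel_iff' := by
        have h0 : (pointGraph).root = () := rfl

        rintro (_ | i | u) (_ | j | v)
        · simp
        · simp [inl_eq_root_branchGraph_iff, h0]
        · simp [inr_eq_root_branchGraph_iff, h0]
        · simp [inl_eq_root_branchGraph_iff, h0]
        · simp
        · simp
        · simp [inr_eq_root_branchGraph_iff, h0]
        · simp
        · simp }, rfl⟩⟩

theorem branchGraph_isIso_toGraph {t : PlaneTree} (h : G.IsIso t.toGraph) (m : ℕ) :
    (branchGraph m G).IsIso (hangTree m t).toGraph := by
  induction m with
  | zero => exact (branchGraph_zero_isIso G).trans h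
  | succ m ih => exact (branchGraph_succ_isIso m G).symm.trans ((IsIso.refl _).join ih)

end Branch

/-! ### Chandeliers built up branch by branch. -/

section Chandelier

variable {L M K : ℕ}

/-- The vertices of a chandelier with one more branch. -/
def addBranchVertex : ChandelierVertex L M K ⊕ (Fin (M - 1) ⊕ Fin (K + 1)) →
    ChandelierVertex (L + 1) M K
  | .inl .root => .root
  | .inl (.wire l i) => .wire l.castSucc i
  | .inl (.bulb l v) => .bulb l.castSucc v
  | .inr (.inl i) => .wire (Fin.last L) i
  | .inr (.inr v) => .bulb (Fin.last L) v

theorem addBranchVertex_bijective :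
    Function.Bijective (addBranchVertex (L := L) (M := M) (K := K)) := by
  constructor
  · rintro ((_ | ⟨l, i⟩ | ⟨l, v⟩) | (i | v)) ((_ | ⟨l', i'⟩ | ⟨l', v'⟩) | (i' | v')) h <;>
      simp_all [addBranchVertex, Fin.castSucc_ne_last, (Fin.castSucc_ne_last _).symm]
  · rintro (_ | ⟨l, i⟩ | ⟨l, v⟩)
    · exact ⟨.inl .root, rfl⟩
    · refine Fin.lastCases ?_ (fun l => ?_) l
      · exact ⟨.inr (.inl i), rfl⟩
      · exact ⟨.inl (.wire l i), rfl⟩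
    · refine Fin.lastCases ?_ (fun l => ?_) l
      · exact ⟨.inr (.inr v), rfl⟩
      · exact ⟨.inl (.bulb l v), rfl⟩

/-- The first edge of the last wire is the new edge of the join, so the attached branch keeps only
`M - 1` edges of the wire. For `M = 1` it is the bulb alone. -/
theorem chandelierGraph_succ_isIso (hM : 0 < M) (B : Fin (L + 1) → RootedGraph (Fin (K + 1))) :
    (joinGraph (chandelierGraph M fun l => B l.castSucc)
      (branchGraph (M - 1) (B (Fin.last L)))).IsIso (chandelierGraph M B) := by
  have h0 : ∀ {L : ℕ} (B : Fin L → RootedGraph (Fin (K + 1))),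
      (chandelierGraph M B).root = .root := fun _ => rfl
  have hr : ∀ {L : ℕ} (B : Fin L → RootedGraph (Fin (K + 1))) (x y), 
      (chandelierGraph M B).graph.Adj x y ↔ (chandelierGraph M B).graph.Adj y x :=
    fun B x y => SimpleGraph.adj_comm _ _ _
  have hne : ∀ l : Fin L, ¬ Fin.last L = l.castSucc := fun l => (Fin.castSucc_ne_last l).symm
  refine ⟨⟨{ toEquiv := Equiv.ofBijective _ addBranchVertex_bijective, map_rel_iff' := ?_ }, rfl⟩⟩
  have key : ∀ x y, (chandelierGraph M B).graph.Adj (addBranchVertex x) (addBranchVertex y) ↔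
      (joinGraph (chandelierGraph M fun l => B l.castSucc)
        (branchGraph (M - 1) (B (Fin.last L)))).graph.Adj x y := by
    have hM1 : M = 1 ↔ M - 1 = 0 := by omega
    rintro ((_ | ⟨l, i⟩ | ⟨l, v⟩) | (i | v)) ((_ | ⟨l', i'⟩ | ⟨l', v'⟩) | (i' | v')) <;>
    simp only [addBranchVertex, joinGraph_adj_inl_inl, joinGraph_adj_inl_inr,
      joinGraph_adj_inr_inl, joinGraph_adj_inr_inr, branchGraph_adj_inl_inl,
      branchGraph_adj_inl_inr, branchGraph_adj_inr_inl, branchGraph_adj_inr_inr,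
      not_chandelierGraph_adj_root_root, chandelierGraph_adj_root_wire hM,
      chandelierGraph_adj_root_bulb hM, chandelierGraph_adj_wire_wire,
      chandelierGraph_adj_wire_bulb, chandelierGraph_adj_bulb_bulb,
      inl_eq_root_branchGraph_iff, inr_eq_root_branchGraph_iff, h0, hM1,
      Fin.castSucc_inj, Fin.castSucc_ne_last, hne, reduceCtorEq, true_and, false_and,
      hr _ (.wire _ _) .root, hr _ (.bulb _ _) .root, hr _ (.bulb _ _) (.wire _ _)]
  exact fun {x y} => key x y

theorem chandelierGraph_isIso (hM : 0 < M) : ∀ {L : ℕ} (B : Fin L → RootedGraph (Fin (K + 1)))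
    (t : Fin L → PlaneTree), (∀ l, (B l).IsIso (t l).toGraph) →
      (chandelierGraph M B).IsIso (chandelierTree M (List.ofFn t)).toGraph := by
  intro L
  induction L with
  | zero =>
    intro B t _
    refine ⟨⟨⟨⟨fun _ => (), fun _ => .root, ?_, fun _ => rfl⟩, ?_⟩, rfl⟩⟩
    · rintro (_ | ⟨l, i⟩ | ⟨l, v⟩)
      · rfl
      · exact l.elim0
      · exact l.elim0
    · intro x y
      rcases x with _ | ⟨l, i⟩ | ⟨l, v⟩ <;> rcases y with _ | ⟨l', i'⟩ | ⟨l', v'⟩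
      · exact iff_of_false (fun h => h) (SimpleGraph.irrefl _)
      all_goals first | exact l.elim0 | exact l'.elim0
  | succ L ih =>
    intro B t h
    rw [List.ofFn_succ', List.concat_eq_append, chandelierTree_concat]
    exact (chandelierGraph_succ_isIso hM B).symm.trans
      ((ih (fun l => B l.castSucc) (fun l => t l.castSucc) fun l => h _).join
        (branchGraph_isIso_toGraph (h _) _))

end Chandelier

/-- The isomorphism class of a plane tree with `m + 1` vertices. -/
noncomputable def PlaneTree.toUnlabeled (m : ℕ) (t : PlaneTree) : Unlabeled (m + 1) :=
  if h : t.size = m + 1 then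
    ⟦t.toGraph.transport (Fintype.equivFinOfCardEq ((card_vert t).trans h))⟧
  else ⟦⟨⊥, 0⟩⟧

theorem isIso_out_of_eq {m : ℕ} {V : Type*} {G : RootedGraph V} {H : RootedGraph (Fin m)}
    (h : G.IsIso H) : G.IsIso (Quotient.out (⟦H⟧ : Unlabeled m)) :=
  h.trans (IsIso.symm (Quotient.mk_out (s := RootedGraph.instSetoid (Fin m)) H))

theorem isIso_toUnlabeled_out {m : ℕ} {t : PlaneTree} (h : t.size = m + 1) :
    t.toGraph.IsIso (t.toUnlabeled m).out := by
  rw [toUnlabeled, dif_pos h]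
  exact isIso_out_of_eq (isIso_transport _ _)

theorem out_isIso_out_iff {m : ℕ} {c c' : Unlabeled m} : c.out.IsIso c'.out ↔ c = c' := by
  constructor
  · intro h
    rw [← Quotient.out_eq c, ← Quotient.out_eq c']
    exact Quotient.sound h
  · rintro rfl
    exact IsIso.refl _

theorem toUnlabeled_eq_iff {m : ℕ} {t : PlaneTree} (h : t.size = m + 1) {c : Unlabeled (m + 1)} :
    t.toUnlabeled m = c ↔ t.toGraph.IsIso c.out := by
  rw [← out_isIso_out_iff]
  exact ⟨fun h' => (isIso_toUnlabeled_out h).trans h',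
    fun h' => (isIso_toUnlabeled_out h).symm.trans h'⟩

theorem size_eq_of_isIso_fin {m : ℕ} {t : PlaneTree} {H : RootedGraph (Fin m)}
    (h : H.IsIso t.toGraph) : t.size = m := by
  rw [← natCard_vert, ← h.card_eq, Nat.card_eq_fintype_card, Fintype.card_fin]

theorem exists_canonTrees_isIso {K : ℕ} {H : RootedGraph (Fin (K + 1))} (h : H.graph.IsTree) :
    ∃ t ∈ canonTrees K, H.IsIso t.toGraph := by
  obtain ⟨s, hs⟩ := exists_isIso_toGraph H h
  obtain ⟨t, ht, hst⟩ := exists_isCanon_isIso s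
  have h1 := hs.trans hst
  exact ⟨t, ⟨ht, size_eq_of_isIso_fin h1⟩, h1⟩

/-- The plane trees in canonical form represent the unlabeled rooted trees. -/
theorem ncard_rootedTrees (K : ℕ) : (rootedTrees K).ncard = (canonTrees K).ncard := by
  have h1 : rootedTrees K = toUnlabeled K '' canonTrees K := by
    ext c
    constructor
    · intro hc
      obtain ⟨t, ht, h⟩ := exists_canonTrees_isIso hc
      exact ⟨t, ht, (toUnlabeled_eq_iff ht.2).2 h.symm⟩
    · rintro ⟨t, ht, h⟩
      rw [toUnlabeled_eq_iff ht.2] at h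
      exact h.isTree_iff.1 (toGraph_isTree t)
  rw [h1, Set.InjOn.ncard_image]
  intro s hs t ht h
  rw [toUnlabeled_eq_iff hs.2] at h
  exact hs.1.eq_of_isIso ht.1 (h.trans (isIso_toUnlabeled_out ht.2).symm)

/-- A sublist of a list without repetitions is determined by its set of elements. This makes
sublists stand for subsets of bulbs. -/
theorem eq_filter_of_sublist {α : Type*} {l l' : List α} (h : l.Sublist l') (hn : l'.Nodup)
    (p : α → Bool) (hp : ∀ a ∈ l', p a = true ↔ a ∈ l) : l = l'.filter p := by
  induction h with
  | slnil => rfl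
  | @cons l₁ l₂ a h ih =>
    rw [List.nodup_cons] at hn
    have h1 : p a = false := by
      rw [← Bool.not_eq_true, hp a List.mem_cons_self]
      exact fun h' => hn.1 (h.subset h')
    rw [List.filter_cons_of_neg (by simp [h1])]
    exact ih hn.2 fun b hb => hp b (List.mem_cons_of_mem _ hb)
  | @cons_cons l₁ l₂ a h ih =>
    rw [List.nodup_cons] at hn
    have h1 : p a = true := (hp a List.mem_cons_self).2 List.mem_cons_self
    rw [List.filter_cons_of_pos h1, ← ih hn.2]
    intro b hb
    rw [hp b (List.mem_cons_of_mem _ hb), List.mem_cons]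
    have : b ≠ a := fun h' => hn.1 (h' ▸ hb)
    simp [this]

/-! ### The listed chandeliers represent each isomorphism class exactly once. -/

section ListChandeliers

variable {L M K R N : ℕ}

/-- The list of chandeliers found by the algorithm. -/
def allChandeliers (L M K R : ℕ) : List (PlaneTree × ℕ) :=
  (listChandeliers L M (listBulbs K R).val).val

theorem mem_allChandeliers {p : PlaneTree × ℕ} : p ∈ allChandeliers L M K R ↔
    ∃ l : List (PlaneTree × ℕ), l.Sublist (listBulbs K R).val ∧ l.length = L ∧
      p = (chandelierTree M (l.map Prod.fst), (l.map Prod.snd).prod) := by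
  simp only [allChandeliers, listChandeliers, val_bind, val_mapList, List.mem_map,
    mem_combinations, val_buildChandelier]
  exact ⟨fun ⟨l, ⟨h1, h2⟩, h3⟩ => ⟨l, h1, h2, h3.symm⟩, fun ⟨l, h1, h2, h3⟩ => ⟨l, ⟨h1, h2⟩, h3.symm⟩⟩

theorem listBulbs_eq_of_fst_eq {p p' : PlaneTree × ℕ} (h : p ∈ (listBulbs K R).val)
    (h' : p' ∈ (listBulbs K R).val) (hp : p.1 = p'.1) : p = p' := by
  have h1 := ((listBulbs_spec K R).1 p).1 h
  have h2 := ((listBulbs_spec K R).1 p').1 h'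
  refine Prod.ext hp ?_
  rw [h1.2.1, h2.2.1, hp]

theorem pairwise_not_isIso_of_sublist {l : List (PlaneTree × ℕ)}
    (h : l.Sublist (listBulbs K R).val) :
    (l.map Prod.fst).Pairwise fun s t => ¬ s.toGraph.IsIso t.toGraph := by
  obtain ⟨h1, h2, -⟩ := listBulbs_spec K R
  refine List.Pairwise.imp_of_mem ?_ (h2.sublist (h.map Prod.fst))
  intro s t hs ht hne hst
  obtain ⟨p, hp, rfl⟩ := List.mem_map.1 hs
  obtain ⟨p', hp', rfl⟩ := List.mem_map.1 ht
  exact hne (((h1 p).1 (h.subset hp)).1.1.eq_of_isIso ((h1 p').1 (h.subset hp')).1.1 hst)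

theorem size_and_aut_of_mem_allChandeliers (hM : 0 < M) (hN : N = (K + M) * L)
    {p : PlaneTree × ℕ} (hp : p ∈ allChandeliers L M K R) :
    p.1.size = N + 1 ∧ p.2 = p.1.toGraph.aut := by
  obtain ⟨h1, -⟩ := listBulbs_spec K R
  obtain ⟨l, hl, hlen, rfl⟩ := mem_allChandeliers.1 hp
  constructor
  · rw [size_chandelierTree (K := K) hM, List.length_map, hlen, hN]
    intro t ht
    obtain ⟨p, hp, rfl⟩ := List.mem_map.1 ht
    exact ((h1 p).1 (hl.subset hp)).1.2
  · rw [aut_chandelierTree M _ (pairwise_not_isIso_of_sublist hl), List.map_map]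
    refine congrArg List.prod (List.map_congr_left fun p hp => ?_)
    exact ((h1 p).1 (hl.subset hp)).2.1

theorem mem_of_isIso_chandelierTree {l l' : List (PlaneTree × ℕ)}
    (hl : l.Sublist (listBulbs K R).val) (hl' : l'.Sublist (listBulbs K R).val)
    (h : (chandelierTree M (l.map Prod.fst)).toGraph.IsIso
      (chandelierTree M (l'.map Prod.fst)).toGraph) {p : PlaneTree × ℕ} (hp : p ∈ l) : p ∈ l' := by
  obtain ⟨h1, -⟩ := listBulbs_spec K R
  obtain ⟨b, hb, hpb⟩ := exists_isIso_of_isIso_chandelierTree h (List.mem_map_of_mem hp)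
  obtain ⟨p', hp', rfl⟩ := List.mem_map.1 hb
  have h2 := ((h1 p).1 (hl.subset hp)).1.1.eq_of_isIso ((h1 p').1 (hl'.subset hp')).1.1 hpb
  rwa [listBulbs_eq_of_fst_eq (hl.subset hp) (hl'.subset hp') h2]

/-- Isomorphic chandeliers have the same bulbs, and both lists are then the same filter of the list
of all bulbs. -/
theorem eq_of_isIso_chandelierTree {l l' : List (PlaneTree × ℕ)}
    (hl : l.Sublist (listBulbs K R).val) (hl' : l'.Sublist (listBulbs K R).val)
    (h : (chandelierTree M (l.map Prod.fst)).toGraph.IsIso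
      (chandelierTree M (l'.map Prod.fst)).toGraph) : l = l' := by
  classical
  have hn : (listBulbs K R).val.Nodup := (listBulbs_spec K R).2.1.of_map _
  rw [eq_filter_of_sublist hl hn (fun a => decide (a ∈ l)) (by simp),
    eq_filter_of_sublist hl' hn (fun a => decide (a ∈ l)) (fun a _ => ?_)]
  rw [decide_eq_true_iff]
  exact ⟨mem_of_isIso_chandelierTree hl hl' h, mem_of_isIso_chandelierTree hl' hl h.symm⟩

theorem nodup_allChandeliers (hM : 0 < M) (hN : N = (K + M) * L) :
    ((allChandeliers L M K R).map fun p => p.1.toUnlabeled N).Nodup := by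
  have hn : (listBulbs K R).val.Nodup := (listBulbs_spec K R).2.1.of_map _
  have h2 := nodup_combinations L hn
  rw [allChandeliers, listChandeliers, val_bind, val_mapList, List.map_map]
  refine h2.map_on fun l hl l' hl' h => ?_
  have m1 := mem_combinations.1 hl
  have m2 := mem_combinations.1 hl'
  simp only [Function.comp_apply, val_buildChandelier] at h
  have s1 := (size_and_aut_of_mem_allChandeliers hM hN
    (mem_allChandeliers.2 ⟨l, m1.1, m1.2, rfl⟩)).1
  have s2 := (size_and_aut_of_mem_allChandeliers hM hN
    (mem_allChandeliers.2 ⟨l', m2.1, m2.2, rfl⟩)).1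
  rw [toUnlabeled_eq_iff s1] at h
  exact eq_of_isIso_chandelierTree m1.1 m2.1 (h.trans (isIso_toUnlabeled_out s2).symm)

theorem mem_chandeliers_iff (hM : 0 < M) (hN : N = (K + M) * L) (c : Unlabeled (N + 1)) :
    c ∈ chandeliers L M K R N ↔
      c ∈ (allChandeliers L M K R).map fun p => p.1.toUnlabeled N := by
  classical
  obtain ⟨h1, h2, -⟩ := listBulbs_spec K R
  rw [List.mem_map]
  constructor
  · rintro ⟨B, hB, hne, hc⟩
    choose t ht hBt using fun l => exists_canonTrees_isIso (hB l).1
    have ht1 : ∀ l, ((t l), (t l).toGraph.aut) ∈ (listBulbs K R).val := fun l =>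
      (h1 _).2 ⟨ht l, rfl, by rw [← (hBt l).aut_eq]; exact (hB l).2⟩
    have hinj : Function.Injective t := by
      intro l l' h
      by_contra hll
      refine hne l l' hll ((hBt l).trans ?_)
      rw [h]
      exact (hBt l').symm
    -- The canonical forms of the bulbs, put in the order of the list, since `combinations` produces
    -- only sublists. Reordering the branches does not change the isomorphism class.
    let l := (listBulbs K R).val.filter fun p => decide (p.1 ∈ List.ofFn t)
    have hl : l.Sublist (listBulbs K R).val := List.filter_sublist
    have hperm : (List.ofFn t).Perm (l.map Prod.fst) := by
      rw [List.perm_ext_iff_of_nodup (List.nodup_ofFn.2 hinj) (h2.sublist (hl.map _))]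
      intro s
      constructor
      · intro hs
        obtain ⟨i, rfl⟩ := List.mem_ofFn.1 hs
        exact List.mem_map.2 ⟨_, List.mem_filter.2 ⟨ht1 i, decide_eq_true hs⟩, rfl⟩
      · intro hs
        obtain ⟨p, hp, rfl⟩ := List.mem_map.1 hs
        exact of_decide_eq_true (List.mem_filter.1 hp).2
    have hlen : l.length = L := by
      rw [← List.length_map (f := Prod.fst), ← hperm.length_eq, List.length_ofFn]
    have hmem := (mem_allChandeliers (M := M)).2 ⟨l, hl, hlen, rfl⟩
    refine ⟨_, hmem, ?_⟩
    rw [toUnlabeled_eq_iff (size_and_aut_of_mem_allChandeliers hM hN hmem).1]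
    exact (hc.trans ((chandelierGraph_isIso hM B t hBt).trans
      (isIso_chandelierTree_of_perm hperm))).symm
  · rintro ⟨p, hp, hpc⟩
    rw [toUnlabeled_eq_iff (size_and_aut_of_mem_allChandeliers hM hN hp).1] at hpc
    obtain ⟨l, hl, rfl, rfl⟩ := mem_allChandeliers.1 hp
    have hl' : ∀ i : Fin l.length, (l.get i).1 ∈ canonTrees K ∧
        (l.get i).2 = (l.get i).1.toGraph.aut ∧ (l.get i).2 ≤ R := fun i =>
      (h1 _).1 (hl.subset (List.get_mem _ _))
    let B : Fin l.length → RootedGraph (Fin (K + 1)) := fun i =>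
      (l.get i).1.toGraph.transport
        (Fintype.equivFinOfCardEq ((card_vert _).trans (hl' i).1.2))
    have hB : ∀ i, (B i).IsIso (l.get i).1.toGraph := fun i => (isIso_transport _ _).symm
    refine ⟨B, fun i => ⟨(hB i).isTree_iff.2 (toGraph_isTree _), ?_⟩, ?_, ?_⟩
    · rw [(hB i).aut_eq, ← (hl' i).2.1]
      exact (hl' i).2.2
    · intro i j hij h
      have h3 := (hB i).symm.trans (h.trans (hB j))
      have h4 := pairwise_not_isIso_of_sublist hl
      rw [List.pairwise_map] at h4
      rcases lt_or_gt_of_ne hij with h5 | h5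
      · exact List.pairwise_iff_get.1 h4 i j h5 h3
      · exact List.pairwise_iff_get.1 h4 j i h5 h3.symm
    · have h5 := chandelierGraph_isIso hM B (fun i => (l.get i).1) hB
      have h6 : List.ofFn (fun i => (l.get i).1) = l.map Prod.fst := by
        conv_rhs => rw [← List.ofFn_get l, List.map_ofFn]
        rfl
      rw [h6] at h5
      exact hpc.symm.trans h5.symm

theorem length_allChandeliers_le :
    (allChandeliers L M K R).length ≤ (canonTrees K).ncard.choose L := by
  rw [allChandeliers, listChandeliers, val_bind, val_mapList, List.length_map,
    length_combinations]
  exact Nat.choose_le_choose L (listBulbs_spec K R).2.2.1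

end ListChandeliers

/-! ### Values of accumulating loops. -/

namespace Timed

theorem val_loop_cons {α σ : Type} (body : σ → α → Timed σ) (a : α) (l : List α) (s : σ) :
    (loop body (a :: l) s).val = (loop body l (body s a).val).val := rfl

theorem val_loop_nil {α σ : Type} (body : σ → α → Timed σ) (s : σ) :
    (loop body [] s).val = s := rfl

theorem val_loop_add {α σ : Type} [AddCommMonoid σ] {body : σ → α → Timed σ} (g : α → σ)
    (h : ∀ s a, (body s a).val = s + g a) (l : List α) (s : σ) :
    (loop body l s).val = s + (l.map g).sum := by
  induction l generalizing s with
  | nil => simp [val_loop_nil]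
  | cons a l ih => rw [val_loop_cons, h, ih, List.map_cons, List.sum_cons, add_assoc]

theorem val_loop_push {α β : Type} {body : List β → α → Timed (List β)} (f : α → List β)
    (h : ∀ s a, (body s a).val = f a ++ s) (l : List α) (s : List β) :
    (loop body l s).val = l.reverse.flatMap f ++ s := by
  induction l generalizing s with
  | nil => simp [val_loop_nil]
  | cons a l ih => rw [val_loop_cons, h, ih]; simp

end Timed

/-- Rewrites an update in place as an addition in the space of tables, so that `val_loop_add` turns
the nested loops into sums. -/
theorem update_update_eq_add_single {ι κ : Type*} [DecidableEq ι] [DecidableEq κ]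
    (Y : ι → κ → ℝ) (x : ι) (U : κ) (v : ℝ) :
    Function.update Y x (Function.update (Y x) U (Y x U + v)) =
      Y + Pi.single x (Pi.single U v) := by
  ext x' U'
  by_cases hx : x' = x
  · subst hx
    by_cases hU : U' = U
    · subst hU
      simp
    · simp [hU]
  · simp [hx]

theorem update_eq_add_single {ι : Type*} [DecidableEq ι] (Y : ι → ℝ) (x : ι) (v : ℝ) :
    Function.update Y x (Y x + v) = Y + Pi.single x v := by
  ext x'
  by_cases hx : x' = x
  · subst hx
    simp
  · simp [hx]

theorem sum_map_finRange {n : ℕ} {σ : Type*} [AddCommMonoid σ] (g : Fin n → σ) :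
    ((List.finRange n).map g).sum = ∑ i, g i := by
  rw [← List.sum_toFinset _ (List.nodup_finRange n)]
  congr 1
  ext i
  simp

/-! # Pairs of disjoint sets of colors -/

section Splits

variable {N : ℕ}

/-- The three ways to extend a pair of disjoint sets by the color `c`. -/
def extendSplit (c : Fin (N + 1)) (C : ColorSet N × ColorSet N) :
    List (ColorSet N × ColorSet N) :=
  [(C.1, insert c C.2), (insert c C.1, C.2), C]

/-- `l` lists the pairs of disjoint subsets of `P`. -/
def ListsSplits (P : ColorSet N) (l : List (ColorSet N × ColorSet N)) : Prop :=
  l.Nodup ∧ ∀ C, C ∈ l ↔ Disjoint C.1 C.2 ∧ C.1 ∪ C.2 ⊆ P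

/-- Erasing `c` from both sets inverts the extension. The color `c` was in the first set, in the
second, or in neither, which are the three entries of `extendSplit`. -/
theorem ListsSplits.extend {P : ColorSet N} {l : List (ColorSet N × ColorSet N)}
    (h : ListsSplits P l) {c : Fin (N + 1)} (hc : c ∉ P) :
    ListsSplits (insert c P) (l.reverse.flatMap (extendSplit c)) := by
  obtain ⟨h1, h2⟩ := h
  have hc1 : ∀ C ∈ l, c ∉ C.1 ∧ c ∉ C.2 := fun C hC =>
    ⟨fun h => hc (((h2 C).1 hC).2 (Finset.mem_union_left _ h)),
      fun h => hc (((h2 C).1 hC).2 (Finset.mem_union_right _ h))⟩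
  have herase : ∀ C ∈ l, ∀ D ∈ extendSplit c C, (D.1.erase c, D.2.erase c) = C := by
    intro C hC D hD
    obtain ⟨h3, h4⟩ := hc1 C hC
    simp only [extendSplit, List.mem_cons, List.not_mem_nil, or_false] at hD
    rcases hD with rfl | rfl | rfl <;> simp [h3, h4]
  constructor
  · rw [List.nodup_flatMap]
    constructor
    · intro C hC
      obtain ⟨h3, h4⟩ := hc1 C (List.mem_reverse.1 hC)
      have e1 : insert c C.1 ≠ C.1 := fun h => h3 (h ▸ Finset.mem_insert_self c _)
      have e2 : insert c C.2 ≠ C.2 := fun h => h4 (h ▸ Finset.mem_insert_self c _)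
      simp [extendSplit, Prod.ext_iff, e1, e2, e1.symm]
    · refine List.Pairwise.imp_of_mem ?_ (List.nodup_reverse.2 h1)
      intro C C' hC hC' hne D hD hD'
      rw [List.mem_reverse] at hC hC'
      exact hne ((herase C hC D hD).symm.trans (herase C' hC' D hD'))
  · intro D
    rw [List.mem_flatMap]
    constructor
    · rintro ⟨C, hC, hD⟩
      rw [List.mem_reverse] at hC
      obtain ⟨h3, h4⟩ := hc1 C hC
      obtain ⟨h5, h6⟩ := (h2 C).1 hC
      simp only [extendSplit, List.mem_cons, List.not_mem_nil, or_false] at hD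
      rcases hD with rfl | rfl | rfl
      · refine ⟨Finset.disjoint_insert_right.2 ⟨h3, h5⟩, ?_⟩
        simp only [Finset.union_insert]
        exact Finset.insert_subset_insert _ h6
      · refine ⟨Finset.disjoint_insert_left.2 ⟨h4, h5⟩, ?_⟩
        simp only [Finset.insert_union]
        exact Finset.insert_subset_insert _ h6
      · exact ⟨h5, h6.trans (Finset.subset_insert _ _)⟩
    · rintro ⟨h5, h6⟩
      have hsub : D.1.erase c ∪ D.2.erase c ⊆ P := by
        rw [← Finset.erase_union_distrib]
        rw [← Finset.subset_insert_iff]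
        exact h6
      refine ⟨(D.1.erase c, D.2.erase c), ?_, ?_⟩
      · rw [List.mem_reverse, h2]
        exact ⟨h5.mono (Finset.erase_subset _ _) (Finset.erase_subset _ _), hsub⟩
      · simp only [extendSplit, List.mem_cons, List.not_mem_nil, or_false]
        by_cases h7 : c ∈ D.1
        · have h8 : c ∉ D.2 := Finset.disjoint_left.1 h5 h7
          refine Or.inr (Or.inl ?_)
          rw [Finset.insert_erase h7, Finset.erase_eq_of_notMem h8]
        · by_cases h8 : c ∈ D.2
          · refine Or.inl ?_
            rw [Finset.insert_erase h8, Finset.erase_eq_of_notMem h7]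
          · refine Or.inr (Or.inr ?_)
            rw [Finset.erase_eq_of_notMem h7, Finset.erase_eq_of_notMem h8]

theorem listSplits_spec (N : ℕ) :
    ListsSplits Finset.univ (listSplits N).val ∧ (listSplits N).val.length = 3 ^ (N + 1) ∧
      (listSplits N).time ≤ 11 * 3 ^ (N + 1) := by
  let inner (c : Fin (N + 1)) : List (ColorSet N × ColorSet N) → ColorSet N × ColorSet N →
      Timed (List (ColorSet N × ColorSet N)) := fun r C => do
    let C₁ ← step (insert c C.1)
    let C₂ ← step (insert c C.2)
    let r ← step (C :: r)
    let r ← step ((C₁, C.2) :: r)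
    step ((C.1, C₂) :: r)
  have hin : ∀ c l, (loop (inner c) l []).val = l.reverse.flatMap (extendSplit c) := by
    intro c l
    rw [val_loop_push (extendSplit c) (fun s a => rfl), List.append_nil]
  have htime : ∀ c l, (loop (inner c) l []).time ≤ l.length * 6 + 1 := fun c l =>
    time_loop_le 5 l [] fun s a _ => le_rfl
  -- `P` is the set of colors treated so far. Each round triples the list at six steps per pair; the
  -- term `3 * l.length` on the left makes the resulting geometric sum telescope.
  have key : ∀ (cs : List (Fin (N + 1))) (P : ColorSet N) (l : List (ColorSet N × ColorSet N)),
      cs.Nodup → (∀ c ∈ cs, c ∉ P) → ListsSplits P l →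
      ListsSplits (P ∪ cs.toFinset) (loop (fun l c => loop (inner c) l []) cs l).val ∧
      (loop (fun l c => loop (inner c) l []) cs l).val.length = l.length * 3 ^ cs.length ∧
      (loop (fun l c => loop (inner c) l []) cs l).time + 3 * l.length ≤
        3 * l.length * 3 ^ cs.length + 2 * cs.length + 1 := by
    intro cs
    induction cs with
    | nil =>
      intro P l _ _ h
      refine ⟨by simpa [val_loop_nil] using h, by simp [val_loop_nil], ?_⟩
      simp [loop, Nat.add_comm]
    | cons c cs ih =>
      intro P l hn hP h
      rw [List.nodup_cons] at hn
      have h1 := h.extend (hP c List.mem_cons_self)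
      have hlen : (l.reverse.flatMap (extendSplit c)).length = l.length * 3 := by
        rw [List.length_flatMap]
        simp [extendSplit]
      obtain ⟨i1, i2, i3⟩ := ih (insert c P) (l.reverse.flatMap (extendSplit c)) hn.2 (by
        intro d hd hdP
        rcases Finset.mem_insert.1 hdP with rfl | hdP
        · exact hn.1 hd
        · exact hP d (List.mem_cons_of_mem _ hd) hdP) h1
      rw [hlen] at i2 i3
      have ht := htime c l
      have e1 : (loop (fun l c => loop (inner c) l []) (c :: cs) l).time =
          1 + ((loop (inner c) l []).time +
            (loop (fun l c => loop (inner c) l []) cs (loop (inner c) l []).val).time) := rfl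
      rw [val_loop_cons, e1, hin]
      refine ⟨?_, ?_, ?_⟩
      · rw [List.toFinset_cons, Finset.union_insert, ← Finset.insert_union]
        exact i1
      · rw [i2, List.length_cons, pow_succ]
        ring
      · rw [List.length_cons, pow_succ]
        have e2 : 3 * (l.length * 3) * 3 ^ cs.length = 3 * l.length * (3 ^ cs.length * 3) := by
          ring
        omega
  obtain ⟨k1, k2, k3⟩ := key (List.finRange (N + 1)) ∅ [(∅, ∅)] (List.nodup_finRange _) (by simp)
    ⟨by simp, by
      intro C
      simp only [List.mem_singleton, Finset.subset_empty, Finset.union_eq_empty, Prod.ext_iff]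
      constructor
      · rintro ⟨h, h'⟩
        rw [h, h']
        simp
      · exact fun h => h.2⟩
  have e : listSplits N = loop (fun l c => loop (inner c) l []) (List.finRange (N + 1)) [(∅, ∅)] :=
    rfl
  rw [← e] at k1 k2 k3
  have huniv : (∅ : ColorSet N) ∪ (List.finRange (N + 1)).toFinset = Finset.univ := by
    ext i
    simp
  rw [huniv] at k1
  rw [List.length_finRange] at k2 k3
  refine ⟨k1, by simpa using k2, ?_⟩
  have h3 : N + 1 < 3 ^ (N + 1) := Nat.lt_pow_self (by norm_num)
  simp at k3
  omega

theorem buildSplits_spec (N : ℕ) :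
    (∀ a b, ((buildSplits N).val a b).Nodup ∧
      ∀ C, C ∈ (buildSplits N).val a b ↔ Disjoint C.1 C.2 ∧ C.1.card = a ∧ C.2.card = b) ∧
    (buildSplits N).time ≤ 11 * 3 ^ (N + 1) + (N + 2) ^ 2 + 3 ^ (N + 1) * (2 * (N + 1) + 4) + 1 := by
  let body : SplitTable N → ColorSet N × ColorSet N → Timed (SplitTable N) := fun S C => do
    let a ← steps (N + 1) C.1.card
    let b ← steps (N + 1) C.2.card
    let old ← step (S a b)
    let new ← step (C :: old)
    step (Function.update S a (Function.update (S a) b new))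
  have key : ∀ (l : List (ColorSet N × ColorSet N)) (S : SplitTable N) (a b : ℕ),
      (loop body l S).val a b =
        l.reverse.filter (fun C => decide (C.1.card = a ∧ C.2.card = b)) ++ S a b := by
    intro l
    induction l with
    | nil => intro S a b; simp [val_loop_nil]
    | cons C l ih =>
      intro S a b
      have hb : (body S C).val = Function.update S C.1.card
        (Function.update (S C.1.card) C.2.card (C :: S C.1.card C.2.card)) := rfl
      rw [val_loop_cons, ih, hb, List.reverse_cons, List.filter_append, List.append_assoc]
      congr 1
      by_cases h1 : a = C.1.card
      · subst h1
        by_cases h2 : b = C.2.card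
        · subst h2
          simp
        · simp [h2, Ne.symm h2]
      · simp [h1, Ne.symm h1]
  have e : buildSplits N = (do
    let l ← listSplits N
    let S ← steps ((N + 2) ^ 2) (fun _ _ => [])
    loop body l S) := rfl
  obtain ⟨⟨h1, h2⟩, h3, h4⟩ := listSplits_spec N
  constructor
  · intro a b
    rw [e, val_bind, val_bind, key]
    simp only [val_steps, List.append_nil]
    refine ⟨(List.nodup_reverse.2 h1).filter _, fun C => ?_⟩
    simp [h2]
  · rw [e, time_bind, time_bind]
    have h5 := time_loop_le (body := body) (2 * (N + 1) + 3) (listSplits N).val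
      (fun _ _ => []) fun S C _ => by
        have : (body S C).time = (N + 1) + ((N + 1) + (1 + (1 + 1))) := rfl
        omega
    rw [h3, show 2 * (N + 1) + 3 + 1 = 2 * (N + 1) + 4 from rfl] at h5
    simp only [val_steps, time_steps]
    omega

end Splits

/-! # Color-coding dynamic programming -/

section Tables

variable {n N : ℕ}

/-- The product of the weights of the images of the edges of a plane tree. -/
def PlaneTree.weight (M : Matrix (Fin n) (Fin n) ℝ) : (t : PlaneTree) → (Vert t → Fin n) → ℝ
  | .leaf, _ => 1
  | .join t c, φ => M (φ (Sum.inl t.toGraph.root)) (φ (Sum.inr c.toGraph.root)) *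
      (weight M t (fun v => φ (Sum.inl v)) * weight M c (fun v => φ (Sum.inr v)))

open Classical in
/-- The weight of a map of a plane tree if its vertices have distinct colors, and `0` otherwise. -/
noncomputable def colorfulWeight (M : Matrix (Fin n) (Fin n) ℝ) (μ : Fin n → Fin (N + 1))
    (t : PlaneTree) (φ : Vert t → Fin n) : ℝ :=
  if Function.Injective (fun v => μ (φ v)) then t.weight M φ else 0

/-- The colors of the vertices under a map of a plane tree. -/
noncomputable def colorImage (μ : Fin n → Fin (N + 1)) (t : PlaneTree) (φ : Vert t → Fin n) :
    ColorSet N :=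
  Finset.univ.image fun v => μ (φ v)

/-- The weighted number of the maps of a plane tree that send the root to `x` and whose colors
are distinct and form the set `C`. -/
noncomputable def treeCount (M : Matrix (Fin n) (Fin n) ℝ) (μ : Fin n → Fin (N + 1))
    (t : PlaneTree) (x : Fin n) (C : ColorSet N) : ℝ :=
  ∑ φ : Vert t → Fin n, if colorImage μ t φ = C then
    (if φ t.toGraph.root = x then colorfulWeight M μ t φ else 0) else 0

theorem val_leafTable (M : Matrix (Fin n) (Fin n) ℝ) (μ : Fin n → Fin (N + 1)) :
    (leafTable μ).val = treeCount M μ .leaf := by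
  let body : ColorTable ℝ n N → Fin n → Timed (ColorTable ℝ n N) := fun Y x => do
    let c ← step (μ x)
    let C ← step {c}
    Y.write x C 1
  have key : ∀ (l : List (Fin n)) (Y : ColorTable ℝ n N) (x : Fin n) (C : ColorSet N),
      (loop body l Y).val x C = if x ∈ l ∧ C = {μ x} then 1 else Y x C := by
    intro l
    induction l with
    | nil => simp [val_loop_nil]
    | cons a l ih =>
      intro Y x C
      have hb : (body Y a).val = Function.update Y a (Function.update (Y a) {μ a} 1) := rfl
      rw [val_loop_cons, ih, hb]
      by_cases h1 : x ∈ l ∧ C = {μ x}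
      · rw [if_pos h1, if_pos ⟨List.mem_cons_of_mem _ h1.1, h1.2⟩]
      · rw [if_neg h1]
        by_cases h2 : x = a
        · subst h2
          by_cases h3 : C = {μ x}
          · subst h3
            simp
          · simp [h3]
        · have h4 : ¬ (x ∈ a :: l ∧ C = {μ x}) := by
            simpa [h2] using h1
          rw [if_neg h4]
          simp [h2]
  have e : (leafTable μ : Timed (ColorTable ℝ n N)).val =
    (loop body (List.finRange n) (fun _ _ => 0)).val := rfl
  ext x C
  rw [e, key, treeCount]
  have h1 : ∀ φ : Vert .leaf → Fin n, φ = fun _ => φ () := fun φ => funext fun _ => rfl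
  rw [Fintype.sum_eq_single (fun _ => x)]
  · have h2 : colorImage μ .leaf (fun _ => x) = {μ x} := by
      rw [colorImage]
      exact Finset.image_const (⟨(), Finset.mem_univ _⟩ :
        (Finset.univ : Finset (Vert .leaf)).Nonempty) _
    have h3 : colorfulWeight M μ .leaf (fun _ => x) = 1 := by
      rw [colorfulWeight, if_pos]
      · rfl
      · intro u v _
        exact Subsingleton.elim (α := Unit) u v
    rw [h2, h3]
    simp [eq_comm]
  · intro φ hφ
    have : φ PlaneTree.leaf.toGraph.root ≠ x := fun h => hφ (by rw [h1 φ]; exact funext fun _ => h)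
    simp [this]

theorem val_joinTable (M : Matrix (Fin n) (Fin n) ℝ) (splits : List (ColorSet N × ColorSet N))
    (Yt Yc : ColorTable ℝ n N) (x : Fin n) (U : ColorSet N) :
    (joinTable M splits Yt Yc).val x U = (splits.map fun C => if C.1 ∪ C.2 = U then
      Yt x C.1 * ∑ y, M x y * Yc y C.2 else 0).sum := by
  let g (C : ColorSet N × ColorSet N) (x y : Fin n) : ColorTable ℝ n N :=
    Pi.single x (Pi.single (C.1 ∪ C.2) (M x y * Yt x C.1 * Yc y C.2))
  have e : (joinTable M splits Yt Yc).val =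
      (splits.map fun C => ∑ x, ∑ y, g C x y).sum := by
    rw [joinTable, val_bind]
    rw [val_loop_add (fun C => ∑ x, ∑ y, g C x y)]
    · have : (zeroTable ℝ n N).val = 0 := rfl
      rw [this, zero_add]
    · intro Y C
      rw [val_bind, val_step]
      rw [val_loop_add (fun x => ∑ y, g C x y), sum_map_finRange]
      intro Y x
      rw [val_loop_add (fun y => g C x y), sum_map_finRange]
      intro Y y
      exact update_update_eq_add_single _ _ _ _
  rw [e]
  have h1 : ∀ l : List (ColorSet N × ColorSet N),
      (l.map fun C => ∑ x, ∑ y, g C x y).sum x U =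
        (l.map fun C => (∑ x, ∑ y, g C x y) x U).sum := by
    intro l
    induction l with
    | nil => rfl
    | cons C l ih =>
      rw [List.map_cons, List.sum_cons, List.map_cons, List.sum_cons, ← ih]
      rfl
  rw [h1]
  congr 1
  refine List.map_congr_left fun C _ => ?_
  rw [Finset.sum_apply, Finset.sum_apply, Finset.sum_eq_single x]
  · rw [Finset.sum_apply, Finset.sum_apply]
    by_cases hU : C.1 ∪ C.2 = U
    · rw [if_pos hU, Finset.mul_sum]
      refine Finset.sum_congr rfl fun y _ => ?_
      simp only [g, hU, Pi.single_eq_same]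
      ring
    · rw [if_neg hU]
      refine Finset.sum_eq_zero fun y _ => ?_
      simp only [g, Pi.single_eq_same]
      exact Pi.single_eq_of_ne' hU _
  · intro x' _ hx
    rw [Finset.sum_apply, Finset.sum_apply]
    refine Finset.sum_eq_zero fun y _ => ?_
    simp only [g]
    rw [Pi.single_eq_of_ne' hx]
    rfl
  · simp

/-- For fixed `φ` and `ψ` exactly one pair of values contributes. This turns the sum over pairs of
color sets into a sum over pairs of maps. -/
theorem sum_fiber_mul_sum_fiber {α β γ δ : Type*} [Fintype α] [Fintype β] [Fintype γ] [Fintype δ]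
    [DecidableEq γ] [DecidableEq δ] (f : α → γ) (g : β → δ) (P : γ × δ → Prop) [DecidablePred P]
    (a : α → ℝ) (b : β → ℝ) :
    (∑ C : γ × δ, if P C then (∑ φ, if f φ = C.1 then a φ else 0) *
      (∑ ψ, if g ψ = C.2 then b ψ else 0) else 0) =
      ∑ φ, ∑ ψ, if P (f φ, g ψ) then a φ * b ψ else 0 := by
  have h1 : ∀ C : γ × δ, (if P C then (∑ φ, if f φ = C.1 then a φ else 0) *
      (∑ ψ, if g ψ = C.2 then b ψ else 0) else 0) =
      ∑ φ, ∑ ψ, if C = (f φ, g ψ) then (if P (f φ, g ψ) then a φ * b ψ else 0) else 0 := by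
    intro C
    rw [Finset.sum_mul_sum]
    by_cases hP : P C
    · rw [if_pos hP]
      refine Finset.sum_congr rfl fun φ _ => Finset.sum_congr rfl fun ψ _ => ?_
      by_cases h : C = (f φ, g ψ)
      · rw [if_pos h]
        rw [h] at hP
        rw [if_pos hP]
        simp [h]
      · rw [if_neg h]
        by_cases h1 : f φ = C.1
        · have h2 : g ψ ≠ C.2 := fun h2 => h (by rw [h1, h2])
          simp [h2]
        · simp [h1]
    · rw [if_neg hP]
      symm
      refine Finset.sum_eq_zero fun φ _ => Finset.sum_eq_zero fun ψ _ => ?_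
      by_cases h : C = (f φ, g ψ)
      · rw [if_pos h]
        rw [h] at hP
        rw [if_neg hP]
      · rw [if_neg h]
  simp_rw [h1]
  rw [Finset.sum_comm]
  refine Finset.sum_congr rfl fun φ _ => ?_
  rw [Finset.sum_comm]
  refine Finset.sum_congr rfl fun ψ _ => ?_
  simp

theorem card_colorImage {μ : Fin n → Fin (N + 1)} {t : PlaneTree} {φ : Vert t → Fin n}
    (h : Function.Injective fun v => μ (φ v)) : (colorImage μ t φ).card = t.size := by
  rw [colorImage, Finset.card_image_of_injective _ h, Finset.card_univ, card_vert]

theorem colorImage_join (μ : Fin n → Fin (N + 1)) (t c : PlaneTree)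
    (φ : Vert (.join t c) → Fin n) :
    colorImage μ (.join t c) φ =
      colorImage μ t (fun v => φ (Sum.inl v)) ∪ colorImage μ c (fun v => φ (Sum.inr v)) := by
  ext k
  simp only [colorImage, Finset.mem_image, Finset.mem_univ, true_and, Finset.mem_union]
  constructor
  · rintro ⟨v | v, h⟩
    · exact Or.inl ⟨v, h⟩
    · exact Or.inr ⟨v, h⟩
  · rintro (⟨v, h⟩ | ⟨v, h⟩)
    · exact ⟨Sum.inl v, h⟩
    · exact ⟨Sum.inr v, h⟩

theorem injective_join_iff (μ : Fin n → Fin (N + 1)) (t c : PlaneTree)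
    (φ : Vert (.join t c) → Fin n) :
    Function.Injective (fun v => μ (φ v)) ↔
      Function.Injective (fun v => μ (φ (Sum.inl v))) ∧
      Function.Injective (fun v => μ (φ (Sum.inr v))) ∧
      Disjoint (colorImage μ t fun v => φ (Sum.inl v))
        (colorImage μ c fun v => φ (Sum.inr v)) := by
  have h1 : Disjoint (colorImage μ t fun v => φ (Sum.inl v))
        (colorImage μ c fun v => φ (Sum.inr v)) ↔
      ∀ u v, μ (φ (Sum.inl u)) ≠ μ (φ (Sum.inr v)) := by
    rw [Finset.disjoint_left]
    simp only [colorImage, Finset.mem_image, Finset.mem_univ, true_and, not_exists,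
      forall_exists_index, forall_apply_eq_imp_iff]
    exact ⟨fun h u v h' => h u v h'.symm, fun h u v h' => h u v h'.symm⟩
  rw [h1]
  constructor
  · intro h
    exact ⟨fun u v huv => Sum.inl_injective (h huv), fun u v huv => Sum.inr_injective (h huv),
      fun u v huv => absurd (h huv) (by simp)⟩
  · rintro ⟨h2, h3, h4⟩ (u | u) (v | v) huv
    · exact congrArg _ (h2 huv)
    · exact absurd huv (h4 u v)
    · exact absurd huv.symm (h4 v u)
    · exact congrArg _ (h3 huv)

/-- A map of `join t c` is a pair of maps. Its colors are distinct iff those of both maps are and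
the two color sets are disjoint (`injective_join_iff`). These sets then have the sizes of `t` and
`c`, so one cell of the table of splits contains every relevant pair, and the weights multiply. -/
theorem val_treeTable (M : Matrix (Fin n) (Fin n) ℝ) {S : SplitTable N}
    (hS : ∀ a b, (S a b).Nodup ∧ ∀ C, C ∈ S a b ↔ Disjoint C.1 C.2 ∧ C.1.card = a ∧ C.2.card = b)
    (μ : Fin n → Fin (N + 1)) : ∀ t : PlaneTree,
      (treeTable M S μ t).val = (t.size, treeCount M μ t)
  | .leaf => by
    rw [treeTable, val_bind, val_leafTable M]
    rfl
  | .join t c => by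
    classical
    have e : (treeTable M S μ (.join t c)).val =
        ((treeTable M S μ t).val.1 + (treeTable M S μ c).val.1,
        (joinTable M (S (treeTable M S μ t).val.1 (treeTable M S μ c).val.1)
          (treeTable M S μ t).val.2 (treeTable M S μ c).val.2).val) := rfl
    rw [e, val_treeTable M hS μ t, val_treeTable M hS μ c]
    refine Prod.ext rfl (funext fun x => funext fun U => ?_)
    simp only
    rw [val_joinTable, ← List.sum_toFinset _ (hS _ _).1]
    obtain ⟨-, h1⟩ := hS t.size c.size
    have h2 : ∀ C2, ∑ y, M x y * treeCount M μ c y C2 = ∑ ψ : Vert c → Fin n,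
        if colorImage μ c ψ = C2 then M x (ψ c.toGraph.root) * colorfulWeight M μ c ψ else 0 := by
      intro C2
      simp only [treeCount, Finset.mul_sum]
      rw [Finset.sum_comm]
      refine Finset.sum_congr rfl fun ψ _ => ?_
      by_cases h : colorImage μ c ψ = C2
      · simp [h]
      · simp [h]
    simp only [h2]
    have h3 : ∀ f : ColorSet N × ColorSet N → ℝ,
        ∑ C ∈ (S t.size c.size).toFinset, (if C.1 ∪ C.2 = U then f C else 0) =
        ∑ C, if (Disjoint C.1 C.2 ∧ C.1.card = t.size ∧ C.2.card = c.size) ∧ C.1 ∪ C.2 = U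
          then f C else 0 := by
      intro f
      have : (S t.size c.size).toFinset = Finset.univ.filter fun C : ColorSet N × ColorSet N =>
          Disjoint C.1 C.2 ∧ C.1.card = t.size ∧ C.2.card = c.size := by
        ext C
        simp [h1]
      rw [this, Finset.sum_filter]
      exact Finset.sum_congr rfl fun C _ => (ite_and _ _ _ _).symm
    rw [h3]
    unfold treeCount
    rw [sum_fiber_mul_sum_fiber (colorImage μ t) (colorImage μ c)]
    have hs : ∀ F : (Vert (.join t c) → Fin n) → ℝ, ∑ φ, F φ = ∑ φ, ∑ ψ,
        F ((Equiv.sumArrowEquivProdArrow (Vert t) (Vert c) (Fin n)).symm (φ, ψ)) := by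
      intro F
      let E : (Vert t → Fin n) × (Vert c → Fin n) ≃ (Vert (.join t c) → Fin n) :=
        (Equiv.sumArrowEquivProdArrow (Vert t) (Vert c) (Fin n)).symm
      exact (E.sum_comp F).symm.trans (Fintype.sum_prod_type _)
    rw [hs]
    refine Finset.sum_congr rfl fun φ _ => Finset.sum_congr rfl fun ψ _ => ?_
    have e1 : colorImage μ (.join t c)
        ((Equiv.sumArrowEquivProdArrow (Vert t) (Vert c) (Fin n)).symm (φ, ψ)) =
        colorImage μ t φ ∪ colorImage μ c ψ := colorImage_join μ t c _
    have e2 := injective_join_iff μ t c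
      ((Equiv.sumArrowEquivProdArrow (Vert t) (Vert c) (Fin n)).symm (φ, ψ))
    have e3 : (PlaneTree.join t c).weight M
        ((Equiv.sumArrowEquivProdArrow (Vert t) (Vert c) (Fin n)).symm (φ, ψ)) =
        M (φ t.toGraph.root) (ψ c.toGraph.root) * (t.weight M φ * c.weight M ψ) := rfl
    have e4 : (Equiv.sumArrowEquivProdArrow (Vert t) (Vert c) (Fin n)).symm (φ, ψ)
        (PlaneTree.join t c).toGraph.root = φ t.toGraph.root := rfl
    simp only [Equiv.sumArrowEquivProdArrow_symm_apply_inl,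
      Equiv.sumArrowEquivProdArrow_symm_apply_inr] at e2
    rw [e1, e4]
    unfold colorfulWeight
    rw [e3]
    by_cases hU : colorImage μ t φ ∪ colorImage μ c ψ = U
    swap
    · simp [hU]
    by_cases hx : φ t.toGraph.root = x
    swap
    · simp [hx]
    by_cases i1 : Function.Injective fun v => μ (φ v)
    swap
    · rw [if_neg fun h => i1 (e2.1 h).1]
      simp [i1]
    by_cases i2 : Function.Injective fun v => μ (ψ v)
    swap
    · rw [if_neg fun h => i2 (e2.1 h).2.1]
      simp [i2]
    by_cases i3 : Disjoint (colorImage μ t φ) (colorImage μ c ψ)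
    swap
    · rw [if_neg fun h => i3 (e2.1 h).2.2]
      simp [i3]
    rw [if_pos (e2.2 ⟨i1, i2, i3⟩)]
    simp [i1, i2, i3, hU, hx, card_colorImage i1, card_colorImage i2]
    ring

theorem val_addCounts (M : Matrix (Fin n) (Fin n) ℝ) {S : SplitTable N}
    (hS : ∀ a b, (S a b).Nodup ∧ ∀ C, C ∈ S a b ↔ Disjoint C.1 C.2 ∧ C.1.card = a ∧ C.2.card = b)
    (μ : Fin n → Fin (N + 1)) (t : PlaneTree) (k : ℕ) (acc : Fin n → ℝ) :
    (addCounts M S μ t k acc).val =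
      fun i => acc i + treeCount M μ t i Finset.univ / (k : ℝ) := by
  rw [addCounts, val_bind, val_treeTable M hS]
  simp only [val_bind, val_step]
  rw [val_loop_add (fun i => Pi.single i (treeCount M μ t i Finset.univ / (k : ℝ))),
    sum_map_finRange]
  · ext i
    rw [Pi.add_apply, Finset.sum_apply, Finset.sum_pi_single]
    simp
  · intro acc i
    exact update_eq_add_single _ _ _

end Tables

/-! # Colorful counts and maps of trees -/

section Copies

variable {V : Type*} {n N : ℕ}

open SimpleGraph in
/-- An injective map into `[n]` as a copy of a graph in the complete graph. -/
def copyOfInjective (G : SimpleGraph V) (φ : V → Fin n) (h : Function.Injective φ) :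
    Copy G (⊤ : SimpleGraph (Fin n)) :=
  ⟨⟨φ, fun {_ _} hab => by simpa using h.ne hab.ne⟩, h⟩

open SimpleGraph in
/-- Copies of a graph in the complete graph are injective maps. -/
def copyEquiv (G : SimpleGraph V) (n : ℕ) :
    {φ : V → Fin n // Function.Injective φ} ≃ Copy G (⊤ : SimpleGraph (Fin n)) where
  toFun φ := copyOfInjective G φ.1 φ.2
  invFun f := ⟨f, f.injective⟩
  left_inv _ := rfl
  right_inv _ := rfl

open SimpleGraph in
instance (G : SimpleGraph V) [Finite V] : Finite (Copy G (⊤ : SimpleGraph (Fin n))) :=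
  Finite.of_equiv _ (copyEquiv G n)

open SimpleGraph in
/-- An isomorphism onto a subgraph as a copy. -/
def copyOfIso {G : SimpleGraph V} {S : (⊤ : SimpleGraph (Fin n)).Subgraph} (e : G ≃g S.coe) :
    Copy G (⊤ : SimpleGraph (Fin n)) :=
  ⟨S.hom.comp e.toHom, Subgraph.hom_injective.comp e.injective⟩

open SimpleGraph in
theorem toSubgraph_copyOfIso {G : SimpleGraph V} {S : (⊤ : SimpleGraph (Fin n)).Subgraph}
    (e : G ≃g S.coe) : (copyOfIso e).toSubgraph = S := by
  simp [copyOfIso, Copy.toSubgraph, Subgraph.map_comp]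

open Classical SimpleGraph in
-- A copy with image `S` that sends the root to `i` is an isomorphism onto `S` rooted at `i`; if one
-- exists, there are as many as automorphisms.
theorem card_copies (G : RootedGraph V) (S : (⊤ : SimpleGraph (Fin n)).Subgraph) (i : Fin n) :
    Nat.card {f : Copy G.graph (⊤ : SimpleGraph (Fin n)) // f G.root = i ∧ f.toSubgraph = S} =
      if ∃ hi : i ∈ S.verts, RootedGraph.IsIso ⟨S.coe, ⟨i, hi⟩⟩ G then G.aut else 0 := by
  split_ifs with h
  · obtain ⟨hi, h⟩ := h
    rw [← h.symm.card_iso_eq_aut]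
    symm
    refine Nat.card_eq_of_bijective (fun e : G.Iso ⟨S.coe, ⟨i, hi⟩⟩ =>
      ⟨copyOfIso e.1, congrArg Subtype.val e.2, toSubgraph_copyOfIso e.1⟩) ⟨?_, ?_⟩
    · intro e e' hee
      refine Iso.ext fun v => Subtype.ext ?_
      have := congrArg (fun f => f.1 v) hee
      exact this
    · rintro ⟨f, rfl, rfl⟩
      exact ⟨⟨f.isoToSubgraph, rfl⟩, rfl⟩
  · rw [Nat.card_eq_zero]
    left
    refine ⟨?_⟩
    rintro ⟨f, rfl, rfl⟩
    exact h ⟨⟨G.root, by simp, rfl⟩, RootedGraph.IsIso.symm ⟨f.isoToSubgraph, rfl⟩⟩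

open SimpleGraph in
theorem finprod_edges_toSubgraph {G : SimpleGraph V} (f : Copy G (⊤ : SimpleGraph (Fin n)))
    (w : Sym2 (Fin n) → ℝ) :
    ∏ᶠ e ∈ f.toSubgraph.edgeSet, w e = ∏ᶠ e ∈ G.edgeSet, w (e.map f) := by
  rw [Copy.toSubgraph, Subgraph.edgeSet_map, Subgraph.edgeSet_top]
  exact finprod_mem_image (Sym2.map.injective f.injective).injOn

open Classical SimpleGraph in
-- Group the maps by their image: every admissible subgraph arises from `aut` of them, and both
-- indicator and weight depend on the image only.
theorem aut_mul_colorfulCount [Fintype V] (M : Matrix (Fin n) (Fin n) ℝ) (μ : Fin n → Fin (N + 1))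
    {H : RootedGraph (Fin (N + 1))} {G : RootedGraph V} (hG : H.IsIso G) (i : Fin n) :
    (G.aut : ℝ) * colorfulCount M μ H i = ∑ φ : V → Fin n,
      if φ G.root = i then (if Function.Injective (fun v => μ (φ v)) then
        ∏ᶠ e ∈ G.graph.edgeSet, M (e.map φ).inf (e.map φ).sup else 0) else 0 := by
  have : Fintype (Copy G.graph (⊤ : SimpleGraph (Fin n))) := Fintype.ofFinite _
  -- Distinct colors force distinct vertices, so only injective maps, that is copies, contribute.
  have e1 : ∀ F : (V → Fin n) → ℝ, (∀ φ, ¬ Function.Injective φ → F φ = 0) →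
      ∑ φ, F φ = ∑ f : Copy G.graph (⊤ : SimpleGraph (Fin n)), F f := by
    intro F hF
    rw [← (copyEquiv G.graph n).sum_comp fun f => F f]
    rw [← Finset.sum_subset (Finset.subset_univ (Finset.univ.filter fun φ : V → Fin n =>
      Function.Injective φ)) fun φ _ h => hF φ (by simpa using h)]
    exact Finset.sum_subtype _ (by simp) F
  rw [e1 _ fun φ h => ?_, ← Finset.sum_fiberwise _ fun f => f.toSubgraph, colorfulCount,
    Finset.mul_sum]
  · refine Finset.sum_congr rfl fun S _ => ?_
    have e2 : ∀ f ∈ (Finset.univ.filter fun f : Copy G.graph (⊤ : SimpleGraph (Fin n)) =>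
        f.toSubgraph = S), (if f G.root = i then (if Function.Injective (fun v => μ (f v)) then
        ∏ᶠ e ∈ G.graph.edgeSet, M (e.map f).inf (e.map f).sup else 0) else 0) =
        if f G.root = i then (if Set.InjOn μ S.verts then 1 else 0) *
          ∏ e ∈ S.edgeSet.toFinset, M e.inf e.sup else 0 := by
      intro f hf
      rw [Finset.mem_filter] at hf
      obtain ⟨-, rfl⟩ := hf
      congr 1
      rw [← finprod_edges_toSubgraph f fun e => M e.inf e.sup,
        finprod_mem_eq_toFinset_prod]
      have : Set.InjOn μ f.toSubgraph.verts ↔ Function.Injective fun v => μ (f v) := by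
        have : f.toSubgraph.verts = Set.range f := by simp [Copy.toSubgraph]
        rw [this]
        constructor
        · intro h u v huv
          exact f.injective (h ⟨u, rfl⟩ ⟨v, rfl⟩ huv)
        · rintro h _ ⟨u, rfl⟩ _ ⟨v, rfl⟩ huv
          rw [h huv]
      simp only [this]
      split_ifs <;> simp
    rw [Finset.sum_congr rfl e2, ← Finset.sum_filter, Finset.sum_const, Finset.filter_filter]
    have e3 := card_copies G S i
    rw [Nat.card_eq_fintype_card, Fintype.card_subtype] at e3
    have e4 : (∃ hi : i ∈ S.verts, RootedGraph.IsIso ⟨S.coe, ⟨i, hi⟩⟩ G) ↔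
        ∃ hi : i ∈ S.verts, RootedGraph.IsIso ⟨S.coe, ⟨i, hi⟩⟩ H :=
      exists_congr fun hi => ⟨fun h => h.trans hG.symm, fun h => h.trans hG⟩
    simp only [e4] at e3
    simp only [and_comm] at e3 ⊢
    rw [e3]
    split_ifs <;> simp
  · have : ¬ Function.Injective fun v => μ (φ v) := fun h' => h fun u v huv =>
      h' (congrArg μ huv)
    simp [this]

/-- The recursion reads an edge from parent to child, the product from the smaller to the larger
end; symmetry of `M` reconciles the two. -/
theorem weight_eq_finprod {M : Matrix (Fin n) (Fin n) ℝ} (hM : ∀ x y, M x y = M y x) :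
    ∀ (t : PlaneTree) (φ : Vert t → Fin n),
      t.weight M φ = ∏ᶠ e ∈ t.toGraph.graph.edgeSet, M (e.map φ).inf (e.map φ).sup
  | .leaf, φ => by
    have : (PlaneTree.leaf.toGraph).graph.edgeSet = ∅ := SimpleGraph.edgeSet_bot
    rw [this, finprod_mem_empty]
    rfl
  | .join t c, φ => by
    have h1 := finprod_edges_joinGraph (G := t.toGraph) (H := c.toGraph)
      fun e => M (e.map φ).inf (e.map φ).sup
    refine Eq.trans ?_ h1.symm
    rw [PlaneTree.weight, weight_eq_finprod hM t, weight_eq_finprod hM c]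
    refine congrArg₂ (· * ·) ?_ (congrArg₂ (· * ·) (finprod_mem_congr rfl fun e _ => ?_)
      (finprod_mem_congr rfl fun e _ => ?_))
    · change _ = M (φ (Sum.inl t.toGraph.root) ⊓ φ (Sum.inr c.toGraph.root))
        (φ (Sum.inl t.toGraph.root) ⊔ φ (Sum.inr c.toGraph.root))
      rcases le_total (φ (Sum.inl t.toGraph.root)) (φ (Sum.inr c.toGraph.root)) with h | h
      · rw [inf_eq_left.2 h, sup_eq_right.2 h]
      · rw [inf_eq_right.2 h, sup_eq_left.2 h, hM]
    · induction e with
      | h u v => rfl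
    · induction e with
      | h u v => rfl

/-- There are as many vertices as colors, so distinct colors already use all of them and the
condition on the color set is automatic. -/
theorem treeCount_univ {M : Matrix (Fin n) (Fin n) ℝ} (hM : ∀ x y, M x y = M y x)
    (μ : Fin n → Fin (N + 1)) {t : PlaneTree} (ht : t.size = N + 1)
    {H : RootedGraph (Fin (N + 1))} (hH : H.IsIso t.toGraph) (i : Fin n) :
    treeCount M μ t i Finset.univ = t.toGraph.aut * colorfulCount M μ H i := by
  classical
  rw [aut_mul_colorfulCount M μ hH, treeCount]
  refine Finset.sum_congr rfl fun φ _ => ?_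
  rw [colorfulWeight, ← weight_eq_finprod hM]
  by_cases h : Function.Injective fun v => μ (φ v)
  · have : colorImage μ t φ = Finset.univ := by
      rw [← Finset.card_eq_iff_eq_univ, card_colorImage h, ht, Fintype.card_fin]
    rw [if_pos this]
  · simp [h]

theorem centered_symm (A : SimpleGraph (Fin n)) (q : ℝ) (x y : Fin n) :
    centered A q x y = centered A q y x := by
  by_cases h : A.Adj x y
  · simp [centered, h, h.symm]
  · have h' : ¬ A.Adj y x := fun h' => h h'.symm
    simp [centered, h, h']

end Copies

/-! # The output of the algorithm -/

section Output

variable {n N : ℕ}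

theorem val_factorialAndPower (b : ℕ) : ∀ k : ℕ,
    (factorialAndPower b k).val = (k.factorial, b ^ k)
  | 0 => rfl
  | k + 1 => by
    have e : (factorialAndPower b (k + 1)).val = ((factorialAndPower b k).val.1 * (k + 1),
      (factorialAndPower b k).val.2 * b) := rfl
    rw [e, val_factorialAndPower b k, Nat.factorial_succ, pow_succ, Nat.mul_comm (k + 1)]

theorem time_factorialAndPower (b : ℕ) : ∀ k : ℕ, (factorialAndPower b k).time = 4 * k + 1
  | 0 => rfl
  | k + 1 => by
    have e : (factorialAndPower b (k + 1)).time =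
      (factorialAndPower b k).time + (1 + (1 + (1 + 1))) := rfl
    rw [e, time_factorialAndPower b k]
    ring

theorem val_drawColoring (μ : Fin n → Fin (N + 1)) : (drawColoring μ).val = μ := by
  let body : (Fin n → Fin (N + 1)) → Fin n → Timed (Fin n → Fin (N + 1)) := fun c x => do
    let color ← step (μ x)
    step (Function.update c x color)
  have key : ∀ (l : List (Fin n)) (c : Fin n → Fin (N + 1)) (x : Fin n),
      (loop body l c).val x = if x ∈ l then μ x else c x := by
    intro l
    induction l with
    | nil => simp [val_loop_nil]
    | cons a l ih =>
      intro c x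
      have hb : (body c a).val = Function.update c a (μ a) := rfl
      rw [val_loop_cons, ih, hb]
      by_cases h1 : x ∈ l
      · simp [h1]
      · by_cases h2 : x = a
        · subst h2
          simp
        · simp [h1, h2]
  ext x
  have e : (drawColoring μ).val = (loop body (List.finRange n) (fun _ => 0)).val := rfl
  rw [e, key, if_pos (List.mem_finRange x)]

/-- The algorithm takes the ceiling of `1 / r` in natural numbers, as a rounded-up quotient of the
power by the factorial. -/
theorem ceil_div_eq_numColorings (N : ℕ) :
    ((N + 1) ^ (N + 1) + (N + 1).factorial - 1) / (N + 1).factorial = numColorings N := by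
  have h := Nat.factorial_pos (N + 1)
  rw [← Nat.ceilDiv_eq_add_pred_div, numColorings, colorfulProb, one_div_div]
  refine eq_of_forall_ge_iff fun k => ?_
  rw [ceilDiv_le_iff_le_mul h, Nat.ceil_le, div_le_iff₀ (by exact_mod_cast h), mul_comm (k : ℝ)]
  exact_mod_cast Iff.rfl

/-- A chandelier with its number of automorphisms, and the sums of the colorful counts over the
colorings, for both graphs. -/
abbrev Record (n : ℕ) : Type := (PlaneTree × ℕ) × (Fin n → ℝ) × (Fin n → ℝ)

/-- Draw `t` pairs of colorings. -/
def drawColorings (μ ν : ℕ → Fin n → Fin (N + 1)) (t : ℕ) :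
    Timed (List ((Fin n → Fin (N + 1)) × (Fin n → Fin (N + 1)))) :=
  mapList (fun a => do
    let c ← drawColoring (μ a)
    let d ← drawColoring (ν a)
    step (c, d)) (List.range t)

/-- Records with vanishing sums. -/
def initialRecords (n : ℕ) (T : List (PlaneTree × ℕ)) : Timed (List (Record n)) :=
  mapList (fun H : PlaneTree × ℕ =>
    steps (2 * n) (H, ((fun _ => 0 : Fin n → ℝ), (fun _ => 0 : Fin n → ℝ)))) T

/-- Add to a record the colorful counts for a pair of colorings. -/
noncomputable def addToRecord (MA MB : Matrix (Fin n) (Fin n) ℝ) (S : SplitTable N)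
    (c : (Fin n → Fin (N + 1)) × (Fin n → Fin (N + 1))) (rec : Record n) : Timed (Record n) := do
  let XA ← addCounts MA S c.1 rec.1.1 rec.1.2 rec.2.1
  let XB ← addCounts MB S c.2 rec.1.1 rec.1.2 rec.2.2
  step (rec.1, XA, XB)

/-- Add to all records the colorful counts for all pairs of colorings. -/
noncomputable def addToRecords (MA MB : Matrix (Fin n) (Fin n) ℝ) (S : SplitTable N)
    (colorings : List ((Fin n → Fin (N + 1)) × (Fin n → Fin (N + 1))))
    (records : List (Record n)) : Timed (List (Record n)) :=
  loop (fun records c => mapList (addToRecord MA MB S c) records) colorings records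

/-- The sum of the contributions of the records to the scores. -/
noncomputable def sumRecords (t' : ℝ) (records : List (Record n)) (Φ : Fin n → Fin n → ℝ) :
    Timed (Fin n → Fin n → ℝ) :=
  loop (fun (Φ : Fin n → Fin n → ℝ) (rec : Record n) => do
    let a ← step (rec.1.2 : ℝ)
    loop (fun (Φ : Fin n → Fin n → ℝ) i => do
      let x ← step (rec.2.1 i)
      let x ← step (x / t')
      let ax ← step (a * x)
      loop (fun (Φ : Fin n → Fin n → ℝ) j => do
        let y ← step (rec.2.2 j)
        let y ← step (y / t')
        let axy ← step (ax * y)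
        let old ← step (Φ i j)
        let new ← step (old + axy)
        step (Function.update Φ i (Function.update (Φ i) j new))) (List.finRange n) Φ)
      (List.finRange n) Φ) records Φ

/-- Divide all entries of a matrix by a number. -/
noncomputable def divideScores (rr : ℝ) (Φ : Fin n → Fin n → ℝ) : Timed (Fin n → Fin n → ℝ) :=
  loop (fun (Φ : Fin n → Fin n → ℝ) i =>
    loop (fun (Φ : Fin n → Fin n → ℝ) j => do
      let old ← step (Φ i j)
      let new ← step (old / rr)
      step (Function.update Φ i (Function.update (Φ i) j new))) (List.finRange n) Φ)
    (List.finRange n) Φ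

/-- Names the blocks of the algorithm, so that their values and costs can be treated separately. -/
theorem approxScores_eq (K L M N R : ℕ) (MA MB : Matrix (Fin n) (Fin n) ℝ)
    (μ ν : ℕ → Fin n → Fin (N + 1)) :
    approxScores K L M N R MA MB μ ν = (do
      let J ← listBulbs K R
      let T ← listChandeliers L M J
      let fp ← factorialAndPower (N + 1) (N + 1)
      let r ← step ((fp.1 : ℝ) / (fp.2 : ℝ))
      let t ← steps 3 ((fp.2 + fp.1 - 1) / fp.1)
      let colorings ← drawColorings μ ν t
      let S ← buildSplits N
      let records ← initialRecords n T
      let records ← addToRecords MA MB S colorings records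
      let t' ← step (t : ℝ)
      let Φ ← steps (n ^ 2) (fun _ _ => 0)
      let Φ ← sumRecords t' records Φ
      let rr ← step (r * r)
      divideScores rr Φ) := rfl

theorem val_drawColorings (μ ν : ℕ → Fin n → Fin (N + 1)) (t : ℕ) :
    (drawColorings μ ν t).val = (List.range t).map fun a => (μ a, ν a) := by
  rw [drawColorings, val_mapList]
  refine List.map_congr_left fun a _ => ?_
  simp only [val_bind, val_step, val_drawColoring]

theorem val_addToRecords (MA MB : Matrix (Fin n) (Fin n) ℝ) {S : SplitTable N}
    (hS : ∀ a b, (S a b).Nodup ∧ ∀ C, C ∈ S a b ↔ Disjoint C.1 C.2 ∧ C.1.card = a ∧ C.2.card = b)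
    (colorings : List ((Fin n → Fin (N + 1)) × (Fin n → Fin (N + 1))))
    (records : List (Record n)) :
    (addToRecords MA MB S colorings records).val = records.map fun rec => (rec.1,
      (fun i => rec.2.1 i + (colorings.map fun c =>
        treeCount MA c.1 rec.1.1 i Finset.univ / (rec.1.2 : ℝ)).sum),
      (fun i => rec.2.2 i + (colorings.map fun c =>
        treeCount MB c.2 rec.1.1 i Finset.univ / (rec.1.2 : ℝ)).sum)) := by
  induction colorings generalizing records with
  | nil => simp [addToRecords, val_loop_nil]
  | cons c colorings ih =>
    have e : (addToRecords MA MB S (c :: colorings) records).val =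
      (addToRecords MA MB S colorings (mapList (addToRecord MA MB S c) records).val).val := rfl
    rw [e, ih, val_mapList, List.map_map]
    refine List.map_congr_left fun rec _ => ?_
    have e2 : (addToRecord MA MB S c rec).val = (rec.1,
        (addCounts MA S c.1 rec.1.1 rec.1.2 rec.2.1).val,
        (addCounts MB S c.2 rec.1.1 rec.1.2 rec.2.2).val) := rfl
    simp only [Function.comp_apply, e2, val_addCounts _ hS, List.map_cons, List.sum_cons,
      add_assoc]

theorem val_sumRecords (t' : ℝ) (records : List (Record n)) (Φ : Fin n → Fin n → ℝ) (i j : Fin n) :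
    (sumRecords t' records Φ).val i j = Φ i j + (records.map fun rec =>
      (rec.1.2 : ℝ) * (rec.2.1 i / t') * (rec.2.2 j / t')).sum := by
  induction records generalizing Φ with
  | nil => simp [sumRecords, val_loop_nil]
  | cons rec records ih =>
    let g (i j : Fin n) : Fin n → Fin n → ℝ :=
      Pi.single i (Pi.single j ((rec.1.2 : ℝ) * (rec.2.1 i / t') * (rec.2.2 j / t')))
    have e : (sumRecords t' (rec :: records) Φ).val =
        (sumRecords t' records (Φ + ∑ i, ∑ j, g i j)).val := by
      rw [sumRecords, val_loop_cons, val_bind, val_step]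
      rw [val_loop_add (fun i => ∑ j, g i j), sum_map_finRange]
      · rfl
      intro Φ i
      simp only [val_bind, val_step]
      rw [val_loop_add (fun j => g i j), sum_map_finRange]
      intro Φ j
      exact update_update_eq_add_single _ _ _ _
    rw [e, ih, List.map_cons, List.sum_cons, ← add_assoc]
    congr 1
    rw [Pi.add_apply, Pi.add_apply]
    congr 1
    rw [Finset.sum_apply, Finset.sum_apply, Finset.sum_eq_single i]
    · rw [Finset.sum_apply, Finset.sum_apply, Finset.sum_eq_single j]
      · simp [g]
      · intro j' _ hj
        simp [g, hj.symm]
      · simp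
    · intro i' _ hi
      rw [Finset.sum_apply, Finset.sum_apply]
      refine Finset.sum_eq_zero fun j _ => ?_
      simp [g, hi.symm]
    · simp

theorem val_divideScores (rr : ℝ) (Φ : Fin n → Fin n → ℝ) (i j : Fin n) :
    (divideScores rr Φ).val i j = Φ i j / rr := by
  let row (Φ : Fin n → Fin n → ℝ) (i : Fin n) : Timed (Fin n → Fin n → ℝ) :=
    loop (fun (Φ : Fin n → Fin n → ℝ) j => do
      let old ← step (Φ i j)
      let new ← step (old / rr)
      step (Function.update Φ i (Function.update (Φ i) j new))) (List.finRange n) Φ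
  have h1 : ∀ (l : List (Fin n)) (hl : l.Nodup) (Φ : Fin n → Fin n → ℝ) (i i' j : Fin n),
      (loop (fun (Φ : Fin n → Fin n → ℝ) j => (do
        let old ← step (Φ i j)
        let new ← step (old / rr)
        step (Function.update Φ i (Function.update (Φ i) j new)))) l Φ).val i' j =
      if i' = i ∧ j ∈ l then Φ i' j / rr else Φ i' j := by
    intro l hl
    induction l with
    | nil => simp [val_loop_nil]
    | cons a l ih =>
      intro Φ i i' j
      obtain ⟨h1, h2⟩ := List.nodup_cons.1 hl
      rw [val_loop_cons, ih h2]
      simp only [val_bind, val_step]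
      by_cases hi : i' = i
      · subst hi
        by_cases hj : j = a
        · subst hj
          simp [h1]
        · simp [hj]
      · simp [hi]
  have h2 : ∀ (Φ : Fin n → Fin n → ℝ) (i i' j : Fin n),
      (row Φ i).val i' j = if i' = i then Φ i' j / rr else Φ i' j := by
    intro Φ i i' j
    simp only [row]
    rw [h1 _ (List.nodup_finRange n)]
    simp
  have h3 : ∀ (l : List (Fin n)) (hl : l.Nodup) (Φ : Fin n → Fin n → ℝ) (i j : Fin n),
      (loop row l Φ).val i j = if i ∈ l then Φ i j / rr else Φ i j := by
    intro l hl
    induction l with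
    | nil => simp [val_loop_nil]
    | cons a l ih =>
      intro Φ i j
      obtain ⟨h4, h5⟩ := List.nodup_cons.1 hl
      rw [val_loop_cons, ih h5, h2]
      by_cases hi : i = a
      · subst hi
        simp [h4]
      · simp [hi]
  have e : (divideScores rr Φ).val = (loop row (List.finRange n) Φ).val := rfl
  rw [e, h3 _ (List.nodup_finRange n), if_pos (List.mem_finRange i)]

theorem val_approxScores {K L M N R : ℕ} (hM : 0 < M) (hN : N = (K + M) * L)
    {MA MB : Matrix (Fin n) (Fin n) ℝ} (hA : ∀ x y, MA x y = MA y x)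
    (hB : ∀ x y, MB x y = MB y x) (μ ν : ℕ → Fin n → Fin (N + 1)) :
    (approxScores K L M N R MA MB μ ν).val = approxScore L M K R MA MB μ ν := by
  classical
  have hS := (buildSplits_spec N).1
  ext i j
  rw [approxScores_eq]
  simp only [val_bind, val_step, val_steps, val_divideScores, val_sumRecords,
    val_addToRecords _ _ hS, val_factorialAndPower, val_drawColorings, ceil_div_eq_numColorings,
    initialRecords, val_mapList, List.map_map, zero_add]
  rw [approxScore, div_eq_inv_mul, one_div]
  congr 1
  · rw [colorfulProb, sq]
    push_cast
    rfl
  · have e1 : (Set.toFinite (chandeliers L M K R N)).toFinset =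
        ((allChandeliers L M K R).map fun p => p.1.toUnlabeled N).toFinset := by
      ext c
      rw [Set.Finite.mem_toFinset, mem_chandeliers_iff hM hN, List.mem_toFinset]
    -- The sum over isomorphism classes becomes a sum over the list, because the list represents
    -- each class once.
    rw [e1, List.sum_toFinset _ (nodup_allChandeliers hM hN), List.map_map]
    change ((allChandeliers L M K R).map _).sum = _
    congr 1
    refine List.map_congr_left fun p hp => ?_
    obtain ⟨h1, h2⟩ := size_and_aut_of_mem_allChandeliers hM hN hp
    have h3 := isIso_toUnlabeled_out h1
    -- Cancels the factor `aut(H)` in `treeCount_univ` against the division in `addCounts`.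
    have h4 : ((p.1.toGraph.aut : ℕ) : ℝ) ≠ 0 := by
      have := aut_pos p.1.toGraph
      exact_mod_cast this.ne'
    simp only [Function.comp_apply, treeCount_univ hA _ h1 h3.symm,
      treeCount_univ hB _ h1 h3.symm, h2, mul_div_cancel_left₀ _ h4]
    have e2 : ∀ f : ℕ → ℝ, ((List.range (numColorings N)).map f).sum =
        ∑ a ∈ Finset.range (numColorings N), f a := fun f => rfl
    rw [← h3.aut_eq, ← e2, ← e2, one_div_mul_eq_div, one_div_mul_eq_div, zero_add,
      zero_add]
    rfl

end Output

/-! # The number of rooted trees -/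

section Otter

theorem ncard_canonTrees_pos (K : ℕ) : 0 < (canonTrees K).ncard := by
  rw [Set.ncard_pos (finite_canonTrees K)]
  induction K with
  | zero => exact ⟨.leaf, trivial, rfl⟩
  | succ K ih =>
    obtain ⟨t, h1, h2⟩ := ih
    exact ⟨.join .leaf t, ⟨trivial, h1, by simp [lastChild]⟩, by simp [PlaneTree.size, h2]; omega⟩

theorem ncard_canonTrees_le_succ (K : ℕ) :
    (canonTrees K).ncard ≤ (canonTrees (K + 1)).ncard := by
  refine Set.ncard_le_ncard_of_injOn (fun t => .join .leaf t) ?_ ?_ (finite_canonTrees _)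
  · rintro t ⟨h1, h2⟩
    exact ⟨⟨trivial, h1, by simp [lastChild]⟩, by simp [PlaneTree.size, h2]; omega⟩
  · intro s _ t _ h
    simpa using h

/-- The tree whose root has the two given subtrees, in canonical order. -/
def pairTree (p : PlaneTree × PlaneTree) : PlaneTree :=
  if lev 0 p.2 ≤ lev 0 p.1 then .join (.join .leaf p.1) p.2 else .join (.join .leaf p.2) p.1

theorem pairTree_eq {p p' : PlaneTree × PlaneTree} (h : pairTree p' = pairTree p) :
    p' = p ∨ p' = p.swap := by
  obtain ⟨s, t⟩ := p
  obtain ⟨s', t'⟩ := p'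
  unfold pairTree at h
  split_ifs at h <;> simp at h <;> simp [h]

/-- Hang both trees from a new root, which adds two edges. The order of the children is lost, so
each tree arises from at most two pairs. -/
theorem ncard_canonTrees_mul_le (i j : ℕ) :
    (canonTrees i).ncard * (canonTrees j).ncard ≤ 2 * (canonTrees (i + j + 2)).ncard := by
  classical
  have fi := finite_canonTrees i
  have fj := finite_canonTrees j
  have fk := finite_canonTrees (i + j + 2)
  rw [Set.ncard_eq_toFinset_card _ fi, Set.ncard_eq_toFinset_card _ fj,
    Set.ncard_eq_toFinset_card _ fk, ← Finset.card_product]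
  refine (Finset.card_le_mul_card_image (f := pairTree) _ 2 fun a ha => ?_).trans
    (Nat.mul_le_mul_left 2 (Finset.card_le_card ?_))
  · obtain ⟨p, -, rfl⟩ := Finset.mem_image.1 ha
    refine (Finset.card_le_card (t := {p, p.swap}) fun p' hp' => ?_).trans Finset.card_le_two
    have := pairTree_eq (Finset.mem_filter.1 hp').2
    simpa using this
  · intro a ha
    obtain ⟨⟨s, t⟩, h, rfl⟩ := Finset.mem_image.1 ha
    simp only [Finset.mem_product, Set.Finite.mem_toFinset] at h
    obtain ⟨⟨h1, h2⟩, ⟨h3, h4⟩⟩ := h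
    rw [Set.Finite.mem_toFinset]
    unfold pairTree
    split_ifs with h5
    · exact ⟨⟨⟨trivial, h1, by simp [lastChild]⟩, h3, by simpa [lastChild] using h5⟩,
        by simp [PlaneTree.size, h2, h4]; omega⟩
    · exact ⟨⟨⟨trivial, h3, by simp [lastChild]⟩, h1, by simpa [lastChild] using (not_le.1 h5).le⟩,
        by simp [PlaneTree.size, h2, h4]; omega⟩

/-- The logarithm of `2 / |J(n - 2)|`. -/
noncomputable def logTwoDiv (n : ℕ) : ℝ := Real.log 2 - Real.log ((canonTrees (n - 2)).ncard : ℝ)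

theorem one_le_ncard_canonTrees (K : ℕ) : (1 : ℝ) ≤ ((canonTrees K).ncard : ℝ) := by
  exact_mod_cast ncard_canonTrees_pos K

/-- The shift by `2` in the index and the factor `2` in the logarithm turn `ncard_canonTrees_mul_le`
into exact subadditivity. -/
theorem subadditive_logTwoDiv : Subadditive logTwoDiv := by
  have mono : Monotone fun K => (canonTrees K).ncard :=
    monotone_nat_of_le_succ ncard_canonTrees_le_succ
  have key : ∀ m n, ((canonTrees (m - 2)).ncard : ℝ) * (canonTrees (n - 2)).ncard ≤
      2 * (canonTrees (m + n - 2)).ncard := by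
    intro m n
    -- For `m < 2` the truncated difference is `0`; there is only one tree without edges, and
    -- monotonicity suffices.
    rcases Nat.lt_or_ge m 2 with hm | hm
    · have h0 : (canonTrees (m - 2)).ncard ≤ 1 := by
        rw [show m - 2 = 0 by omega]
        exact ncard_canonTrees_le 0
      have h1 : (canonTrees (n - 2)).ncard ≤ (canonTrees (m + n - 2)).ncard := mono (by omega)
      have h2 := Nat.mul_le_mul h0 h1
      exact_mod_cast h2.trans (by omega)
    rcases Nat.lt_or_ge n 2 with hn | hn
    · have h0 : (canonTrees (n - 2)).ncard ≤ 1 := by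
        rw [show n - 2 = 0 by omega]
        exact ncard_canonTrees_le 0
      have h1 : (canonTrees (m - 2)).ncard ≤ (canonTrees (m + n - 2)).ncard := mono (by omega)
      have h2 := Nat.mul_le_mul h1 h0
      exact_mod_cast h2.trans (by omega)
    have := ncard_canonTrees_mul_le (m - 2) (n - 2)
    rw [show m - 2 + (n - 2) + 2 = m + n - 2 by omega] at this
    exact_mod_cast this
  intro m n
  have hm := one_le_ncard_canonTrees (m - 2)
  have hn := one_le_ncard_canonTrees (n - 2)
  have hmn := one_le_ncard_canonTrees (m + n - 2)
  have h := Real.log_le_log (by positivity) (key m n)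
  rw [Real.log_mul (by positivity) (by positivity), Real.log_mul (by positivity) (by positivity)]
    at h
  unfold logTwoDiv
  linarith

theorem bddBelow_logTwoDiv : BddBelow (Set.range fun n => logTwoDiv n / n) := by
  refine ⟨-Real.log 4, ?_⟩
  rintro _ ⟨n, rfl⟩
  rcases Nat.eq_zero_or_pos n with rfl | hn
  · simp only [Nat.cast_zero, div_zero, Left.neg_nonpos_iff]
    positivity
  have hn' : (0 : ℝ) < n := by exact_mod_cast hn
  dsimp only
  rw [le_div_iff₀ hn', logTwoDiv]
  have h1 : ((canonTrees (n - 2)).ncard : ℝ) ≤ 4 ^ n := by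
    exact_mod_cast (ncard_canonTrees_le (n - 2)).trans
      (Nat.pow_le_pow_right (by norm_num) (Nat.sub_le n 2))
  have h2 := Real.log_le_log (by linarith [one_le_ncard_canonTrees (n - 2)]) h1
  rw [Real.log_pow] at h2
  have := Real.log_nonneg (by norm_num : (1 : ℝ) ≤ 2)
  linarith

/-- Otter's constant. -/
noncomputable def otterConstant : ℝ := Real.exp subadditive_logTwoDiv.lim

theorem otterConstant_pos : 0 < otterConstant := Real.exp_pos _

/-- There is at least one tree of each size, so `logTwoDiv n / n` is at most `log 2 / n`, which
tends to `0`. -/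
theorem otterConstant_le_one : otterConstant ≤ 1 := by
  rw [otterConstant, Real.exp_le_one_iff]
  refine ge_of_tendsto (tendsto_const_div_atTop_nhds_zero_nat (Real.log 2)) ?_
  filter_upwards [eventually_ne_atTop 0] with n hn
  refine (subadditive_logTwoDiv.lim_le_div bddBelow_logTwoDiv hn).trans ?_
  have h := Real.log_nonneg (one_le_ncard_canonTrees (n - 2))
  refine div_le_div_of_nonneg_right ?_ (Nat.cast_nonneg n)
  rw [logTwoDiv]
  linarith

/-- In Fekete's lemma the limit is a lower bound for every quotient. This is stronger than the
asymptotics: the loss is a constant factor for every `K`. -/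
theorem ncard_canonTrees_le_mul_pow (K : ℕ) :
    ((canonTrees K).ncard : ℝ) ≤ 2 / otterConstant ^ 2 * (1 / otterConstant) ^ K := by
  have h := subadditive_logTwoDiv.lim_le_div bddBelow_logTwoDiv (n := K + 2) (by omega)
  rw [le_div_iff₀ (by positivity), logTwoDiv, Nat.add_sub_cancel] at h
  have h1 := one_le_ncard_canonTrees K
  have h2 : Real.log (canonTrees K).ncard ≤
      Real.log 2 - subadditive_logTwoDiv.lim * ((K + 2 : ℕ) : ℝ) := by linarith
  rw [Real.log_le_iff_le_exp (by linarith), Real.exp_sub, Real.exp_log (by norm_num), mul_comm,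
    Real.exp_nat_mul] at h2
  refine h2.trans (le_of_eq ?_)
  change 2 / otterConstant ^ (K + 2) = _
  have := otterConstant_pos
  rw [pow_add, one_div, inv_pow]
  field_simp

/-- The logarithm of the `K`-th root is `log 2 / K` minus `logTwoDiv (K + 2) / (K + 2)` times `(K +
2) / K`; the last ratio tends to `1`, so the shift does not affect the limit. -/
theorem isOtterConstant_otterConstant : IsOtterConstant otterConstant := by
  refine ⟨otterConstant_pos, ?_⟩
  have h1 := (subadditive_logTwoDiv.tendsto_lim bddBelow_logTwoDiv).comp (tendsto_add_atTop_nat 2)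
  have h2 : Tendsto (fun K : ℕ => ((K + 2 : ℕ) : ℝ) / K) atTop (𝓝 1) := by
    have : Tendsto (fun K : ℕ => 1 + (2 : ℝ) / K) atTop (𝓝 (1 + 0)) :=
      tendsto_const_nhds.add (tendsto_const_div_atTop_nhds_zero_nat 2)
    rw [add_zero] at this
    refine this.congr' ?_
    filter_upwards [eventually_ne_atTop 0] with K hK
    have : (K : ℝ) ≠ 0 := by exact_mod_cast hK
    push_cast
    field_simp
  have h3 := (tendsto_const_div_atTop_nhds_zero_nat (Real.log 2)).sub (h1.mul h2)
  have h4 := (Real.continuous_exp.tendsto _).comp h3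
  have e : Real.exp (0 - subadditive_logTwoDiv.lim * 1) = otterConstant⁻¹ := by
    rw [otterConstant, ← Real.exp_neg]
    ring_nf
  rw [e] at h4
  refine h4.congr' ?_
  filter_upwards [eventually_ne_atTop 0] with K hK
  have hK' : (K : ℝ) ≠ 0 := by exact_mod_cast hK
  have hK2 : ((K + 2 : ℕ) : ℝ) ≠ 0 := by positivity
  have h5 := one_le_ncard_canonTrees K
  rw [ncard_rootedTrees, Real.rpow_def_of_pos (by linarith)]
  simp only [Function.comp_apply, logTwoDiv, Nat.add_sub_cancel]
  congr 1
  field_simp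
  ring

end Otter

/-! # The running time of the dynamic programming -/

section Time

variable {n N : ℕ}

theorem time_leafTable_le (μ : Fin n → Fin (N + 1)) :
    (leafTable (F := ℝ) μ).time ≤ n * 2 ^ (N + 1) + (n * 4 + 1) := by
  have h := time_loop_le (body := fun (Y : ColorTable ℝ n N) x => (do
    let c ← step (μ x)
    let C ← step {c}
    Y.write x C 1)) 3 (List.finRange n) (fun _ _ => 0) (fun _ _ _ => le_rfl)
  rw [List.length_finRange] at h
  exact Nat.add_le_add_left h _

theorem time_joinTable_le (M : Matrix (Fin n) (Fin n) ℝ)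
    (splits : List (ColorSet N × ColorSet N)) (Yt Yc : ColorTable ℝ n N) :
    (joinTable M splits Yt Yc).time ≤
      n * 2 ^ (N + 1) + (splits.length * (n * (n * 9 + 2) + 3) + 1) := by
  refine Nat.add_le_add_left (time_loop_le (n * (n * 9 + 2) + 2) splits _ fun Y C _ => ?_) _
  have h := time_loop_le (body := fun (Y : ColorTable ℝ n N) x =>
      loop (fun (Y : ColorTable ℝ n N) y => do
        let m ← step (M x y)
        let u ← step (Yt x C.1)
        let v ← step (Yc y C.2)
        let old ← step (Y x (C.1 ∪ C.2))
        let mu ← step (m * u)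
        let muv ← step (mu * v)
        let new ← step (old + muv)
        Y.write x (C.1 ∪ C.2) new) (List.finRange n) Y) (n * 9 + 1) (List.finRange n) Y
      fun Y x _ => by
        have h := time_loop_le (body := fun (Y : ColorTable ℝ n N) y => (do
          let m ← step (M x y)
          let u ← step (Yt x C.1)
          let v ← step (Yc y C.2)
          let old ← step (Y x (C.1 ∪ C.2))
          let mu ← step (m * u)
          let muv ← step (mu * v)
          let new ← step (old + muv)
          Y.write x (C.1 ∪ C.2) new)) 8 (List.finRange n) Y (fun _ _ _ => le_rfl)
        rwa [List.length_finRange] at h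
  rw [List.length_finRange] at h
  rw [time_bind, time_step, Nat.add_comm]
  exact Nat.add_le_add_right h 1

/-- A bound for the number of steps that the computation takes per vertex of the tree, if every
pair of sizes has at most `s` pairs of disjoint sets of colors. -/
def vertexCost (n N s : ℕ) : ℕ := n * 2 ^ (N + 1) + s * (n * (n * 9 + 2) + 3) + 4 * n + 4

/-- A plane tree with `v` vertices consists of `v` leaves and `v - 1` joins, so `2 v - 1` tables are
computed. -/
theorem time_treeTable_le (M : Matrix (Fin n) (Fin n) ℝ) {S : SplitTable N} {s : ℕ}
    (hS : ∀ a b, (S a b).length ≤ s) (μ : Fin n → Fin (N + 1)) : ∀ t : PlaneTree,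
      (treeTable M S μ t).time + vertexCost n N s ≤ 2 * t.size * vertexCost n N s
  | .leaf => by
    have e : (treeTable M S μ .leaf).time = (leafTable (F := ℝ) μ).time + 1 := rfl
    have h := time_leafTable_le (N := N) μ
    have hs : PlaneTree.leaf.size = 1 := rfl
    rw [e, hs]
    have : (leafTable (F := ℝ) μ).time + 1 ≤ vertexCost n N s := by
      unfold vertexCost
      omega
    omega
  | .join t c => by
    have h1 := time_treeTable_le M hS μ t
    have h2 := time_treeTable_le M hS μ c
    let a := (treeTable M S μ t).val.1
    let b := (treeTable M S μ c).val.1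
    have e : (treeTable M S μ (.join t c)).time = (treeTable M S μ t).time +
      ((treeTable M S μ c).time + (1 + ((joinTable M (S a b) (treeTable M S μ t).val.2
        (treeTable M S μ c).val.2).time + (1 + 1)))) := rfl
    have h3 := time_joinTable_le M (S a b) (treeTable M S μ t).val.2 (treeTable M S μ c).val.2
    have h4 := Nat.mul_le_mul_right (n * (n * 9 + 2) + 3) (hS a b)
    have h5 : (joinTable M (S a b) (treeTable M S μ t).val.2
        (treeTable M S μ c).val.2).time + 3 ≤ vertexCost n N s := by
      unfold vertexCost
      omega
    have hs : (PlaneTree.join t c).size = t.size + c.size := rfl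
    rw [e, hs, Nat.mul_add, Nat.add_mul]
    omega

theorem time_addCounts_le (M : Matrix (Fin n) (Fin n) ℝ) {S : SplitTable N} {s : ℕ}
    (hS : ∀ a b, (S a b).length ≤ s) (μ : Fin n → Fin (N + 1)) (t : PlaneTree) (k : ℕ)
    (acc : Fin n → ℝ) :
    (addCounts M S μ t k acc).time ≤ 2 * t.size * vertexCost n N s + 2 * n := by
  have e : (addCounts M S μ t k acc).time = (treeTable M S μ t).time + (1 + (1 +
    (loop (fun (acc : Fin n → ℝ) i => (do
      let y ← step ((treeTable M S μ t).val.2 i Finset.univ)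
      let x ← step (y / (k : ℝ))
      let old ← step (acc i)
      let new ← step (old + x)
      step (Function.update acc i new))) (List.finRange n) acc).time)) := rfl
  have h1 := time_treeTable_le M hS μ t
  have h2 := time_loop_le (body := fun (acc : Fin n → ℝ) i => (do
      let y ← step ((treeTable M S μ t).val.2 i Finset.univ)
      let x ← step (y / (k : ℝ))
      let old ← step (acc i)
      let new ← step (old + x)
      step (Function.update acc i new))) 5 (List.finRange n) acc (fun _ _ _ => le_rfl)
  rw [List.length_finRange] at h2
  have h3 : 4 * n + 4 ≤ vertexCost n N s := by
    unfold vertexCost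
    omega
  omega

theorem time_drawColoring_le (μ : Fin n → Fin (N + 1)) : (drawColoring μ).time ≤ n * 3 + 1 := by
  have h := time_loop_le (body := fun (c : Fin n → Fin (N + 1)) x => (do
    let color ← step (μ x)
    step (Function.update c x color))) 2 (List.finRange n) (fun _ => 0) (fun _ _ _ => le_rfl)
  rwa [List.length_finRange] at h

theorem time_drawColorings_le (μ ν : ℕ → Fin n → Fin (N + 1)) (t : ℕ) :
    (drawColorings μ ν t).time ≤ t * (6 * n + 5) + 1 := by
  have h := time_mapList_le (f := fun a => (do
    let c ← drawColoring (μ a)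
    let d ← drawColoring (ν a)
    step (c, d))) (6 * n + 3) (List.range t) fun a _ => by
      have h1 := time_drawColoring_le (μ a)
      have h2 := time_drawColoring_le (ν a)
      simp only [time_bind, time_step]
      omega
  rwa [List.length_range] at h

theorem time_addToRecords_le (MA MB : Matrix (Fin n) (Fin n) ℝ) {S : SplitTable N} {s : ℕ}
    (hS : ∀ a b, (S a b).length ≤ s)
    (colorings : List ((Fin n → Fin (N + 1)) × (Fin n → Fin (N + 1)))) :
    ∀ records : List (Record n), (∀ rec ∈ records, rec.1.1.size = N + 1) →
      (addToRecords MA MB S colorings records).time ≤ colorings.length *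
        (records.length * (4 * (N + 1) * vertexCost n N s + 4 * n + 3) + 2) + 1 := by
  induction colorings with
  | nil =>
    intro records _
    simp [addToRecords, loop]
  | cons c colorings ih =>
    intro records hr
    have e : (addToRecords MA MB S (c :: colorings) records).time = 1 +
      ((mapList (addToRecord MA MB S c) records).time +
      (addToRecords MA MB S colorings (mapList (addToRecord MA MB S c) records).val).time) := rfl
    have h1 : (mapList (addToRecord MA MB S c) records).time ≤
        records.length * (4 * (N + 1) * vertexCost n N s + 4 * n + 3) + 1 := time_mapList_le
      (4 * (N + 1) * vertexCost n N s + 4 * n + 1) records fun rec hrec => by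
        have h1 := time_addCounts_le MA hS c.1 rec.1.1 rec.1.2 rec.2.1
        have h2 := time_addCounts_le MB hS c.2 rec.1.1 rec.1.2 rec.2.2
        rw [hr rec hrec] at h1 h2
        have e2 : (addToRecord MA MB S c rec).time =
          (addCounts MA S c.1 rec.1.1 rec.1.2 rec.2.1).time +
          ((addCounts MB S c.2 rec.1.1 rec.1.2 rec.2.2).time + 1) := rfl
        rw [e2, show 4 * (N + 1) * vertexCost n N s = 2 * (N + 1) * vertexCost n N s +
          2 * (N + 1) * vertexCost n N s by ring]
        omega
    have h2 := ih (mapList (addToRecord MA MB S c) records).val fun rec hrec => by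
      rw [val_mapList, List.mem_map] at hrec
      obtain ⟨rec', h, rfl⟩ := hrec
      exact hr rec' h
    rw [val_mapList, List.length_map, ← val_mapList] at h2
    rw [e, List.length_cons, Nat.add_mul, Nat.one_mul]
    omega

theorem time_sumRecords_le (t' : ℝ) (records : List (Record n)) (Φ : Fin n → Fin n → ℝ) :
    (sumRecords t' records Φ).time ≤ records.length * (n * (n * 7 + 5) + 3) + 1 := by
  refine time_loop_le (n * (n * 7 + 5) + 2) records Φ fun Φ rec _ => ?_
  have h := time_loop_le (body := fun (Φ : Fin n → Fin n → ℝ) i => (do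
      let x ← step (rec.2.1 i)
      let x ← step (x / t')
      let ax ← step ((rec.1.2 : ℝ) * x)
      loop (fun (Φ : Fin n → Fin n → ℝ) j => do
        let y ← step (rec.2.2 j)
        let y ← step (y / t')
        let axy ← step (ax * y)
        let old ← step (Φ i j)
        let new ← step (old + axy)
        step (Function.update Φ i (Function.update (Φ i) j new))) (List.finRange n) Φ))
    (n * 7 + 4) (List.finRange n) Φ fun Φ i _ => by
      have h := time_loop_le (body := fun (Φ : Fin n → Fin n → ℝ) j => (do
        let y ← step (rec.2.2 j)
        let y ← step (y / t')
        let axy ← step ((rec.1.2 : ℝ) * (rec.2.1 i / t') * y)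
        let old ← step (Φ i j)
        let new ← step (old + axy)
        step (Function.update Φ i (Function.update (Φ i) j new)))) 6 (List.finRange n) Φ
        (fun _ _ _ => le_rfl)
      rw [List.length_finRange] at h
      simp only [time_bind, time_step, val_step] at h ⊢
      omega
  rw [List.length_finRange] at h
  rw [time_bind, time_step, Nat.add_comm]
  exact Nat.add_le_add_right h 1

theorem time_divideScores_le (rr : ℝ) (Φ : Fin n → Fin n → ℝ) :
    (divideScores rr Φ).time ≤ n * (n * 4 + 2) + 1 := by
  have h := time_loop_le (body := fun (Φ : Fin n → Fin n → ℝ) i =>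
    loop (fun (Φ : Fin n → Fin n → ℝ) j => do
      let old ← step (Φ i j)
      let new ← step (old / rr)
      step (Function.update Φ i (Function.update (Φ i) j new))) (List.finRange n) Φ)
    (n * 4 + 1) (List.finRange n) Φ fun Φ i _ => by
      have h := time_loop_le (body := fun (Φ : Fin n → Fin n → ℝ) j => (do
        let old ← step (Φ i j)
        let new ← step (old / rr)
        step (Function.update Φ i (Function.update (Φ i) j new)))) 3 (List.finRange n) Φ
        (fun _ _ _ => le_rfl)
      rwa [List.length_finRange] at h
  rwa [List.length_finRange] at h

theorem time_initialRecords_le (n : ℕ) (T : List (PlaneTree × ℕ)) :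
    (initialRecords n T).time ≤ T.length * (2 * n + 2) + 1 :=
  time_mapList_le (2 * n) T fun _ _ => le_rfl

theorem time_listChandeliers_le {L M K R : ℕ} (hM : 0 < M) :
    (listChandeliers L M (listBulbs K R).val).time ≤
      (5 * L + 3) * ((canonTrees K).ncard + 1) ^ L +
        (canonTrees K).ncard.choose L * (L * (M + 5) + 3) := by
  obtain ⟨-, -, h1, -⟩ := listBulbs_spec K R
  have h2 := time_combinations_le L (listBulbs K R).val
  have h3 : (mapList (buildChandelier M) (combinations L (listBulbs K R).val).val).time ≤
      (combinations L (listBulbs K R).val).val.length * (L * (M + 5) + 3) + 1 :=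
    time_mapList_le (L * (M + 5) + 1) (combinations L (listBulbs K R).val).val fun l hl => by
      have := time_buildChandelier_le M hM l
      rwa [(mem_combinations.1 hl).2] at this
  rw [length_combinations] at h3
  have h4 := Nat.mul_le_mul_left (5 * L + 3) (Nat.pow_le_pow_left (Nat.add_le_add_right h1 1) L)
  have h5 := Nat.mul_le_mul_right (L * (M + 5) + 3) (Nat.choose_le_choose L h1)
  have e : (listChandeliers L M (listBulbs K R).val).time =
    (combinations L (listBulbs K R).val).time +
    (mapList (buildChandelier M) (combinations L (listBulbs K R).val).val).time := rfl
  rw [e]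
  omega

/-- A bound for the running time of the algorithm in terms of the number `a` of rooted trees with
`K` edges, the number `t` of colorings and a bound `s` for the number of pairs of disjoint sets of
colors of given sizes. -/
theorem time_approxScores_le {K L M N R : ℕ} (hM : 0 < M) (hN : N = (K + M) * L) {s : ℕ}
    (hs : ∀ a b, ((buildSplits N).val a b).length ≤ s)
    (MA MB : Matrix (Fin n) (Fin n) ℝ) (μ ν : ℕ → Fin n → Fin (N + 1)) {a t T : ℕ}
    (ha : a = (canonTrees K).ncard) (ht : t = numColorings N) (hT : T = a.choose L) :
    (approxScores K L M N R MA MB μ ν).time ≤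
      (a * (4 * (K + 1) ^ 2 + 16 * (K + 1) + 13) + (K + 1) + 1) +
      ((5 * L + 3) * (a + 1) ^ L + T * (L * (M + 5) + 3)) + (4 * (N + 1) + 5) +
      (t * (6 * n + 5) + 1) +
      (11 * 3 ^ (N + 1) + (N + 2) ^ 2 + 3 ^ (N + 1) * (2 * (N + 1) + 4) + 1) +
      (T * (2 * n + 2) + 1) +
      (t * (T * (4 * (N + 1) * vertexCost n N s + 4 * n + 3) + 2) + 1) + 1 + n ^ 2 +
      (T * (n * (n * 7 + 5) + 3) + 1) + 1 + (n * (n * 4 + 2) + 1) := by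
  have hT' : (allChandeliers L M K R).length ≤ T := by
    rw [hT, ha]
    exact length_allChandeliers_le
  have h1 := (listBulbs_spec K R).2.2.2
  have h2 := time_listChandeliers_le (L := L) (K := K) (R := R) hM
  have h3 := time_factorialAndPower (N + 1) (N + 1)
  have h4 := time_drawColorings_le μ ν (numColorings N)
  have h5 := (buildSplits_spec N).2
  have h6 := (time_initialRecords_le n (allChandeliers L M K R)).trans
    (Nat.add_le_add_right (Nat.mul_le_mul_right _ hT') 1)
  let records := (initialRecords n (allChandeliers L M K R)).val
  have hrec : records = (allChandeliers L M K R).map fun H =>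
    (H, ((fun _ => 0 : Fin n → ℝ), (fun _ => 0 : Fin n → ℝ))) := val_mapList _ _
  have hlen : records.length ≤ T := by rwa [hrec, List.length_map]
  have h7 := time_addToRecords_le MA MB hs (drawColorings μ ν (numColorings N)).val records
    fun rec hr => by
      rw [hrec, List.mem_map] at hr
      obtain ⟨p, hp, rfl⟩ := hr
      exact (size_and_aut_of_mem_allChandeliers hM hN hp).1
  have hc : (drawColorings μ ν (numColorings N)).val.length = numColorings N := by
    rw [val_drawColorings, List.length_map, List.length_range]
  rw [hc] at h7
  have h8 := h7.trans (Nat.add_le_add_right (Nat.mul_le_mul_left _ (Nat.add_le_add_right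
    (Nat.mul_le_mul_right _ hlen) 2)) 1)
  let r : ℝ := ((factorialAndPower (N + 1) (N + 1)).val.1 : ℝ) /
    ((factorialAndPower (N + 1) (N + 1)).val.2 : ℝ)
  let records' := (addToRecords MA MB (buildSplits N).val
    (drawColorings μ ν (numColorings N)).val records).val
  have hlen' : records'.length ≤ T := by
    simp only [records']
    rw [val_addToRecords _ _ (buildSplits_spec N).1, List.length_map]
    exact hlen
  have h9 := (time_sumRecords_le (numColorings N : ℝ) records' fun _ _ => 0).trans
    (Nat.add_le_add_right (Nat.mul_le_mul_right _ hlen') 1)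
  have h10 := time_divideScores_le (r * r)
    (sumRecords (numColorings N : ℝ) records' fun _ _ => 0).val
  have e : (approxScores K L M N R MA MB μ ν).time = (listBulbs K R).time +
      ((listChandeliers L M (listBulbs K R).val).time +
      ((factorialAndPower (N + 1) (N + 1)).time + (1 + (3 +
      ((drawColorings μ ν (numColorings N)).time + ((buildSplits N).time +
      ((initialRecords n (allChandeliers L M K R)).time +
      ((addToRecords MA MB (buildSplits N).val
        (drawColorings μ ν (numColorings N)).val records).time + (1 + (n ^ 2 +
      ((sumRecords (numColorings N : ℝ) records' fun _ _ => 0).time + (1 +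
      (divideScores (r * r)
        (sumRecords (numColorings N : ℝ) records' fun _ _ => 0).val).time)))))))))))) := by
    rw [approxScores_eq]
    simp only [time_bind, time_step, time_steps, val_step, val_steps,
      val_factorialAndPower, ceil_div_eq_numColorings, records', records, r, allChandeliers]
  rw [e]
  subst ha ht hT
  omega

end Time

/-! # Estimates for binomial and trinomial coefficients -/

/-- Wallis type estimate: by the ratio of consecutive coefficients, the step amounts to `(2j + 1)(2j
+ 3) ≤ (2j + 2) ^ 2`. -/
theorem centralBinom_sq_mul_le (j : ℕ) : j.centralBinom ^ 2 * (2 * j + 1) ≤ 16 ^ j := by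
  induction j with
  | zero => simp
  | succ j ih =>
    have h := Nat.succ_mul_centralBinom_succ j
    have h1 : ((j + 1) * (j + 1).centralBinom) ^ 2 * (2 * (j + 1) + 1) ≤
        (j + 1) ^ 2 * 16 ^ (j + 1) := by
      rw [h]
      calc (2 * (2 * j + 1) * j.centralBinom) ^ 2 * (2 * (j + 1) + 1)
          = 4 * (2 * j + 1) * (2 * j + 3) * (j.centralBinom ^ 2 * (2 * j + 1)) := by ring
        _ ≤ 4 * (2 * j + 1) * (2 * j + 3) * 16 ^ j := Nat.mul_le_mul_left _ ih
        _ ≤ (16 * (j + 1) ^ 2) * 16 ^ j := Nat.mul_le_mul_right _ (by ring_nf; omega)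
        _ = (j + 1) ^ 2 * 16 ^ (j + 1) := by ring
    rw [mul_pow, mul_assoc] at h1
    exact Nat.le_of_mul_le_mul_left h1 (by positivity)

/-- The middle coefficient is the largest; for odd `k` it is half of the next central coefficient.
-/
theorem choose_sq_mul_le (k x : ℕ) : k.choose x ^ 2 * (k + 1) ≤ 4 ^ k := by
  have h := Nat.choose_le_middle x k
  refine (Nat.mul_le_mul_right _ (Nat.pow_le_pow_left h 2)).trans ?_
  rcases Nat.even_or_odd' k with ⟨j, rfl | rfl⟩
  · rw [Nat.mul_div_cancel_left j (by norm_num), pow_mul]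
    exact centralBinom_sq_mul_le j
  · rw [show (2 * j + 1) / 2 = j by omega]
    have h1 := centralBinom_sq_mul_le (j + 1)
    have h2 : (j + 1).centralBinom = 2 * (2 * j + 1).choose j := by
      rw [Nat.centralBinom, show 2 * (j + 1) = 2 * j + 1 + 1 by ring, Nat.choose_succ_succ,
        Nat.choose_symm_half]
      ring
    rw [h2] at h1
    have e : (16 : ℕ) ^ (j + 1) = 4 * 4 ^ (2 * j + 1) := by
      rw [pow_succ 4 (2 * j), pow_mul]
      ring
    rw [e] at h1
    nlinarith [Nat.zero_le ((2 * j + 1).choose j ^ 2)]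

/-- One term of the expansion of `(1 + 2) ^ (a + d)`. -/
theorem choose_mul_two_pow_le (a d : ℕ) : (a + d).choose a * 2 ^ d ≤ 3 ^ (a + d) := by
  have h := add_pow (1 : ℕ) 2 (a + d)
  rw [show (1 : ℕ) + 2 = 3 from rfl] at h
  rw [h]
  refine le_trans (le_of_eq ?_) (Finset.single_le_sum (f := fun k => 1 ^ k * 2 ^ (a + d - k) *
    (a + d).choose k) (fun _ _ => Nat.zero_le _) (Finset.mem_range.2 (by omega : a < a + d + 1)))
  simp [mul_comm]

/-- The trinomial coefficient. -/
def trinomial (a b c : ℕ) : ℕ := (a + b + c).choose a * (b + c).choose b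

theorem trinomial_mul (a b c : ℕ) :
    trinomial a b c * (a.factorial * b.factorial * c.factorial) = (a + b + c).factorial := by
  have h1 := Nat.choose_mul_factorial_mul_factorial (show a ≤ a + b + c by omega)
  have h2 := Nat.choose_mul_factorial_mul_factorial (show b ≤ b + c by omega)
  rw [show a + b + c - a = b + c by omega] at h1
  rw [show b + c - b = c by omega] at h2
  rw [← h1, ← h2, trinomial]
  ring

theorem trinomial_comm (a b c : ℕ) : trinomial a b c = trinomial b a c := by
  refine Nat.eq_of_mul_eq_mul_right (m := a.factorial * b.factorial * c.factorial)
    (by positivity) ?_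
  rw [trinomial_mul, mul_comm a.factorial, trinomial_mul, add_comm a]

theorem trinomial_rotate (a b c : ℕ) : trinomial a b c = trinomial c a b := by
  refine Nat.eq_of_mul_eq_mul_right (m := a.factorial * b.factorial * c.factorial)
    (by positivity) ?_
  rw [trinomial_mul, show a.factorial * b.factorial * c.factorial =
    c.factorial * a.factorial * b.factorial by ring, trinomial_mul,
    show a + b + c = c + a + b by ring]

/-- Bounding `(a + b + c).choose a` by a single binomial term gains nothing, so the factor `1 / √(b
+ c + 1)` from the other coefficient has to suffice. It does when `a` is smallest: then `2 a ≤ b +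
c`, and `b + c + 1` is at least two thirds of `a + b + c + 1`. -/
theorem trinomial_sq_mul_le_of_le {a b c : ℕ} (hb : a ≤ b) (hc : a ≤ c) :
    trinomial a b c ^ 2 * (2 * (a + b + c + 1)) ≤ 3 * 9 ^ (a + b + c) := by
  have h1 := choose_mul_two_pow_le a (b + c)
  have h2 := choose_sq_mul_le (b + c) b
  rw [← add_assoc] at h1
  calc trinomial a b c ^ 2 * (2 * (a + b + c + 1))
      ≤ trinomial a b c ^ 2 * (3 * (b + c + 1)) := Nat.mul_le_mul_left _ (by omega)
    _ = 3 * ((a + b + c).choose a ^ 2 * ((b + c).choose b ^ 2 * (b + c + 1))) := by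
      rw [trinomial]
      ring
    _ ≤ 3 * ((a + b + c).choose a ^ 2 * 4 ^ (b + c)) :=
      Nat.mul_le_mul_left _ (Nat.mul_le_mul_left _ h2)
    _ = 3 * ((a + b + c).choose a * 2 ^ (b + c)) ^ 2 := by
      rw [mul_pow, ← pow_mul, mul_comm (b + c) 2, pow_mul]
      norm_num
    _ ≤ 3 * (3 ^ (a + b + c)) ^ 2 := Nat.mul_le_mul_left _ (Nat.pow_le_pow_left h1 2)
    _ = 3 * 9 ^ (a + b + c) := by
      rw [← pow_mul, mul_comm _ 2, pow_mul]
      norm_num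

theorem trinomial_sq_mul_le (a b c : ℕ) :
    trinomial a b c ^ 2 * (2 * (a + b + c + 1)) ≤ 3 * 9 ^ (a + b + c) := by
  rcases le_total a b with h1 | h1
  · rcases le_total a c with h2 | h2
    · exact trinomial_sq_mul_le_of_le h1 h2
    · rw [trinomial_rotate, show a + b + c = c + a + b by ring]
      exact trinomial_sq_mul_le_of_le h2 (h2.trans h1)
  · rcases le_total b c with h2 | h2
    · rw [trinomial_comm, show a + b + c = b + a + c by ring]
      exact trinomial_sq_mul_le_of_le h1 h2
    · rw [trinomial_rotate, show a + b + c = c + a + b by ring]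
      exact trinomial_sq_mul_le_of_le (h2.trans h1) h2

/-! ### Bounds for the pairs of color sets of given sizes and for the number of colorings. -/

theorem card_splits_le {N : ℕ} {l : List (ColorSet N × ColorSet N)} {a b : ℕ} (hl : l.Nodup)
    (h : ∀ C, C ∈ l ↔ Disjoint C.1 C.2 ∧ C.1.card = a ∧ C.2.card = b) :
    l.length ≤ (N + 1).choose a * (N + 1 - a).choose b := by
  classical
  rw [← List.toFinset_card_of_nodup hl]
  have h1 : l.toFinset ⊆ ((Finset.powersetCard a (Finset.univ : ColorSet N)).sigma
      fun C => Finset.powersetCard b Cᶜ).image fun p => (p.1, p.2) := by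
    intro C hC
    rw [List.mem_toFinset, h] at hC
    rw [Finset.mem_image]
    refine ⟨⟨C.1, C.2⟩, ?_, rfl⟩
    rw [Finset.mem_sigma, Finset.mem_powersetCard, Finset.mem_powersetCard]
    exact ⟨⟨Finset.subset_univ _, hC.2.1⟩, Finset.subset_compl_iff_disjoint_left.2 hC.1, hC.2.2⟩
  refine (Finset.card_le_card h1).trans (Finset.card_image_le.trans (le_of_eq ?_))
  rw [Finset.card_sigma]
  have h2 : ∀ C ∈ Finset.powersetCard a (Finset.univ : ColorSet N),
      (Finset.powersetCard b Cᶜ).card = (N + 1 - a).choose b := by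
    intro C hC
    rw [Finset.mem_powersetCard] at hC
    rw [Finset.card_powersetCard, Finset.card_compl, Fintype.card_fin, hC.2]
  rw [Finset.sum_congr rfl h2, Finset.sum_const, Finset.card_powersetCard, Finset.card_univ,
    Fintype.card_fin, smul_eq_mul]

theorem length_splits_sq_mul_le (N a b : ℕ) :
    ((buildSplits N).val a b).length ^ 2 * (2 * (N + 2)) ≤ 3 * 9 ^ (N + 1) := by
  obtain ⟨h1, h2⟩ := (buildSplits_spec N).1 a b
  have h := card_splits_le h1 h2
  refine (Nat.mul_le_mul_right _ (Nat.pow_le_pow_left h 2)).trans ?_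
  rcases Nat.lt_or_ge (N + 1) (a + b) with hab | hab
  · have : (N + 1).choose a * (N + 1 - a).choose b = 0 := by
      rw [Nat.mul_eq_zero]
      rcases Nat.lt_or_ge (N + 1) a with ha | ha
      · exact Or.inl (Nat.choose_eq_zero_of_lt ha)
      · exact Or.inr (Nat.choose_eq_zero_of_lt (by omega))
    rw [this]
    simp
  · obtain ⟨c, hc⟩ := Nat.exists_eq_add_of_le hab
    have h3 := trinomial_sq_mul_le a b c
    rw [trinomial, ← hc, show b + c = N + 1 - a by omega] at h3
    exact h3

theorem length_splits_le (N a b : ℕ) :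
    (((buildSplits N).val a b).length : ℝ) ≤ 2 * 3 ^ (N + 1) / √((N + 1 : ℕ) : ℝ) := by
  have hN : (0 : ℝ) < ((N + 1 : ℕ) : ℝ) := by positivity
  rw [le_div_iff₀ (Real.sqrt_pos.2 hN)]
  refine le_of_sq_le_sq ?_ (by positivity)
  rw [mul_pow, Real.sq_sqrt hN.le]
  have h := length_splits_sq_mul_le N a b
  have h' : (((buildSplits N).val a b).length : ℝ) ^ 2 * (2 * ((N : ℝ) + 2)) ≤
      3 * 9 ^ (N + 1) := by exact_mod_cast h
  have e : (2 * 3 ^ (N + 1) : ℝ) ^ 2 = 4 * 9 ^ (N + 1) := by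
    rw [mul_pow, ← pow_mul, mul_comm (N + 1) 2, pow_mul]
    norm_num
  rw [e]
  push_cast
  nlinarith [sq_nonneg (((buildSplits N).val a b).length : ℝ),
    (by positivity : (0 : ℝ) ≤ 9 ^ (N + 1))]

/-- Stirling's lower bound for `(N + 1)!` gives `1 / r` with constant `1`. The ceiling adds at most
`1`, which is no more than `e ^ (N + 1) / √(N + 1)`. -/
theorem numColorings_le (N : ℕ) :
    (numColorings N : ℝ) ≤ 2 * Real.exp 1 ^ (N + 1) / √((N + 1 : ℕ) : ℝ) := by
  have hN : (0 : ℝ) < ((N + 1 : ℕ) : ℝ) := by positivity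
  have hs := Real.sqrt_pos.2 hN
  have hf : (0 : ℝ) < ((N + 1).factorial : ℝ) := by positivity
  have h1 : 1 / colorfulProb N ≤ Real.exp 1 ^ (N + 1) / √((N + 1 : ℕ) : ℝ) := by
    have h := Stirling.le_factorial_stirling (N + 1)
    rw [div_pow] at h
    rw [colorfulProb, one_div_div, div_le_div_iff₀ hf hs]
    have h2 : √((N + 1 : ℕ) : ℝ) ≤ √(2 * Real.pi * ((N + 1 : ℕ) : ℝ)) := by
      refine Real.sqrt_le_sqrt ?_
      nlinarith [Real.pi_gt_three]
    have h3 := (mul_le_mul_of_nonneg_right h2 (by positivity)).trans h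
    rw [← mul_div_assoc, div_le_iff₀ (by positivity)] at h3
    linarith
  have h2 : 1 ≤ Real.exp 1 ^ (N + 1) / √((N + 1 : ℕ) : ℝ) := by
    rw [le_div_iff₀ hs, one_mul]
    have h3 : √((N + 1 : ℕ) : ℝ) ≤ ((N + 1 : ℕ) : ℝ) := by
      rw [Real.sqrt_le_left (by positivity)]
      have : (1 : ℝ) ≤ ((N + 1 : ℕ) : ℝ) := by exact_mod_cast Nat.le_add_left 1 N
      nlinarith
    refine h3.trans ?_
    have h4 : N + 1 ≤ 2 ^ (N + 1) := Nat.lt_two_pow_self.le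
    calc ((N + 1 : ℕ) : ℝ) ≤ 2 ^ (N + 1) := by exact_mod_cast h4
      _ ≤ Real.exp 1 ^ (N + 1) := by
        gcongr
        exact Real.exp_one_gt_two.le
  have h3 : (0 : ℝ) ≤ 1 / colorfulProb N := by
    rw [colorfulProb]
    positivity
  have h4 := (Nat.ceil_lt_add_one h3).le
  rw [numColorings]
  calc (⌈1 / colorfulProb N⌉₊ : ℝ) ≤ 1 / colorfulProb N + 1 := h4
    _ ≤ Real.exp 1 ^ (N + 1) / √((N + 1 : ℕ) : ℝ) + Real.exp 1 ^ (N + 1) / √((N + 1 : ℕ) : ℝ) :=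
      add_le_add h1 h2
    _ = _ := by ring

/-! # The running time of the algorithm -/

/-- An upper bound, up to a power of Otter's constant, for the number of chandeliers. -/
noncomputable def chandelierFactor : ℝ := Real.exp (2 / otterConstant ^ 2)

theorem one_le_chandelierFactor : 1 ≤ chandelierFactor :=
  Real.one_le_exp (by have := otterConstant_pos; positivity)

/-- The constant factor of `ncard_canonTrees_le_mul_pow` enters to the power `L`, but `x ^ L / L! ≤
exp x` keeps it bounded uniformly in `L`. -/
theorem choose_ncard_canonTrees_le {L M K N : ℕ} (hN : N = (K + M) * L) :
    ((canonTrees K).ncard.choose L : ℝ) ≤ chandelierFactor * (1 / otterConstant) ^ N := by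
  have hα := otterConstant_pos
  have hα1 : 1 ≤ 1 / otterConstant := by
    rw [le_div_iff₀ hα, one_mul]
    exact otterConstant_le_one
  have hKL : K * L ≤ N := by
    rw [hN, Nat.add_mul]
    omega
  calc ((canonTrees K).ncard.choose L : ℝ)
      ≤ ((canonTrees K).ncard : ℝ) ^ L / L.factorial := Nat.choose_le_pow_div _ _
    _ ≤ (2 / otterConstant ^ 2 * (1 / otterConstant) ^ K) ^ L / L.factorial := by
      gcongr
      exact ncard_canonTrees_le_mul_pow K
    _ = (2 / otterConstant ^ 2) ^ L / L.factorial * (1 / otterConstant) ^ (K * L) := by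
      rw [mul_pow, ← pow_mul]
      ring
    _ ≤ chandelierFactor * (1 / otterConstant) ^ N := by
      gcongr
      · exact (Real.exp_pos _).le
      · exact Real.pow_div_factorial_le_exp _ (by positivity) L

theorem succ_le_two_pow (N : ℕ) : N + 1 ≤ 2 ^ N := Nat.lt_two_pow_self

theorem succ_sq_le_two_pow (K : ℕ) : (K + 1) ^ 2 ≤ 4 * 2 ^ K := by
  induction K with
  | zero => norm_num
  | succ K ih =>
    rcases Nat.lt_or_ge K 2 with h | h
    · interval_cases K <;> norm_num
    · rw [pow_succ 2 K]
      nlinarith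

/-- There are at most `4 ^ K` trees, and the polynomial cost per tree is of order at most `2 ^ K`;
hence the base `8`. Likewise `a + 1 ≤ 8 ^ K`, which uses `0 < K`, and `8 ^ L` fits because `K * L +
L ≤ N`. -/
theorem listing_cost_le {L M K N : ℕ} (hK : 0 < K) (hL : 0 < L) (hM : 0 < M)
    (hN : N = (K + M) * L) {a T : ℕ} (ha : a ≤ 4 ^ K) :
    (a * (4 * (K + 1) ^ 2 + 16 * (K + 1) + 13) + (K + 1) + 1) +
      ((5 * L + 3) * (a + 1) ^ L + T * (L * (M + 5) + 3)) ≤ 143 * 8 ^ N + 9 * (T * 2 ^ N) := by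
  have hKN : K ≤ N := by
    rw [hN]
    nlinarith
  have hN' : N = K * L + M * L := by rw [hN, Nat.add_mul]
  have hML : L ≤ M * L := Nat.le_mul_of_pos_left L hM
  have h1 : a * (4 * (K + 1) ^ 2 + 16 * (K + 1) + 13) + (K + 1) + 1 ≤ 142 * 8 ^ N := by
    have h2 := succ_sq_le_two_pow K
    have h3 := succ_le_two_pow K
    have h4 : 4 * (K + 1) ^ 2 + 16 * (K + 1) + 13 ≤ 140 * 2 ^ K := by nlinarith
    have h5 : a * (4 * (K + 1) ^ 2 + 16 * (K + 1) + 13) ≤ 4 ^ K * (140 * 2 ^ K) :=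
      Nat.mul_le_mul ha h4
    have h6 : 4 ^ K * (140 * 2 ^ K) = 140 * 8 ^ K := by
      rw [show (8 : ℕ) = 4 * 2 by norm_num, mul_pow]
      ring
    have h7 : (8 : ℕ) ^ K ≤ 8 ^ N := Nat.pow_le_pow_right (by norm_num) hKN
    have h8 : 2 ^ K ≤ 8 ^ K := Nat.pow_le_pow_left (by norm_num) K
    have h9 : 1 ≤ 8 ^ K := Nat.one_le_pow _ _ (by norm_num)
    omega
  have h2 : (5 * L + 3) * (a + 1) ^ L ≤ 8 ^ N := by
    have h3 : 5 * L + 3 ≤ 8 ^ L := by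
      clear hN hN' hML h1 ha
      induction L with
      | zero => omega
      | succ L ih =>
        rcases Nat.eq_zero_or_pos L with rfl | hL
        · norm_num
        · have := ih hL
          rw [pow_succ]
          omega
    have h4 : a + 1 ≤ 8 ^ K := by
      have h5 : 1 ≤ 4 ^ K := Nat.one_le_pow _ _ (by norm_num)
      have h6 : 2 ≤ 2 ^ K := by
        calc 2 = 2 ^ 1 := rfl
          _ ≤ 2 ^ K := Nat.pow_le_pow_right (by norm_num) hK
      have h7 : (8 : ℕ) ^ K = 4 ^ K * 2 ^ K := by
        rw [← mul_pow]
        norm_num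
      rw [h7]
      nlinarith
    calc (5 * L + 3) * (a + 1) ^ L ≤ 8 ^ L * (8 ^ K) ^ L :=
          Nat.mul_le_mul h3 (Nat.pow_le_pow_left h4 L)
      _ = 8 ^ (K * L + L) := by rw [← pow_mul, ← pow_add, add_comm]
      _ ≤ 8 ^ N := Nat.pow_le_pow_right (by norm_num) (by omega)
  have h3 : T * (L * (M + 5) + 3) ≤ 9 * (T * 2 ^ N) := by
    have h4 := succ_le_two_pow N
    have h5 : L * (M + 5) + 3 ≤ 9 * 2 ^ N := by
      rw [Nat.mul_add, Nat.mul_comm L M]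
      omega
    calc T * (L * (M + 5) + 3) ≤ T * (9 * 2 ^ N) := Nat.mul_le_mul_left T h5
      _ = 9 * (T * 2 ^ N) := by ring
  omega

theorem splits_cost_le (N : ℕ) :
    (4 * (N + 1) + 5) +
      (11 * 3 ^ (N + 1) + (N + 2) ^ 2 + 3 ^ (N + 1) * (2 * (N + 1) + 4) + 1) ≤ 81 * 8 ^ N := by
  have h1 := succ_le_two_pow N
  have h2 := succ_sq_le_two_pow (N + 1)
  have h3 : 3 ^ N * 2 ^ N ≤ 8 ^ N := by
    rw [← mul_pow]
    exact Nat.pow_le_pow_left (by norm_num) N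
  have h4 : 2 ^ N ≤ 8 ^ N := Nat.pow_le_pow_left (by norm_num) N
  have h5 : 3 ^ (N + 1) * (11 + (2 * (N + 1) + 4)) ≤ 3 ^ (N + 1) * (17 * 2 ^ N) :=
    Nat.mul_le_mul_left _ (by omega)
  have h6 : 3 ^ (N + 1) * (17 * 2 ^ N) = 51 * (3 ^ N * 2 ^ N) := by ring
  have h7 : 3 ^ (N + 1) * (11 + (2 * (N + 1) + 4)) =
    11 * 3 ^ (N + 1) + 3 ^ (N + 1) * (2 * (N + 1) + 4) := by ring
  rw [show N + 1 + 1 = N + 2 by ring, pow_succ 2 N] at h2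
  have h8 : 1 ≤ 2 ^ N := Nat.one_le_two_pow
  omega

theorem vertexCost_le {n N s : ℕ} (hn : 0 < n)
    (hs : (s : ℝ) ≤ 2 * 3 ^ (N + 1) / √((N + 1 : ℕ) : ℝ)) :
    (vertexCost n N s : ℝ) ≤ 37 * n ^ 2 * (3 ^ (N + 1) / √((N + 1 : ℕ) : ℝ)) := by
  have hN : (0 : ℝ) < ((N + 1 : ℕ) : ℝ) := by positivity
  have hq := Real.sqrt_pos.2 hN
  have hn' : (1 : ℝ) ≤ n := by exact_mod_cast hn
  set X : ℝ := 3 ^ (N + 1) / √((N + 1 : ℕ) : ℝ) with hX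
  -- The square root is harmless here: after squaring and with `N + 1 ≤ 2 ^ (N + 1)`, the claim is
  -- `8 ^ (N + 1) ≤ 9 ^ (N + 1)`.
  have h2 : (2 : ℝ) ^ (N + 1) ≤ X := by
    rw [hX, le_div_iff₀ hq]
    refine le_of_sq_le_sq ?_ (by positivity)
    rw [mul_pow, Real.sq_sqrt hN.le]
    have h3 : N + 1 ≤ 2 ^ (N + 1) := Nat.lt_two_pow_self.le
    have h4 : ((N + 1 : ℕ) : ℝ) ≤ 2 ^ (N + 1) := by exact_mod_cast h3
    calc ((2 : ℝ) ^ (N + 1)) ^ 2 * ((N + 1 : ℕ) : ℝ) ≤ (2 ^ (N + 1)) ^ 2 * 2 ^ (N + 1) := by gcongr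
      _ = 8 ^ (N + 1) := by
        rw [← pow_mul, ← pow_add, show (8 : ℝ) = 2 ^ 3 by norm_num, ← pow_mul]
        congr 1
        ring
      _ ≤ 9 ^ (N + 1) := by
        gcongr
        norm_num
      _ = (3 ^ (N + 1)) ^ 2 := by
        rw [← pow_mul, mul_comm (N + 1) 2, pow_mul]
        norm_num
  have h1 : (1 : ℝ) ≤ X := (one_le_pow₀ (by norm_num)).trans h2
  have hs' : (s : ℝ) ≤ 2 * X := by rwa [hX, ← mul_div_assoc]
  have hn2 : (n : ℝ) ≤ n ^ 2 := by nlinarith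
  have hn1 : (1 : ℝ) ≤ n ^ 2 := hn'.trans hn2
  have e1 : (n : ℝ) * 2 ^ (N + 1) ≤ n ^ 2 * X := by gcongr
  have e2 : (s : ℝ) * (n * (n * 9 + 2) + 3) ≤ 2 * X * (14 * n ^ 2) := by
    gcongr
    nlinarith
  have e3 : (4 : ℝ) * n + 4 ≤ 8 * n ^ 2 * X := by
    nlinarith [mul_le_mul hn1 h1 zero_le_one (by positivity)]
  rw [vertexCost]
  push_cast
  linarith

/-- The factor `N + 1` from the number of vertices cancels against the two factors `1 / √(N + 1)`,
one from the splits and one from the colorings. So no power of `N` is left. -/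
theorem counting_cost_le {n N s t : ℕ} (hn : 0 < n)
    (hs : (s : ℝ) ≤ 2 * 3 ^ (N + 1) / √((N + 1 : ℕ) : ℝ))
    (ht : (t : ℝ) ≤ 2 * Real.exp 1 ^ (N + 1) / √((N + 1 : ℕ) : ℝ)) :
    (t : ℝ) * (4 * (N + 1) * vertexCost n N s + 4 * n + 3) ≤
      6000 * (n ^ 2 * (3 * Real.exp 1) ^ N) := by
  have hN : (0 : ℝ) < ((N + 1 : ℕ) : ℝ) := by positivity
  have hq := Real.sqrt_pos.2 hN
  have hn' : (1 : ℝ) ≤ n := by exact_mod_cast hn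
  have hV := vertexCost_le hn hs
  have h4 : (4 : ℝ) * n + 3 ≤ 4 * (N + 1) * vertexCost n N s := by
    have h5 : 4 * n + 3 ≤ vertexCost n N s := by
      unfold vertexCost
      omega
    have h6 : (4 : ℝ) * n + 3 ≤ vertexCost n N s := by exact_mod_cast h5
    have h7 : (0 : ℝ) ≤ (N : ℝ) := Nat.cast_nonneg N
    nlinarith
  have h5 : (4 * (N + 1) * vertexCost n N s + 4 * n + 3 : ℝ) ≤
      8 * ((N + 1 : ℕ) : ℝ) * (37 * n ^ 2 * (3 ^ (N + 1) / √((N + 1 : ℕ) : ℝ))) := by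
    calc (4 * (N + 1) * vertexCost n N s + 4 * n + 3 : ℝ)
        ≤ 8 * ((N + 1 : ℕ) : ℝ) * vertexCost n N s := by
          push_cast
          linarith
      _ ≤ _ := by gcongr
  have he := Real.exp_one_lt_three
  calc (t : ℝ) * (4 * (N + 1) * vertexCost n N s + 4 * n + 3)
      ≤ (2 * Real.exp 1 ^ (N + 1) / √((N + 1 : ℕ) : ℝ)) *
        (8 * ((N + 1 : ℕ) : ℝ) * (37 * n ^ 2 * (3 ^ (N + 1) / √((N + 1 : ℕ) : ℝ)))) := by gcongr
    _ = 592 * (n ^ 2 * (3 * Real.exp 1) ^ (N + 1)) *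
        (((N + 1 : ℕ) : ℝ) / (√((N + 1 : ℕ) : ℝ) * √((N + 1 : ℕ) : ℝ))) := by
      rw [mul_pow]
      field_simp
      ring
    _ = 592 * (n ^ 2 * (3 * Real.exp 1) ^ N) * (3 * Real.exp 1) := by
      rw [Real.mul_self_sqrt hN.le, div_self hN.ne', mul_one, pow_succ]
      ring
    -- The constant is `592 = 2 * 8 * 37`, and `3 e < 9`.
    _ ≤ 6000 * (n ^ 2 * (3 * Real.exp 1) ^ N) := by
      have : 0 ≤ n ^ 2 * (3 * Real.exp 1) ^ N := by positivity
      nlinarith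

/-- The algorithm runs in time `O(n ^ 2 (3 e / α) ^ N)`. -/
theorem time_approxScores_le_mul_pow {n K L M N R : ℕ} (hn : 0 < n) (hK : 0 < K) (hL : 0 < L)
    (hM : 0 < M) (hN : N = (K + M) * L) (MA MB : Matrix (Fin n) (Fin n) ℝ)
    (μ ν : ℕ → Fin n → Fin (N + 1)) :
    ((approxScores K L M N R MA MB μ ν).time : ℝ) ≤
      (10000 * chandelierFactor) * ((n : ℝ) ^ 2 * (3 * Real.exp 1 / otterConstant) ^ N) := by
  -- The step counts are natural numbers, so the real bound for the lengths is rounded down.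
  obtain ⟨s, hs1, hs2⟩ : ∃ s : ℕ, (∀ a b, ((buildSplits N).val a b).length ≤ s) ∧
      (s : ℝ) ≤ 2 * 3 ^ (N + 1) / √((N + 1 : ℕ) : ℝ) :=
    ⟨⌊2 * 3 ^ (N + 1) / √((N + 1 : ℕ) : ℝ)⌋₊,
      fun a b => Nat.le_floor (length_splits_le N a b), Nat.floor_le (by positivity)⟩
  have h := time_approxScores_le (R := R) hM hN hs1 MA MB μ ν rfl rfl rfl
  have hT := choose_ncard_canonTrees_le hN
  have ht := numColorings_le N
  have hlist := listing_cost_le (T := (canonTrees K).ncard.choose L) hK hL hM hN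
    (ncard_canonTrees_le K)
  have hsplit := splits_cost_le N
  generalize (canonTrees K).ncard.choose L = T at h hT hlist
  generalize numColorings N = t at h ht
  have hcount := counting_cost_le hn hs2 ht
  generalize vertexCost n N s = V at h hcount
  have h' : (approxScores K L M N R MA MB μ ν).time ≤ 224 * 8 ^ N + 9 * (T * 2 ^ N) +
      (t * (6 * n + 5) + 1) + (T * (2 * n + 2) + 1) +
      (t * (T * (4 * (N + 1) * V + 4 * n + 3) + 2) + 1) + 1 + n ^ 2 +
      (T * (n * (n * 7 + 5) + 3) + 1) + 1 + (n * (n * 4 + 2) + 1) := by omega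
  have hr : ((approxScores K L M N R MA MB μ ν).time : ℝ) ≤ 224 * 8 ^ N + 9 * (T * 2 ^ N) +
      (t * (6 * n + 5) + 1) + (T * (2 * n + 2) + 1) +
      (t * (T * (4 * (N + 1) * V + 4 * n + 3) + 2) + 1) + 1 + n ^ 2 +
      (T * (n * (n * 7 + 5) + 3) + 1) + 1 + (n * (n * 4 + 2) + 1) := by exact_mod_cast h'
  refine hr.trans ?_
  -- The comparison of `8 ^ N` with `(3 e) ^ N` needs `e ≥ 8 / 3`, for which `e > 2` is too weak.
  have he2 := Real.exp_one_gt_d9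
  have he3 := Real.exp_one_lt_three
  have hα := otterConstant_pos
  have hα1 : 1 ≤ 1 / otterConstant := by
    rw [le_div_iff₀ hα, one_mul]
    exact otterConstant_le_one
  have hA : 1 ≤ (1 / otterConstant) ^ N := one_le_pow₀ hα1
  have h8 : (8 : ℝ) ^ N ≤ (3 * Real.exp 1) ^ N := by
    gcongr
    linarith
  have h2 : (2 : ℝ) ^ N ≤ (3 * Real.exp 1) ^ N := by
    gcongr
    linarith
  have ht' : (t : ℝ) ≤ 6 * (3 * Real.exp 1) ^ N := by
    refine ht.trans ?_
    have h1 : (1 : ℝ) ≤ √((N + 1 : ℕ) : ℝ) := by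
      rw [Real.one_le_sqrt]
      exact_mod_cast Nat.le_add_left 1 N
    calc 2 * Real.exp 1 ^ (N + 1) / √((N + 1 : ℕ) : ℝ) ≤ 2 * Real.exp 1 ^ (N + 1) / 1 := by
          gcongr
      _ = 2 * Real.exp 1 * Real.exp 1 ^ N := by
        rw [pow_succ]
        ring
      _ ≤ 6 * (3 * Real.exp 1) ^ N := by
        gcongr
        · linarith
        · linarith
  have hE : 1 ≤ (3 * Real.exp 1) ^ N := one_le_pow₀ (by linarith)
  rw [show 3 * Real.exp 1 / otterConstant = 3 * Real.exp 1 * (1 / otterConstant) by ring, mul_pow]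
  have hC := one_le_chandelierFactor
  have hn' : (1 : ℝ) ≤ n := by exact_mod_cast hn
  generalize (3 * Real.exp 1) ^ N = E at *
  generalize (1 / otterConstant) ^ N = A at *
  generalize chandelierFactor = C at *
  clear h h' hr hlist hsplit hs1 hs2 ht
  have hT0 : (0 : ℝ) ≤ T := Nat.cast_nonneg T
  have hn2 : (n : ℝ) ≤ n ^ 2 := le_self_pow₀ hn' two_ne_zero
  have hn1 : (1 : ℝ) ≤ n ^ 2 := hn'.trans hn2
  have hCA : 1 ≤ C * A := one_le_mul_of_one_le_of_one_le hC hA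
  have hCAE : 1 ≤ C * A * E := one_le_mul_of_one_le_of_one_le hCA hE
  have hE0 : 0 ≤ E := zero_le_one.trans hE
  have e1 : (T : ℝ) * 2 ^ N ≤ C * A * E := by gcongr
  have e2 : E ≤ C * A * E := le_mul_of_one_le_left hE0 hCA
  have e3 : C * A ≤ C * A * E := le_mul_of_one_le_right (zero_le_one.trans hCA) hE
  have e4 : C * A * E ≤ n ^ 2 * (C * A * E) :=
    le_mul_of_one_le_left (zero_le_one.trans hCAE) hn1
  have e5 : (t : ℝ) * (6 * n + 5) ≤ 66 * (n ^ 2 * (C * A * E)) := by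
    calc (t : ℝ) * (6 * n + 5) ≤ 6 * (C * A * E) * (11 * n ^ 2) := by
          gcongr
          · linarith
          · linarith
      _ = _ := by ring
  have e6 : (T : ℝ) * (2 * n + 2) ≤ 4 * (n ^ 2 * (C * A * E)) := by
    calc (T : ℝ) * (2 * n + 2) ≤ (C * A * E) * (4 * n ^ 2) := by
          gcongr
          · linarith
          · linarith
      _ = _ := by ring
  have e7 : (T : ℝ) * (n * (n * 7 + 5) + 3) ≤ 15 * (n ^ 2 * (C * A * E)) := by
    calc (T : ℝ) * (n * (n * 7 + 5) + 3) ≤ (C * A * E) * (15 * n ^ 2) := by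
          gcongr
          · linarith
          · nlinarith
      _ = _ := by ring
  have e8 : (t : ℝ) * (T * (4 * (N + 1) * V + 4 * n + 3) + 2) ≤ 6012 * (n ^ 2 * (C * A * E)) := by
    calc (t : ℝ) * (T * (4 * (N + 1) * V + 4 * n + 3) + 2)
        = T * (t * (4 * (N + 1) * V + 4 * n + 3)) + 2 * t := by ring
      _ ≤ C * A * (6000 * (n ^ 2 * E)) + 2 * (6 * E) := by gcongr
      _ = 6000 * (n ^ 2 * (C * A * E)) + 12 * E := by ring
      _ ≤ _ := by linarith
  have e9 : (n : ℝ) ^ 2 ≤ n ^ 2 * (C * A * E) := le_mul_of_one_le_right (by positivity) hCAE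
  have e10 : (n : ℝ) * (n * 4 + 2) ≤ 6 * (n ^ 2 * (C * A * E)) := by
    have : (n : ℝ) * (n * 4 + 2) ≤ 6 * n ^ 2 := by nlinarith
    linarith
  have e11 : (1 : ℝ) ≤ n ^ 2 * (C * A * E) := hn1.trans e9
  have e12 : 10000 * C * (n ^ 2 * (E * A)) = 10000 * (n ^ 2 * (C * A * E)) := by ring
  rw [e12]
  linarith

/-! # The running time for the simple choice of the parameters -/

/-- For the simple choice of the parameters, `N ≤ D log n / ε`. -/
theorem IsSimpleChoice.edges_le {C₁ C₂ C₃ C₄ : ℝ} (h1 : 0 < C₁) (h2 : 0 < C₂) (h3 : 0 < C₃) :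
    ∃ D : ℝ, 0 < D ∧ ∀ ε : ℝ, 0 < ε → ε ≤ 1 → ∀ (n : ℕ) (q : ℝ), q ≤ 1 → 2 ≤ n * q →
      ∀ K L M N R : ℕ, N = (K + M) * L → IsSimpleChoice C₁ C₂ C₃ C₄ ε q n K L M R →
        (N : ℝ) ≤ D * (Real.log n / ε) := by
  have hl2 : 0 < Real.log 2 := Real.log_pos (by norm_num)
  let D₂ : ℝ := C₂ + 1 / Real.log 2
  let D₃ : ℝ := C₃ * D₂ / Real.log 2 + 1 / Real.log 2
  refine ⟨(D₂ + D₃) * (C₁ + 1), by positivity, ?_⟩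
  intro ε hε hε1 n q hq hnq K L M N R hN ⟨hL, hK, hM, _⟩
  have hn : (2 : ℝ) ≤ n := hnq.trans (mul_le_of_le_one_right (Nat.cast_nonneg n) hq)
  have hln : Real.log 2 ≤ Real.log n := Real.log_le_log (by norm_num) hn
  -- This keeps the denominator of `M` away from zero, so that `M` is at most of the order of `K`
  -- plus the rounding error.
  have hlnq : Real.log 2 ≤ Real.log (n * q) := Real.log_le_log (by norm_num) hnq
  have hln0 : 0 < Real.log n := hl2.trans_le hln
  -- Turns the rounding errors into multiples of `log n`; this is the source of `1 / log 2` in `D₂`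
  -- and `D₃`.
  have one_le : 1 ≤ 1 / Real.log 2 * Real.log n := by
    rw [one_div_mul_eq_div, le_div_iff₀ hl2]
    linarith
  have hL' : (L : ℝ) ≤ (C₁ + 1) / ε := by
    have h4 : 1 ≤ 1 / ε := by
      rw [le_div_iff₀ hε]
      linarith
    have h5 := (abs_le.1 hL).2
    rw [add_div]
    linarith
  have hK' : (K : ℝ) ≤ D₂ * Real.log n := by
    have h5 := (abs_le.1 hK).2
    simp only [D₂, add_mul]
    linarith
  have hM' : (M : ℝ) ≤ D₃ * Real.log n := by
    have h5 := (abs_le.1 hM).2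
    have h6 : C₃ * K / Real.log (n * q) ≤ C₃ * (D₂ * Real.log n) / Real.log 2 := by gcongr
    have h7 : C₃ * (D₂ * Real.log n) / Real.log 2 = C₃ * D₂ / Real.log 2 * Real.log n := by ring
    simp only [D₃, add_mul]
    linarith
  rw [hN]
  push_cast
  calc ((K : ℝ) + M) * L ≤ (D₂ * Real.log n + D₃ * Real.log n) * ((C₁ + 1) / ε) := by gcongr
    _ = (D₂ + D₃) * (C₁ + 1) * (Real.log n / ε) := by ring

/-- `β ^ N = exp (N log β)` is a power of `n` once `N` is of order `log n / ε`, and `ε ≤ 1` lets `n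
^ 2` be raised to `n ^ (2 / ε)`. -/
theorem sq_mul_pow_le_rpow {β D ε : ℝ} {n N : ℕ} (hβ : 1 ≤ β) (hn : 0 < n) (hε : 0 < ε)
    (hε1 : ε ≤ 1) (hN : (N : ℝ) ≤ D * (Real.log n / ε)) :
    (n : ℝ) ^ 2 * β ^ N ≤ (n : ℝ) ^ ((2 + D * Real.log β) / ε) := by
  have hn1 : (1 : ℝ) ≤ n := by exact_mod_cast hn
  have hn0 : (0 : ℝ) < n := by linarith
  have hβ0 : 0 < β := by linarith
  have hlb := Real.log_nonneg hβ
  have hln := Real.log_nonneg hn1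
  have h1 : (n : ℝ) ^ 2 ≤ (n : ℝ) ^ (2 / ε) := by
    rw [← Real.rpow_natCast]
    refine Real.rpow_le_rpow_of_exponent_le hn1 ?_
    rw [le_div_iff₀ hε]
    push_cast
    linarith
  have h2 : β ^ N ≤ (n : ℝ) ^ (D * Real.log β / ε) := by
    rw [← Real.rpow_natCast, Real.rpow_def_of_pos hβ0, Real.rpow_def_of_pos hn0,
      Real.exp_le_exp]
    calc Real.log β * N ≤ Real.log β * (D * (Real.log n / ε)) := by gcongr
      _ = Real.log n * (D * Real.log β / ε) := by ring
  calc (n : ℝ) ^ 2 * β ^ N ≤ (n : ℝ) ^ (2 / ε) * (n : ℝ) ^ (D * Real.log β / ε) := by gcongr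
    _ = (n : ℝ) ^ ((2 + D * Real.log β) / ε) := by rw [← Real.rpow_add hn0, add_div]

theorem one_le_three_exp_div_otterConstant : 1 ≤ 3 * Real.exp 1 / otterConstant := by
  rw [le_div_iff₀ otterConstant_pos, one_mul]
  have := Real.exp_one_gt_two
  linarith [otterConstant_le_one]

end OtterMatching

/-! ### Assembly of correctness and the two running time bounds. -/

open OtterMatching
theorem mainTheorem9 :
    -- running time `O(n ^ 2 (3 e / α) ^ N)`, where `α` is Otter's constant
    (∃ α : ℝ, IsOtterConstant α ∧ ∃ C : ℝ, 0 < C ∧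
      ∀ n K L M N R : ℕ, 0 < n → 0 < K → 0 < L → 0 < M → N = (K + M) * L →
      ∀ (A B : SimpleGraph (Fin n)) (q : ℝ), 0 ≤ q → q ≤ 1 →
      ∀ μ ν : ℕ → Fin n → Fin (N + 1),
        (approxScores K L M N R (centered A q) (centered B q) μ ν).val =
          approxScore L M K R (centered A q) (centered B q) μ ν ∧
        ((approxScores K L M N R (centered A q) (centered B q) μ ν).time : ℝ) ≤
          C * ((n : ℝ) ^ 2 * (3 * Real.exp 1 / α) ^ N)) ∧
    -- running time `O(n ^ (c / ε))` for the simple choice of the parameters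
    (∀ C₁ C₂ C₃ C₄ : ℝ, 0 < C₁ → 0 < C₂ → 0 < C₃ → 0 < C₄ →
      ∃ c C : ℝ, 0 < c ∧ 0 < C ∧
      ∀ ε : ℝ, 0 < ε → ε ≤ 1 →
      ∀ (n : ℕ) (q : ℝ), 0 ≤ q → q ≤ 1 → 2 ≤ n * q →
      ∀ K L M N R : ℕ, 0 < K → 0 < L → 0 < M → N = (K + M) * L →
        IsSimpleChoice C₁ C₂ C₃ C₄ ε q n K L M R →
      ∀ (A B : SimpleGraph (Fin n)) (μ ν : ℕ → Fin n → Fin (N + 1)),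
        (approxScores K L M N R (centered A q) (centered B q) μ ν).val =
          approxScore L M K R (centered A q) (centered B q) μ ν ∧
        ((approxScores K L M N R (centered A q) (centered B q) μ ν).time : ℝ) ≤
          C * (n : ℝ) ^ (c / ε)) := by
  have hC : 0 < 10000 * chandelierFactor :=
    mul_pos (by norm_num) (zero_lt_one.trans_le one_le_chandelierFactor)
  constructor
  · refine ⟨otterConstant, isOtterConstant_otterConstant, _, hC, ?_⟩
    intro n K L M N R hn hK hL hM hN A B q _ _ μ ν
    exact ⟨val_approxScores hM hN (centered_symm A q) (centered_symm B q) μ ν,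
      time_approxScores_le_mul_pow hn hK hL hM hN _ _ μ ν⟩
  · intro C₁ C₂ C₃ C₄ h1 h2 h3 _
    obtain ⟨D, hD, h⟩ := IsSimpleChoice.edges_le (C₄ := C₄) h1 h2 h3
    have hβ := one_le_three_exp_div_otterConstant
    -- The exponent has `2` from `n ^ 2` and `D log β` from `β ^ N` with `β = 3 e / α`. Since `D`
    -- depends only on `C₁`, `C₂`, `C₃`, so does `c`.
    refine ⟨2 + D * Real.log (3 * Real.exp 1 / otterConstant), _,
      add_pos_of_pos_of_nonneg two_pos (mul_nonneg hD.le (Real.log_nonneg hβ)), hC, ?_⟩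
    intro ε hε hε1 n q _ hq hnq K L M N R hK hL hM hN hc A B μ ν
    have hn : 0 < n := by
      rcases Nat.eq_zero_or_pos n with rfl | hn
      · simp at hnq
        linarith
      · exact hn
    refine ⟨val_approxScores hM hN (centered_symm A q) (centered_symm B q) μ ν, ?_⟩
    refine (time_approxScores_le_mul_pow hn hK hL hM hN _ _ μ ν).trans ?_
    exact mul_le_mul_of_nonneg_left
      (sq_mul_pow_le_rpow hβ hn hε hε1 (h ε hε hε1 n q hq hnq K L M N R hN hc)) hC.le
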